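/- **Problem.** An instance of weighted Ultrametric Violation Distance with triangle inequality consists of $n\ge 0$ vertices, a symmetric positive input distance $x_{\rm in}(i,j)$ and a symmetric weight $w(i,j)\ge 0$ for every pair of distinct vertices, where $w(i,k)\le w(i,j)+w(j,k)$ for all distinct $i,j,k$. The cost of an ultrametric $x$ (symmetric, positive on distinct vertices, $x(i,k)\le\max\{x(i,j),x(j,k)\}$) is $\sum_{i<j} w(i,j)\mathbf 1[x(i,j)\ne x_{\rm in}(i,j)]$, and $\mathrm{OPT}$ is the minimum cost of an ultrametric. Let $d_1>\dots>d_L$ be the distinct input distances and $x_{\rm in}(i,j)=d_{\tilde\ell(i,j)}$. **Linear program.** Minimize $\sum_{i<j} w(i,j)\,(1-y_{\tilde\ell(i,j)}(i,j)+y_{\tilde\ell(i,j)-1}(i,j))$ over symmetric $y_\ell(i,j)\in[0,1]$, $1\le\ell\le L$, with $y_\ell(i,j)\le y_\ell(i,k)+y_\ell(k,j)$ and $y_{\ell-1}(i,j)\le y_\ell(i,j)$, where $y_0=0$ and $y_\ell(i,i)=0$. Let $y^*$ be an optimal solution with $y^*_L(i,j)=1$ for all $i\ne j$; such solutions exist.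 **Algorithm** (parameters $\alpha=\frac13$, $\beta=0$; access to $d_1,\dots,d_L$ and $y^*$). $\textsf{Pivot}(V,x,u)$: If $|V|\le 2$ or $u=L$, return $x$. Otherwise choose $i\in V$ uniformly at random and let $y$ be $y^*$ with $y_\ell$ replaced by $0$ for $\ell<u$. Independently for each $j\in V\setminus\{i\}$, let $\ell^*$ maximize $\Delta_\ell=y_\ell(i,j)-y_{\ell-1}(i,j)$; if $\Delta_{\ell^*}>1-\alpha$ set $x'(i,j)=d_{\ell^*}$, and otherwise draw $x'(i,j)$ from $\{d_1,\dots,d_L\}$ with $\Pr[x'(i,j)\ge d_\ell]=\frac{(y_\ell(i,j)-\alpha\beta)^+}{1-\alpha\beta}=y_\ell(i,j)$ for all $\ell$. For each pair $\{j,k\}\subseteq V\setminus\{i\}$ set $x'(j,k)=\min\{x(j,k),x'(i,j)\}$ if $x'(i,j)=x'(i,k)$, and $x'(j,k)=\max\{x'(i,j),x'(i,k)\}$ otherwise. For $\ell=u,\dots,L$ let $V_\ell=\{j\in V\setminus\{i\}: x'(i,j)=d_\ell\}$ and replace $x'$ on the pairs in $V_\ell$ by $\textsf{Pivot}(V_\ell,x'|_{V_\ell},\ell)$.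 Return $x'$. The algorithm is run as $\textsf{Pivot}([n],x_{\rm in},1)$. **Theorem.** There are an absolute constant $C$ and a polynomial $p$ such that for every such instance and every such $y^*$ the following holds. Every run of the algorithm outputs an ultrametric after at most $p(n)$ elementary steps (on a random access machine with real numbers, where reading or writing a cell, an arithmetic operation, a comparison, advancing a loop, drawing a random vertex are one step each, and drawing a level from a table of $L+1$ probabilities takes $L+1$ steps), and the expected cost of the output is at most $C\cdot\min\{L,\log n\}\cdot\mathrm{OPT}$. -/

import Mathlib

open scoped ENNReal

noncomputable section

namespace UMVD

/-! ## The problem -/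

/-- A value for every unordered pair of vertices `s(i, j)`. -/
abbrev PairFun (n : ℕ) : Type := Sym2 (Fin n) → ℝ

/-- The pairs of distinct vertices. -/
def edges (n : ℕ) : Finset (Sym2 (Fin n)) := Finset.univ.filter fun e => ¬ e.IsDiag

/-- Ultrametrics on the vertex set `Fin n` (symmetric because they live on unordered pairs). -/
structure IsUltrametric {n : ℕ} (x : PairFun n) : Prop where
  self_zero : ∀ i, x s(i, i) = 0
  pos : ∀ i j, i ≠ j → 0 < x s(i, j)
  ultra : ∀ i j k, x s(i, k) ≤ max (x s(i, j)) (x s(j, k))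

/-- A weighted instance whose weights satisfy the triangle inequality: positive input distances
and nonnegative weights on all pairs of distinct vertices. -/
structure Instance (n : ℕ) where
  /-- input distances -/
  x : PairFun n
  /-- weights -/
  w : PairFun n
  x_self : ∀ i, x s(i, i) = 0
  x_pos : ∀ i j, i ≠ j → 0 < x s(i, j)
  w_nonneg : ∀ i j, i ≠ j → 0 ≤ w s(i, j)
  w_triangle : ∀ i j k, i ≠ j → j ≠ k → i ≠ k → w s(i, k) ≤ w s(i, j) + w s(j, k)

namespace Instance

variable {n : ℕ} (I : Instance n)

/-- The weighted disagreement of `z` with the input distances. -/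
def cost (z : PairFun n) : ℝ :=
  ∑ e ∈ edges n, if z e ≠ I.x e then I.w e else 0

/-- The optimal value: the least disagreement of an ultrametric with the input. -/
def opt : ℝ := sInf {c | ∃ z : PairFun n, IsUltrametric z ∧ I.cost z = c}

/-- The distinct input distances in decreasing order. -/
def distances : List ℝ := ((edges n).image I.x).sort (fun a b => a ≥ b)

/-- The number of distinct input distances. -/
def numLevels : ℕ := ((edges n).image I.x).card

/-- `d_ℓ`, the `ℓ`-th largest input distance, for `1 ≤ ℓ ≤ L`. -/
def d (ℓ : ℕ) : ℝ := I.distances.getD (ℓ - 1) 0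

/-- The level of the input distance of a pair, so that `I.d (I.level e) = I.x e`. -/
def level (e : Sym2 (Fin n)) : ℕ := I.distances.idxOf (I.x e) + 1

/-! ## The linear program -/

/-- Feasible solutions. The variables are `y ℓ s(i, j)` for `1 ≤ ℓ ≤ L` and `i ≠ j`; the values at
`ℓ = 0` and at `i = j` are zero by convention. -/
structure LPFeasible (y : ℕ → PairFun n) : Prop where
  level_zero : ∀ e, y 0 e = 0
  diag_zero : ∀ ℓ i, y ℓ s(i, i) = 0
  triangle : ∀ ℓ, 1 ≤ ℓ → ℓ ≤ I.numLevels → ∀ i j k, y ℓ s(i, j) ≤ y ℓ s(i, k) + y ℓ s(k, j)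
  mono : ∀ ℓ, 1 ≤ ℓ → ℓ ≤ I.numLevels → ∀ i j, y (ℓ - 1) s(i, j) ≤ y ℓ s(i, j)
  nonneg : ∀ ℓ, 1 ≤ ℓ → ℓ ≤ I.numLevels → ∀ i j, 0 ≤ y ℓ s(i, j)
  le_one : ∀ ℓ, 1 ≤ ℓ → ℓ ≤ I.numLevels → ∀ i j, y ℓ s(i, j) ≤ 1

/-- The objective function. -/
def lpObjective (y : ℕ → PairFun n) : ℝ :=
  ∑ e ∈ edges n, I.w e * (1 - y (I.level e) e + y (I.level e - 1) e)

/-- Optimal solutions that satisfy `y_L(i, j) = 1` for all pairs of distinct vertices. -/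
structure LPOptimal (y : ℕ → PairFun n) : Prop where
  feasible : I.LPFeasible y
  optimal : ∀ y', I.LPFeasible y' → I.lpObjective y ≤ I.lpObjective y'
  top_one : ∀ i j, i ≠ j → y I.numLevels s(i, j) = 1

end Instance

/-! ## Randomized computations with a step counter

The model is a real random access machine: memory cells hold real numbers or vertices, a step
reads or writes a cell, performs one arithmetic operation or comparison on reals or indices,
advances a loop, or draws a random vertex. Tables are arrays that are updated in place, and a
computation threads the number of steps performed so far. -/

/-- A randomized computation with a step counter. -/
abbrev Comp (α : Type) : Type := StateT ℕ PMF α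

/-- Spend `k` steps. -/
def charge (k : ℕ) : Comp Unit := modify fun s => s + k

/-- One elementary operation with result `a`. -/
def op {α : Type} (a : α) : Comp α := do
  charge 1
  pure a

/-- A loop through `l` that starts in state `s`; every iteration spends a step on the loop counter,
in addition to the steps of its body. -/
def forEach {ι σ : Type} (l : List ι) (s : σ) (body : σ → ι → Comp σ) : Comp σ :=
  l.foldlM (fun t a => do
    charge 1
    body t a) s

/-- Read a cell of a table of reals. -/
def read {ι : Type} (t : ι → ℝ) (a : ι) : Comp ℝ := op (t a)

/-- Write a cell of a table of reals. -/
def write {ι : Type} [DecidableEq ι] (t : ι → ℝ) (a : ι) (v : ℝ) : Comp (ι → ℝ) :=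
  op (Function.update t a v)

/-- Subtraction. -/
def sub (a b : ℝ) : Comp ℝ := op (a - b)
/-- Multiplication. -/
def mul (a b : ℝ) : Comp ℝ := op (a * b)
/-- Division. -/
def div (a b : ℝ) : Comp ℝ := op (a / b)
/-- Maximum. -/
def maxR (a b : ℝ) : Comp ℝ := op (max a b)
/-- Minimum. -/
def minR (a b : ℝ) : Comp ℝ := op (min a b)
open Classical in
/-- Strict comparison. -/
def ltR (a b : ℝ) : Comp Bool := op (decide (a < b))
open Classical in
/-- Test for equality. -/
def eqR (a b : ℝ) : Comp Bool := op (decide (a = b))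

/-- Draw a uniformly random vertex of a nonempty list. -/
def pick {n : ℕ} (V : List (Fin n)) (h : V ≠ []) : Comp (Fin n) := do
  charge 1
  StateT.lift (PMF.uniformOfFinset V.toFinset (List.toFinset_nonempty_iff V |>.mpr h))

open Classical in
/-- The distribution on the levels `1, …, L` that gives `ℓ` the probability `F ℓ - F (ℓ - 1)`,
that is, `Pr[level ≤ ℓ] = F ℓ`. (If `F` does not define a distribution, a point mass.) -/
def levelPMF (L : ℕ) (F : ℕ → ℝ) : PMF ℕ :=
  if h : ∑ ℓ ∈ Finset.Icc 1 L, ENNReal.ofReal (F ℓ - F (ℓ - 1)) = 1 then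
    PMF.ofFinset (fun ℓ => if ℓ ∈ Finset.Icc 1 L then ENNReal.ofReal (F ℓ - F (ℓ - 1)) else 0)
      (Finset.Icc 1 L)
      ((Finset.sum_congr rfl fun _ hℓ => if_pos hℓ).trans h)
      (fun _ hℓ => if_neg hℓ)
  else PMF.pure L

/-- Draw a random level from a table of `L` cumulative probabilities, with one step for each entry
of the table. -/
def drawLevel (L : ℕ) (F : ℕ → ℝ) : Comp ℕ := do
  charge (L + 1)
  StateT.lift (levelPMF L F)

/-- The pairs of entries at different positions of a list, each position pair once. -/
def pairs {α : Type} : List α → List (α × α)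
  | [] => []
  | a :: l => l.map (fun b => (a, b)) ++ pairs l

/-! ## The pivot algorithm -/

section Algorithm

variable {n : ℕ}

/-- The increment `Δy_ℓ(i, j)`. -/
def increment (y : ℕ × Sym2 (Fin n) → ℝ) (e : Sym2 (Fin n)) (ℓ : ℕ) : Comp ℝ := do
  let a ← read y (ℓ, e)
  let b ← read y (ℓ - 1, e)
  sub a b

/-- The solution `y*`, copied, with the values on the levels below `u` set to zero for the pairs
in `V`. -/
def truncate (L : ℕ) (ystar : ℕ × Sym2 (Fin n) → ℝ) (V : List (Fin n)) (u : ℕ) :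
    Comp (ℕ × Sym2 (Fin n) → ℝ) := do
  -- the table has at most `n * n` pairs on each of the levels `0, …, L`
  charge ((L + 1) * (n * n))
  forEach (pairs V) ystar fun y p =>
    forEach (List.range' 1 (u - 1)) y fun y ℓ => write y (ℓ, s(p.1, p.2)) 0

/-- A level `ℓ` in `1, …, L` with the largest increment, and that increment. (Of several such
levels the smallest; the algorithm uses the level only if its increment exceeds `1 - α ≥ 1 / 2`,
and then it is the only one.) -/
def dominant (L : ℕ) (y : ℕ × Sym2 (Fin n) → ℝ) (e : Sym2 (Fin n)) : Comp (ℕ × ℝ) := do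
  let v ← increment y e 1
  forEach (List.range' 2 (L - 1)) (1, v) fun best ℓ => do
    let v ← increment y e ℓ
    if ← ltR best.2 v then pure (ℓ, v) else pure best

/-- The table of the probabilities `Pr[x'(e) ≥ d_ℓ] = (y_ℓ(e) - αβ)⁺ / (1 - αβ)`, for `ℓ` from
`0` to `L`. -/
def ccdf (α β : ℝ) (L : ℕ) (y : ℕ × Sym2 (Fin n) → ℝ) (e : Sym2 (Fin n)) : Comp (ℕ → ℝ) :=
  forEach (List.range' 0 (L + 1)) (fun _ => 0) fun F ℓ => do
    let c ← mul α β
    let a ← read y (ℓ, e)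
    let a ← sub a c
    let a ← maxR a 0
    let b ← sub 1 c
    let a ← div a b
    write F ℓ a

/-- The level chosen for the pivot edge `e`: the dominant level if `e` is deterministic, a random
level otherwise. -/
def pivotLevel (α β : ℝ) (L : ℕ) (y : ℕ × Sym2 (Fin n) → ℝ) (e : Sym2 (Fin n)) : Comp ℕ := do
  let best ← dominant L y e
  let t ← sub 1 α
  if ← ltR t best.2 then
    pure best.1
  else
    let F ← ccdf α β L y e
    drawLevel L F

/-- The new distance of the non-pivot edge between `j` and `k`. The cell of `x'` for this edge
still holds its distance in the input of the call. -/
def fixEdge (i : Fin n) (x' : PairFun n) (j k : Fin n) : Comp (PairFun n) := do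
  let a ← read x' s(i, j)
  let b ← read x' s(i, k)
  if ← eqR a b then
    let c ← read x' s(j, k)
    let c ← minR c a
    write x' s(j, k) c
  else
    let c ← maxR a b
    write x' s(j, k) c

/-- The vertices `j` among `W` with `x'(i, j) = d_ℓ`. -/
def part (d : ℕ → ℝ) (i : Fin n) (x' : PairFun n) (W : List (Fin n)) (ℓ : ℕ) :
    Comp (List (Fin n)) :=
  forEach W [] fun acc j => do
    let a ← read x' s(i, j)
    let b ← read d ℓ
    if ← eqR a b then op (j :: acc) else pure acc

/-- The vertices of `V` other than `i`. -/
def remove (i : Fin n) (V : List (Fin n)) : Comp (List (Fin n)) :=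
  forEach V [] fun acc j => do
    if ← op (decide (j = i)) then pure acc else op (j :: acc)

/-- The recursive pivot algorithm for instances with all distances specified. A call gets the
vertices `V`, the distances `x` and the upper bound level `u`; it changes the distances of the pairs
in `V` in place and leaves all others alone. The first argument bounds the depth of the recursion.
A child call has fewer vertices than its parent, so a bound of at least the number of vertices is
never reached. -/
def pivot (α β : ℝ) (L : ℕ) (d : ℕ → ℝ) (ystar : ℕ × Sym2 (Fin n) → ℝ) :
    ℕ → List (Fin n) → PairFun n → ℕ → Comp (PairFun n)
  | 0, _, x, _ => pure x
  | depth + 1, V, x, u => do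
    charge 1
    if h : V.length ≤ 2 ∨ u = L then
      pure x
    else
      let i ← pick V (by rintro rfl; simp at h)
      let W ← remove i V
      let y ← truncate L ystar V u
      let x' ← forEach W x fun x' j => do
        let ℓ ← pivotLevel α β L y s(i, j)
        let v ← read d ℓ
        write x' s(i, j) v
      let x' ← forEach (pairs W) x' fun x' p => fixEdge i x' p.1 p.2
      forEach (List.range' u (L + 1 - u)) x' fun x' ℓ => do
        let Vℓ ← part d i x' W ℓ
        pivot α β L d ystar depth Vℓ x' ℓ

/-- The root call of the algorithm with parameters `α`, `β` on an instance, with access to the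
distinct distances of the instance and to the solution `y` of the linear program. The result is the
joint distribution of the output and of the number of steps. -/
def algorithm (α β : ℝ) (I : Instance n) (y : ℕ → PairFun n) : PMF (PairFun n × ℕ) :=
  (pivot α β I.numLevels I.d (fun q => y q.1 q.2) n (List.finRange n) I.x 1).run 0

/-- The expected disagreement of a random output with the input distances. -/
def expectedCost (I : Instance n) (P : PMF (PairFun n × ℕ)) : ℝ≥0∞ :=
  ∑' r, P r * ENNReal.ofReal (I.cost r.1)

end Algorithm

end UMVD

end

noncomputable section

namespace UMVD

/-! ## A program logic for randomized computations with a step counter -/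

/-! Let `lp e` be the share 1 - y_ℓ(e) + y_{ℓ-1}(e) of an edge in the LP objective, ℓ being its
input level. Edges with `lp e ≥ 1/3` can all be given up at the price of a factor 3. A good edge
(`lp e < 1/3`) has mass above 2/3 on its input level. If that level is at least the bound `u` of the
current call, the edge is rounded deterministically to its input distance when it is a pivot edge,
and otherwise it changes only if the levels of the two pivot edges do not form an ultrametric
triangle with it.

Charging (`wrongProb_le`, `weighted_wrongProb_le`): for a pivot i and a good edge jk, three
concentrated edges always fit together by the LP triangle inequality. Otherwise the error
probability is at most 9 times what jk pays for being separated by i, plus what ij pays as if k were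
the pivot. By symmetry the same holds with ik and pivot j, and the triangle inequality for weights
turns the smaller of the two payments into weighted payments of ij and ik. An edge pays `lp` times
the probability that the pivot separates it, plus `lp` if the pivot is eligible, that is, sends both
endpoints with certainty to one level above `u`.

Potential (`IsPotential`, `edge_budget`): every ordered pair holds the budget 27·w·lp·(1 + f(E)),
where E is its set of eligible pivots. Separation releases the whole budget, since the endpoints
never meet again. An eligible pivot keeps them together but raises `u` to its own level, which
removes from E all vertices of no larger level; averaged over E this lowers f by at least one. Both
the harmonic number of |E| and the number of distinct levels in E are such potentials, bounded by 2
log n (for n ≥ 3) and by L. Hence good cost plus remaining budget does not increase in expectation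
(`sum_levelExp_roundBound`), and the root budget is O(min{L, log n}) times the LP value, which is at
most `opt`.

The ultrametric property and the step bound hold on every run. They are proved in the same induction
on recursion depth (`pivotSpec`), through triples that combine a step bound, a postcondition and an
expectation bound. -/

/-- Every run of `c` ends in a result that satisfies `Q`, after at most `T` steps, and the expected
value of `g` at the result is at most `b`. -/
def Triple {α : Type} (c : Comp α) (T : ℕ) (Q : α → Prop) (g : α → ℝ) (b : ℝ) : Prop :=
  ∀ s, (∀ r ∈ (c.run s).support, Q r.1 ∧ r.2 ≤ s + T) ∧
    ∑' r, c.run s r * ENNReal.ofReal (g r.1) ≤ ENNReal.ofReal b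

/-- The computation `c` is deterministic, takes at most `T` steps and its result satisfies `Q`. -/
def Det {α : Type} (c : Comp α) (T : ℕ) (Q : α → Prop) : Prop :=
  ∃ a, Q a ∧ ∀ s, ∃ t ≤ T, c.run s = PMF.pure (a, s + t)

section Logic

variable {α β ι : Type}

/-- The tower rule: `g` is the expected cost still to come after `c`, so bounding it before `c`
bounds the final expectation. -/
theorem Triple.bind {c : Comp α} {k : α → Comp β} {T T' : ℕ} {Q : α → Prop} {Q' : β → Prop}
    {g : α → ℝ} {g' : β → ℝ} {b : ℝ} (hc : Triple c T Q g b)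
    (hk : ∀ a, Q a → Triple (k a) T' Q' g' (g a)) : Triple (c >>= k) (T + T') Q' g' b := by
  intro s
  have hrun : (c >>= k).run s = (c.run s).bind fun p => (k p.1).run p.2 := rfl
  refine ⟨?_, ?_⟩
  · intro r hr
    rw [hrun, PMF.mem_support_bind_iff] at hr
    obtain ⟨p, hp, hr⟩ := hr
    obtain ⟨h1, h2⟩ := (hc s).1 p hp
    obtain ⟨h3, h4⟩ := (hk p.1 h1 p.2).1 r hr
    exact ⟨h3, by omega⟩
  · rw [hrun]
    calc ∑' r, (c.run s).bind (fun p => (k p.1).run p.2) r * ENNReal.ofReal (g' r.1)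
        = ∑' r, ∑' p, c.run s p * ((k p.1).run p.2 r * ENNReal.ofReal (g' r.1)) := by
          refine tsum_congr fun r => ?_
          rw [PMF.bind_apply, ← ENNReal.tsum_mul_right]
          exact tsum_congr fun p => mul_assoc _ _ _
      _ = ∑' p, c.run s p * ∑' r, (k p.1).run p.2 r * ENNReal.ofReal (g' r.1) := by
          rw [ENNReal.tsum_comm]
          exact tsum_congr fun p => ENNReal.tsum_mul_left
      _ ≤ ∑' p, c.run s p * ENNReal.ofReal (g p.1) := by
          refine ENNReal.tsum_le_tsum fun p => ?_
          by_cases hp : c.run s p = 0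
          · simp [hp]
          · exact mul_le_mul_right ((hk p.1 ((hc s).1 p ((PMF.mem_support_iff _ _).2 hp)).1 p.2).2) _
      _ ≤ _ := (hc s).2

theorem Triple.mono {c : Comp α} {T T' : ℕ} {Q Q' : α → Prop} {g : α → ℝ} {b b' : ℝ}
    (hc : Triple c T Q g b) (hT : T ≤ T') (hQ : ∀ a, Q a → Q' a) (hb : b ≤ b') :
    Triple c T' Q' g b' := fun s =>
  ⟨fun r hr => ⟨hQ _ ((hc s).1 r hr).1, ((hc s).1 r hr).2.trans (by omega)⟩,
    (hc s).2.trans (ENNReal.ofReal_le_ofReal hb)⟩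

theorem Triple.mono_right {c : Comp α} {T : ℕ} {Q : α → Prop} {g g' : α → ℝ} {b : ℝ}
    (hc : Triple c T Q g b) (hg : ∀ a, g' a ≤ g a) : Triple c T Q g' b := fun s =>
  ⟨(hc s).1, (ENNReal.tsum_le_tsum fun r : α × ℕ =>
    mul_le_mul_right (ENNReal.ofReal_le_ofReal (hg r.1)) _).trans (hc s).2⟩

/-- Carries the budget of the calls still to come through a recursive call. The signs matter because
`ENNReal.ofReal` cuts negative values off at zero. -/
theorem Triple.add_const {c : Comp α} {T : ℕ} {Q : α → Prop} {g : α → ℝ} {b C : ℝ}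
    (hc : Triple c T Q g b) (hb : 0 ≤ b) (hC : 0 ≤ C) :
    Triple c T Q (fun a => g a + C) (b + C) := fun s => by
  refine ⟨(hc s).1, ?_⟩
  calc ∑' r, c.run s r * ENNReal.ofReal (g r.1 + C)
      ≤ ∑' r, (c.run s r * ENNReal.ofReal (g r.1) + c.run s r * ENNReal.ofReal C) :=
        ENNReal.tsum_le_tsum fun r => by
          rw [← mul_add]
          exact mul_le_mul_right ENNReal.ofReal_add_le _
    _ = ∑' r, c.run s r * ENNReal.ofReal (g r.1) + ENNReal.ofReal C := by
        rw [ENNReal.tsum_add, ENNReal.tsum_mul_right, PMF.tsum_coe, one_mul]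
    _ ≤ _ := by
        rw [ENNReal.ofReal_add hb hC]
        exact add_le_add (hc s).2 le_rfl

theorem Det.triple {c : Comp α} {T : ℕ} {Q : α → Prop} {g : α → ℝ} {b : ℝ}
    (hc : Det c T Q) (hb : ∀ a, Q a → g a ≤ b) : Triple c T Q g b := by
  obtain ⟨a, ha, hrun⟩ := hc
  intro s
  obtain ⟨t, ht, h⟩ := hrun s
  rw [h]
  refine ⟨?_, ?_⟩
  · intro r hr
    rw [PMF.mem_support_pure_iff] at hr
    subst hr
    exact ⟨ha, by simpa using ht⟩
  · rw [tsum_eq_single (a, s + t)]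
    · simpa using ENNReal.ofReal_le_ofReal (hb a ha)
    · intro r hr
      simp [PMF.pure_apply, hr]

theorem Det.bind_triple {c : Comp α} {k : α → Comp β} {T T' : ℕ} {Q : α → Prop} {Q' : β → Prop}
    {g' : β → ℝ} {b : ℝ} (hc : Det c T Q)
    (hk : ∀ a, Q a → Triple (k a) T' Q' g' b) : Triple (c >>= k) (T + T') Q' g' b :=
  Triple.bind (g := fun _ => b) (hc.triple fun _ _ => le_rfl) hk

theorem Det.bind {c : Comp α} {k : α → Comp β} {T T' : ℕ} {Q : α → Prop} {Q' : β → Prop}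
    (hc : Det c T Q) (hk : ∀ a, Q a → Det (k a) T' Q') : Det (c >>= k) (T + T') Q' := by
  obtain ⟨a, ha, hrun⟩ := hc
  obtain ⟨a', ha', hrun'⟩ := hk a ha
  refine ⟨a', ha', fun s => ?_⟩
  obtain ⟨t, ht, h⟩ := hrun s
  obtain ⟨t', ht', h'⟩ := hrun' (s + t)
  refine ⟨t + t', by omega, ?_⟩
  have : (c >>= k).run s = (c.run s).bind fun p => (k p.1).run p.2 := rfl
  rw [this, h, PMF.pure_bind, h', add_assoc]

theorem Det.mono {c : Comp α} {T T' : ℕ} {Q Q' : α → Prop} (hc : Det c T Q) (hT : T ≤ T')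
    (hQ : ∀ a, Q a → Q' a) : Det c T' Q' := by
  obtain ⟨a, ha, hrun⟩ := hc
  refine ⟨a, hQ a ha, fun s => ?_⟩
  obtain ⟨t, ht, h⟩ := hrun s
  exact ⟨t, ht.trans hT, h⟩

theorem det_pure {Q : α → Prop} {a : α} (h : Q a) : Det (pure a) 0 Q :=
  ⟨a, h, fun _ => ⟨0, le_rfl, rfl⟩⟩

theorem det_charge (k : ℕ) : Det (charge k) k fun _ => True :=
  ⟨(), trivial, fun _ => ⟨k, le_rfl, rfl⟩⟩

theorem det_op (a : α) : Det (op a) 1 (· = a) :=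
  (det_charge 1).bind (T' := 0) fun _ _ => det_pure rfl

theorem det_read (t : ι → ℝ) (a : ι) : Det (read t a) 1 (· = t a) := det_op _

theorem det_write [DecidableEq ι] (t : ι → ℝ) (a : ι) (v : ℝ) :
    Det (write t a v) 1 (· = Function.update t a v) := det_op _

theorem det_forEach {σ : Type} {body : σ → ι → Comp σ} {T : ℕ} (Inv : List ι → σ → Prop)
    (hbody : ∀ a l t, Inv (a :: l) t → Det (body t a) T (Inv l)) :
    ∀ l s, Inv l s → Det (forEach l s body) (l.length * (T + 1)) (Inv [])
  | [], s, h => by simpa [forEach] using det_pure h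
  | a :: l, s, h => by
    have : forEach (a :: l) s body =
        (charge 1 >>= fun _ => body s a) >>= fun t => forEach l t body := by
      simp [forEach, List.foldlM_cons]
    rw [this]
    refine (((det_charge 1).bind fun _ _ => hbody a l s h).bind fun t ht =>
      det_forEach Inv hbody l t ht).mono ?_ fun _ h => h
    simp only [List.length_cons]
    ring_nf
    omega

/-- `G l` is a potential for the state with `l` still unprocessed, and the bounds telescope along
the list. The time depends on the element because recursive calls are charged by the size of their
class. -/
theorem triple_forEach {σ : Type} {body : σ → ι → Comp σ} {T : ι → ℕ}
    (Inv : List ι → σ → Prop) (G : List ι → σ → ℝ)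
    (hbody : ∀ a l t, Inv (a :: l) t → Triple (body t a) (T a) (Inv l) (G l) (G (a :: l) t)) :
    ∀ l s, Inv l s →
      Triple (forEach l s body) (l.map fun a => T a + 1).sum (Inv []) (G []) (G l s)
  | [], s, h => by
    simpa [forEach] using ((det_pure (Q := fun a => a = s ∧ Inv [] a) ⟨rfl, h⟩).triple
      (g := G []) (b := G [] s) (by rintro a ⟨rfl, -⟩; exact le_rfl)).mono le_rfl
      (fun _ h => h.2) le_rfl
  | a :: l, s, h => by
    have : forEach (a :: l) s body =
        (charge 1 >>= fun _ => body s a) >>= fun t => forEach l t body := by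
      simp [forEach, List.foldlM_cons]
    rw [this]
    refine (((det_charge 1).bind_triple fun _ _ => hbody a l s h).bind fun t ht =>
      triple_forEach Inv G hbody l t ht).mono ?_ (fun _ h => h) le_rfl
    simp only [List.map_cons, List.sum_cons]
    omega

end Logic

/-! ### The random primitives. -/

theorem triple_pick {n : ℕ} (V : List (Fin n)) (h : V ≠ []) (g : Fin n → ℝ)
    (hg : ∀ i ∈ V, 0 ≤ g i) :
    Triple (pick V h) 1 (· ∈ V) g ((∑ i ∈ V.toFinset, g i) / V.toFinset.card) := by
  have hne : V.toFinset.Nonempty := (List.toFinset_nonempty_iff V).2 h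
  refine (det_charge 1).bind_triple (T' := 0) fun _ _ s => ?_
  have hrun : (StateT.lift (PMF.uniformOfFinset V.toFinset hne) : Comp (Fin n)).run s
      = (PMF.uniformOfFinset V.toFinset hne).bind fun i => PMF.pure (i, s) := rfl
  rw [hrun]
  refine ⟨?_, ?_⟩
  · intro r hr
    rw [PMF.mem_support_bind_iff] at hr
    obtain ⟨i, hi, hr⟩ := hr
    rw [PMF.mem_support_pure_iff] at hr
    subst hr
    simpa using hi
  · have hcard : (0 : ℝ) < V.toFinset.card := by exact_mod_cast hne.card_pos
    calc ∑' r, ((PMF.uniformOfFinset V.toFinset hne).bind fun i => PMF.pure (i, s)) r *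
            ENNReal.ofReal (g r.1)
        = ∑' i, PMF.uniformOfFinset V.toFinset hne i * ENNReal.ofReal (g i) := by
          simp_rw [PMF.bind_apply, ← ENNReal.tsum_mul_right]
          rw [ENNReal.tsum_comm]
          refine tsum_congr fun i => ?_
          rw [tsum_eq_single (i, s)]
          · simp
          · intro r hr
            simp [PMF.pure_apply, hr]
      _ = ∑ i ∈ V.toFinset, (V.toFinset.card : ℝ≥0∞)⁻¹ * ENNReal.ofReal (g i) := by
          rw [tsum_eq_sum (s := V.toFinset)]
          · refine Finset.sum_congr rfl fun i hi => ?_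
            rw [PMF.uniformOfFinset_apply_of_mem hne hi]
          · intro i hi
            rw [PMF.uniformOfFinset_apply_of_notMem hne hi, zero_mul]
      _ = ENNReal.ofReal ((∑ i ∈ V.toFinset, g i) / V.toFinset.card) := by
          rw [← Finset.mul_sum, ← ENNReal.ofReal_sum_of_nonneg fun i hi => hg i (by simpa using hi),
            ENNReal.ofReal_div_of_pos hcard, ENNReal.ofReal_natCast, ENNReal.div_eq_inv_mul]
      _ ≤ _ := le_rfl

/-- A random level that is drawn from a table of cumulative probabilities. -/
theorem triple_drawLevel (L : ℕ) (F : ℕ → ℝ) (g : ℕ → ℝ) (hF : ∀ ℓ ∈ Finset.Icc 1 L, F (ℓ - 1) ≤ F ℓ)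
    (h0 : F 0 = 0) (h1 : F L = 1) (hg : ∀ ℓ ∈ Finset.Icc 1 L, 0 ≤ g ℓ) :
    Triple (drawLevel L F) (L + 1) (fun ℓ => ℓ ∈ Finset.Icc 1 L ∧ 0 < F ℓ - F (ℓ - 1)) g
      (∑ ℓ ∈ Finset.Icc 1 L, (F ℓ - F (ℓ - 1)) * g ℓ) := by
  have htel : ∀ M, ∑ ℓ ∈ Finset.Icc 1 M, (F ℓ - F (ℓ - 1)) = F M - F 0 := by
    intro M
    induction M with
    | zero => simp
    | succ M ih => rw [Finset.sum_Icc_succ_top (by omega), ih]; simp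
  have hnn : ∀ ℓ ∈ Finset.Icc 1 L, 0 ≤ F ℓ - F (ℓ - 1) := fun ℓ hℓ => sub_nonneg.2 (hF ℓ hℓ)
  have hsum : ∑ ℓ ∈ Finset.Icc 1 L, ENNReal.ofReal (F ℓ - F (ℓ - 1)) = 1 := by
    rw [← ENNReal.ofReal_sum_of_nonneg hnn, htel, h0, h1]
    simp
  have happ : ∀ ℓ, levelPMF L F ℓ =
      if ℓ ∈ Finset.Icc 1 L then ENNReal.ofReal (F ℓ - F (ℓ - 1)) else 0 := by
    intro ℓ
    rw [levelPMF, dif_pos hsum, PMF.ofFinset_apply]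
  refine ((det_charge (L + 1)).bind_triple (T' := 0) fun _ _ s => ?_).mono (by omega)
    (fun _ h => h) le_rfl
  have hrun : (StateT.lift (levelPMF L F) : Comp ℕ).run s
      = (levelPMF L F).bind fun i => PMF.pure (i, s) := rfl
  rw [hrun]
  refine ⟨?_, ?_⟩
  · intro r hr
    rw [PMF.mem_support_bind_iff] at hr
    obtain ⟨i, hi, hr⟩ := hr
    rw [PMF.mem_support_pure_iff] at hr
    subst hr
    rw [PMF.mem_support_iff, happ] at hi
    by_cases hm : i ∈ Finset.Icc 1 L
    · rw [if_pos hm] at hi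
      exact ⟨⟨hm, by simpa using hi⟩, le_rfl⟩
    · simp [hm] at hi
  · calc ∑' r, ((levelPMF L F).bind fun i => PMF.pure (i, s)) r * ENNReal.ofReal (g r.1)
        = ∑' i, levelPMF L F i * ENNReal.ofReal (g i) := by
          simp_rw [PMF.bind_apply, ← ENNReal.tsum_mul_right]
          rw [ENNReal.tsum_comm]
          refine tsum_congr fun i => ?_
          rw [tsum_eq_single (i, s)]
          · simp
          · intro r hr
            simp [PMF.pure_apply, hr]
      _ = ∑ i ∈ Finset.Icc 1 L, ENNReal.ofReal ((F i - F (i - 1)) * g i) := by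
          rw [tsum_eq_sum (s := Finset.Icc 1 L)]
          · refine Finset.sum_congr rfl fun i hi => ?_
            rw [happ, if_pos hi, ENNReal.ofReal_mul (hnn i hi)]
          · intro i hi
            rw [happ, if_neg hi, zero_mul]
      _ = _ := by
          rw [← ENNReal.ofReal_sum_of_nonneg fun i hi => mul_nonneg (hnn i hi) (hg i hi)]
      _ ≤ _ := le_rfl

/-! ## The deterministic parts of the algorithm -/

theorem length_pairs_le {α : Type} : ∀ l : List α, (pairs l).length ≤ l.length * l.length
  | [] => by simp [pairs]
  | a :: l => by
    have := length_pairs_le l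
    simp only [pairs, List.length_append, List.length_map, List.length_cons]
    nlinarith

theorem mem_of_mem_pairs {α : Type} {p : α × α} :
    ∀ {l : List α}, p ∈ pairs l → p.1 ∈ l ∧ p.2 ∈ l
  | [], h => by simp [pairs] at h
  | a :: l, h => by
    simp only [pairs, List.mem_append, List.mem_map] at h
    rcases h with ⟨b, hb, rfl⟩ | h
    · simp [hb]
    · have := mem_of_mem_pairs h
      simp [this]

theorem ne_of_mem_pairs {α : Type} {p : α × α} :
    ∀ {l : List α}, l.Nodup → p ∈ pairs l → p.1 ≠ p.2
  | [], _, h => by simp [pairs] at h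
  | a :: l, hl, h => by
    simp only [pairs, List.mem_append, List.mem_map] at h
    rw [List.nodup_cons] at hl
    rcases h with ⟨b, hb, rfl⟩ | h
    · intro (h : a = b)
      exact hl.1 (h ▸ hb)
    · exact ne_of_mem_pairs hl.2 h

theorem mem_pairs_or {α : Type} {a b : α} (hab : a ≠ b) :
    ∀ {l : List α}, a ∈ l → b ∈ l → (a, b) ∈ pairs l ∨ (b, a) ∈ pairs l
  | [], h, _ => by simp at h
  | c :: l, ha, hb => by
    simp only [pairs, List.mem_append, List.mem_map, Prod.mk.injEq]
    rw [List.mem_cons] at ha hb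
    rcases ha with rfl | ha
    · rcases hb with rfl | hb
      · exact absurd rfl hab
      · exact Or.inl (Or.inl ⟨b, hb, rfl, rfl⟩)
    · rcases hb with rfl | hb
      · exact Or.inr (Or.inl ⟨a, ha, rfl, rfl⟩)
      · rcases mem_pairs_or hab ha hb with h | h
        · exact Or.inl (Or.inr h)
        · exact Or.inr (Or.inr h)

variable {n : ℕ}

theorem det_remove (i : Fin n) (V : List (Fin n)) (hV : V.Nodup) :
    Det (remove i V) (V.length * 3) fun W => W.Nodup ∧ ∀ j, j ∈ W ↔ j ∈ V ∧ j ≠ i := by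
  refine (det_forEach (T := 2) (fun l acc => (l ++ acc).Nodup ∧ i ∉ acc ∧
    ∀ j, j ≠ i → (j ∈ V ↔ j ∈ l ∨ j ∈ acc)) ?_ V [] ⟨by simpa using hV, by simp, by simp⟩).mono
    le_rfl ?_
  · rintro a l acc ⟨h1, h2, h3⟩
    refine (det_op _).bind (T' := 1) ?_
    rintro _ rfl
    by_cases h : a = i
    · subst h
      simp only [decide_true, if_true]
      refine (det_pure ⟨(List.nodup_cons.1 h1).2, h2, fun j hj => ?_⟩).mono (by omega) fun _ h => h
      rw [h3 j hj, List.mem_cons]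
      tauto
    · simp only [h, decide_false]
      refine (det_op _).mono le_rfl ?_
      rintro _ rfl
      refine ⟨List.perm_middle.nodup_iff.2 h1, ?_, fun j hj => ?_⟩
      · simpa [h2] using fun h' => h h'.symm
      · rw [h3 j hj, List.mem_cons, List.mem_cons]
        tauto
  · rintro W ⟨h1, h2, h3⟩
    refine ⟨by simpa using h1, fun j => ⟨fun hj => ?_, fun hj => by simpa [hj.1] using h3 j hj.2⟩⟩
    have hji : j ≠ i := by
      rintro rfl
      exact h2 hj
    exact ⟨(h3 j hji).2 (Or.inr hj), hji⟩

theorem det_part (d : ℕ → ℝ) (i : Fin n) (x' : PairFun n) (W : List (Fin n)) (ℓ : ℕ)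
    (hW : W.Nodup) :
    Det (part d i x' W ℓ) (W.length * 5) fun A => A.Nodup ∧
      ∀ j, j ∈ A ↔ j ∈ W ∧ x' s(i, j) = d ℓ := by
  refine (det_forEach (T := 4) (fun l acc => (l ++ acc).Nodup ∧ (∀ j ∈ acc, x' s(i, j) = d ℓ) ∧
    (∀ j, x' s(i, j) = d ℓ → (j ∈ W ↔ j ∈ l ∨ j ∈ acc))) ?_ W []
    ⟨by simpa using hW, by simp, by simp⟩).mono le_rfl ?_
  · rintro a l acc ⟨h1, h2, h3⟩
    refine (det_read _ _).bind (T' := 3) ?_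
    rintro _ rfl
    refine (det_read _ _).bind (T' := 2) ?_
    rintro _ rfl
    refine (det_op _).bind (T' := 1) ?_
    rintro _ rfl
    by_cases h : x' s(i, a) = d ℓ
    · simp only [h, decide_true, if_true]
      refine (det_op _).mono le_rfl ?_
      rintro _ rfl
      refine ⟨List.perm_middle.nodup_iff.2 h1, ?_, fun j hj => ?_⟩
      · intro j hj
        rcases List.mem_cons.1 hj with rfl | hj
        exacts [h, h2 j hj]
      · rw [h3 j hj, List.mem_cons, List.mem_cons]
        tauto
    · simp only [h, decide_false]
      refine (det_pure ⟨(List.nodup_cons.1 h1).2, h2, fun j hj => ?_⟩).mono (by omega) fun _ h => h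
      rw [h3 j hj, List.mem_cons]
      constructor
      · rintro ((rfl | h') | h')
        exacts [absurd hj h, Or.inl h', Or.inr h']
      · tauto
  · rintro A ⟨h1, h2, h3⟩
    refine ⟨by simpa using h1, fun j => ⟨fun hj => ?_, fun hj => by simpa [hj.1] using h3 j hj.2⟩⟩
    exact ⟨(h3 j (h2 j hj)).2 (Or.inr hj), h2 j hj⟩

/-- The values on the levels below `u` are replaced by zero. -/
def trunc (y : ℕ → PairFun n) (u : ℕ) : ℕ → PairFun n := fun ℓ e => if ℓ < u then 0 else y ℓ e

theorem det_truncate (L : ℕ) (y : ℕ → PairFun n) (h0 : ∀ e, y 0 e = 0) (V : List (Fin n)) (u : ℕ) :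
    Det (truncate L (fun q => y q.1 q.2) V u)
      ((L + 1) * (n * n) + V.length * V.length * ((u - 1) * 2 + 1))
      fun y' => ∀ a ∈ V, ∀ b ∈ V, a ≠ b → ∀ ℓ, y' (ℓ, s(a, b)) = trunc y u ℓ s(a, b) := by
  refine (det_charge _).bind fun _ _ => ?_
  -- Every cell holds its old value or a zero below level `u`, so later writes cannot spoil the
  -- pairs already treated.
  refine (det_forEach (T := (u - 1) * 2) (fun l (y' : ℕ × Sym2 (Fin n) → ℝ) =>
    (∀ q, y' q = y q.1 q.2 ∨ (q.1 < u ∧ y' q = 0)) ∧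
    ∀ p ∈ pairs V, p ∈ l ∨ ∀ ℓ, 1 ≤ ℓ → ℓ < u → y' (ℓ, s(p.1, p.2)) = 0) ?_ (pairs V)
    (fun q => y q.1 q.2) ⟨fun q => Or.inl rfl, fun p hp => Or.inl hp⟩).mono
    (Nat.mul_le_mul_right _ (length_pairs_le V)) ?_
  · rintro p l y' ⟨h1, h2⟩
    refine (det_forEach (T := 1) (fun l' (y'' : ℕ × Sym2 (Fin n) → ℝ) =>
      (∀ ℓ ∈ l', ℓ < u) ∧ (∀ q, y'' q = y' q ∨ (q.1 < u ∧ y'' q = 0)) ∧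
      ∀ ℓ, 1 ≤ ℓ → ℓ < u → ℓ ∈ l' ∨ y'' (ℓ, s(p.1, p.2)) = 0) ?_ _ y' ⟨?_, fun q => Or.inl rfl, ?_⟩).mono
      (by simp) ?_
    · rintro a l' y'' ⟨g0, g1, g2⟩
      refine (det_write _ _ _).mono le_rfl ?_
      rintro _ rfl
      refine ⟨fun ℓ hℓ => g0 ℓ (by simp [hℓ]), fun q => ?_, fun ℓ hℓ hu => ?_⟩
      · by_cases hq : q = (a, s(p.1, p.2))
        · subst hq
          right
          simpa using g0 a (by simp)
        · rw [Function.update_of_ne hq]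
          exact g1 q
      · by_cases hq : ℓ = a
        · subst hq
          simp
        · rw [Function.update_of_ne (by simpa using hq)]
          simpa [hq] using g2 ℓ hℓ hu
    · intro ℓ hℓ
      rw [List.mem_range'_1] at hℓ
      omega
    · intro ℓ hℓ hu
      left
      rw [List.mem_range'_1]
      omega
    · rintro y'' ⟨-, g1, g2⟩
      refine ⟨fun q => ?_, fun p' hp' => ?_⟩
      · rcases g1 q with h | h
        · rw [h]
          exact h1 q
        · exact Or.inr h
      · by_cases hpp : p' = p
        · subst hpp
          right
          intro ℓ hℓ hu
          simpa using g2 ℓ hℓ hu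
        · rcases h2 p' hp' with h | h
          · left
            simpa [hpp] using h
          · right
            intro ℓ hℓ hu
            rcases g1 (ℓ, s(p'.1, p'.2)) with h' | h'
            · rw [h']
              exact h ℓ hℓ hu
            · exact h'.2
  · rintro y' ⟨h1, h2⟩ a ha b hb hab ℓ
    have h2' : 1 ≤ ℓ → ℓ < u → y' (ℓ, s(a, b)) = 0 := by
      intro hℓ hu
      rcases mem_pairs_or hab ha hb with h | h
      · simpa using (h2 _ h).resolve_left (by simp) ℓ hℓ hu
      · simpa [Sym2.eq_swap] using (h2 _ h).resolve_left (by simp) ℓ hℓ hu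
    rw [trunc]
    split_ifs with hu
    -- The loop starts at level 1; level 0 is zero by `h0`.
    · rcases Nat.eq_zero_or_pos ℓ with rfl | hℓ
      · rcases h1 (0, s(a, b)) with h | h
        · rw [h, h0]
        · exact h.2
      · exact h2' hℓ hu
    · exact (h1 (ℓ, s(a, b))).resolve_right fun h => hu h.1

theorem det_increment (y : ℕ × Sym2 (Fin n) → ℝ) (e : Sym2 (Fin n)) (ℓ : ℕ) :
    Det (increment y e ℓ) 3 (· = y (ℓ, e) - y (ℓ - 1, e)) := by
  refine (det_read _ _).bind (T' := 2) ?_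
  rintro _ rfl
  refine (det_read _ _).bind (T' := 1) ?_
  rintro _ rfl
  exact det_op _

theorem det_dominant (L : ℕ) (hL : 1 ≤ L) (y : ℕ × Sym2 (Fin n) → ℝ) (e : Sym2 (Fin n)) :
    Det (dominant L y e) (3 + (L - 1) * 5) fun best => best.1 ∈ Finset.Icc 1 L ∧
      best.2 = y (best.1, e) - y (best.1 - 1, e) ∧
      ∀ ℓ ∈ Finset.Icc 1 L, y (ℓ, e) - y (ℓ - 1, e) ≤ best.2 := by
  refine (det_increment y e 1).bind ?_
  rintro _ rfl
  refine (det_forEach (T := 4) (fun l (best : ℕ × ℝ) => (∀ ℓ ∈ l, ℓ ∈ Finset.Icc 1 L) ∧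
      best.1 ∈ Finset.Icc 1 L ∧ best.2 = y (best.1, e) - y (best.1 - 1, e) ∧
      ∀ ℓ ∈ Finset.Icc 1 L, ℓ ∈ l ∨ y (ℓ, e) - y (ℓ - 1, e) ≤ best.2) ?_ _ _ ?_).mono
      (by simp) ?_
  · rintro a l best ⟨h0, h1, h2, h3⟩
    refine (det_increment y e a).bind (T' := 1) ?_
    rintro _ rfl
    refine (det_op _).bind (T' := 0) ?_
    rintro _ rfl
    by_cases h : best.2 < y (a, e) - y (a - 1, e)
    · simp only [h, decide_true, if_true]
      refine det_pure ⟨fun ℓ hℓ => h0 ℓ (by simp [hℓ]), h0 a (by simp), rfl, fun ℓ hℓ => ?_⟩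
      by_cases hq : ℓ = a
      · subst hq
        right
        exact le_rfl
      · rcases h3 ℓ hℓ with h' | h'
        · left
          simpa [hq] using h'
        · right
          exact h'.trans h.le
    · simp only [h, decide_false]
      refine det_pure ⟨fun ℓ hℓ => h0 ℓ (by simp [hℓ]), h1, h2, fun ℓ hℓ => ?_⟩
      by_cases hq : ℓ = a
      · subst hq
        right
        exact not_lt.1 h
      · rcases h3 ℓ hℓ with h' | h'
        · left
          simpa [hq] using h'
        · right
          exact h'
  · refine ⟨fun ℓ hℓ => ?_, by simpa using hL, rfl, fun ℓ hℓ => ?_⟩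
    · rw [List.mem_range'_1] at hℓ
      simp only [Finset.mem_Icc]
      omega
    · rw [Finset.mem_Icc] at hℓ
      by_cases hq : ℓ = 1
      · subst hq
        right
        exact le_rfl
      · left
        rw [List.mem_range'_1]
        omega
  · rintro best ⟨-, h1, h2, h3⟩
    exact ⟨h1, h2, fun ℓ hℓ => (h3 ℓ hℓ).resolve_left (by simp)⟩

theorem det_ccdf (α β : ℝ) (L : ℕ) (y : ℕ × Sym2 (Fin n) → ℝ) (e : Sym2 (Fin n)) :
    Det (ccdf α β L y e) ((L + 1) * 8) fun F =>
      ∀ ℓ ≤ L, F ℓ = max (y (ℓ, e) - α * β) 0 / (1 - α * β) := by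
  refine (det_forEach (T := 7) (fun l (F : ℕ → ℝ) => ∀ ℓ ≤ L, ℓ ∈ l ∨
      F ℓ = max (y (ℓ, e) - α * β) 0 / (1 - α * β)) ?_ _ _ ?_).mono
      (by simp) ?_
  · intro a l F h
    refine (det_op _).bind (T' := 6) ?_
    rintro _ rfl
    refine (det_read _ _).bind (T' := 5) ?_
    rintro _ rfl
    refine (det_op _).bind (T' := 4) ?_
    rintro _ rfl
    refine (det_op _).bind (T' := 3) ?_
    rintro _ rfl
    refine (det_op _).bind (T' := 2) ?_
    rintro _ rfl
    refine (det_op _).bind (T' := 1) ?_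
    rintro _ rfl
    refine (det_write _ _ _).mono le_rfl ?_
    rintro _ rfl ℓ hℓ
    by_cases hq : ℓ = a
    · subst hq
      simp
    · rw [Function.update_of_ne hq]
      simpa [hq] using h ℓ hℓ
  · intro ℓ hℓ
    left
    rw [List.mem_range'_1]
    omega
  · intro F h ℓ hℓ
    exact (h ℓ hℓ).resolve_left (by simp)

/-! ### Rewriting the non-pivot edges. -/

/-- The new distance of an edge with old distance `c` whose endpoints get the pivot distances
`a` and `b`. -/
def fixValue (a b c : ℝ) : ℝ := if a = b then min c a else max a b

theorem fixValue_comm (a b c : ℝ) : fixValue a b c = fixValue b a c := by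
  unfold fixValue
  by_cases h : a = b
  · subst h
    rfl
  · rw [if_neg h, if_neg (Ne.symm h), max_comm]

/-- By idempotence it does no harm to treat an edge twice, so the loop over `pairs W` need not be
shown to visit each edge only once. -/
theorem fixValue_fixValue (a b c : ℝ) : fixValue a b (fixValue a b c) = fixValue a b c := by
  unfold fixValue
  split_ifs <;> simp

theorem det_fixEdge (i : Fin n) (x' : PairFun n) (j k : Fin n) :
    Det (fixEdge i x' j k) 6 (· = Function.update x' s(j, k)
      (fixValue (x' s(i, j)) (x' s(i, k)) (x' s(j, k)))) := by
  refine (det_read _ _).bind (T' := 5) ?_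
  rintro _ rfl
  refine (det_read _ _).bind (T' := 4) ?_
  rintro _ rfl
  refine (det_op _).bind (T' := 3) ?_
  rintro _ rfl
  by_cases h : x' s(i, j) = x' s(i, k)
  · simp only [h, decide_true, if_true]
    refine (det_read _ _).bind (T' := 2) ?_
    rintro _ rfl
    refine (det_op _).bind (T' := 1) ?_
    rintro _ rfl
    refine (det_write _ _ _).mono le_rfl ?_
    rintro _ rfl
    simp [fixValue]
  · simp only [h, decide_false]
    refine ((det_op _).bind (T' := 1) ?_).mono (by omega) fun _ h => h
    rintro _ rfl
    refine (det_write _ _ _).mono le_rfl ?_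
    rintro _ rfl
    simp [fixValue, h]

theorem det_fixEdges (i : Fin n) (x' : PairFun n) (W : List (Fin n)) (hW : W.Nodup) (hi : i ∉ W) :
    Det (forEach (pairs W) x' fun x' p => fixEdge i x' p.1 p.2) (W.length * W.length * 7)
      fun z => (∀ a ∈ W, ∀ b ∈ W, a ≠ b →
          z s(a, b) = fixValue (x' s(i, a)) (x' s(i, b)) (x' s(a, b))) ∧
        ∀ e, (∀ a ∈ W, ∀ b ∈ W, a ≠ b → e ≠ s(a, b)) → z e = x' e := by
  -- The cell of an edge holds the old or the fixed value at any time, and the pivot cells that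
  -- determine the fixed value are never written because `i ∉ W`.
  refine (det_forEach (T := 6) (fun l z => (∀ p ∈ l, p ∈ pairs W) ∧
    (∀ e, (∀ a ∈ W, ∀ b ∈ W, a ≠ b → e ≠ s(a, b)) → z e = x' e) ∧
    (∀ p ∈ pairs W, z s(p.1, p.2) = x' s(p.1, p.2) ∨
      z s(p.1, p.2) = fixValue (x' s(i, p.1)) (x' s(i, p.2)) (x' s(p.1, p.2))) ∧
    ∀ p ∈ pairs W, p ∈ l ∨
      z s(p.1, p.2) = fixValue (x' s(i, p.1)) (x' s(i, p.2)) (x' s(p.1, p.2))) ?_ _ _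
      ⟨fun p hp => hp, fun e _ => rfl, fun p _ => Or.inl rfl, fun p hp => Or.inl hp⟩).mono
      (Nat.mul_le_mul_right _ (length_pairs_le W)) ?_
  · rintro p l z ⟨h0, h1, h2, h3⟩
    refine (det_fixEdge _ _ _ _).mono le_rfl ?_
    have hp : p ∈ pairs W := h0 p (by simp)
    have hpW := mem_of_mem_pairs hp
    have hpn := ne_of_mem_pairs hW hp
    have hpiv : ∀ a ∈ W, z s(i, a) = x' s(i, a) := by
      refine fun a _ => h1 _ fun b hb c hc _ h => ?_
      rw [Sym2.eq_iff] at h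
      rcases h with ⟨rfl, -⟩ | ⟨rfl, -⟩
      exacts [hi hb, hi hc]
    have hval : fixValue (z s(i, p.1)) (z s(i, p.2)) (z s(p.1, p.2)) =
        fixValue (x' s(i, p.1)) (x' s(i, p.2)) (x' s(p.1, p.2)) := by
      rw [hpiv _ hpW.1, hpiv _ hpW.2]
      rcases h2 p hp with h | h
      · rw [h]
      · rw [h, fixValue_fixValue]
    rintro _ rfl
    rw [hval]
    have key : ∀ p' : Fin n × Fin n, s(p'.1, p'.2) = s(p.1, p.2) →
        fixValue (x' s(i, p.1)) (x' s(i, p.2)) (x' s(p.1, p.2)) =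
          fixValue (x' s(i, p'.1)) (x' s(i, p'.2)) (x' s(p'.1, p'.2)) := by
      rintro ⟨a, b⟩ h
      rcases Sym2.eq_iff.1 h with ⟨rfl, rfl⟩ | ⟨rfl, rfl⟩
      · rfl
      · rw [fixValue_comm, Sym2.eq_swap (a := p.1) (b := p.2)]
    refine ⟨fun p' hp' => h0 p' (by simp [hp']), fun e he => ?_, fun p' hp' => ?_, fun p' hp' => ?_⟩
    · rw [Function.update_of_ne (he _ hpW.1 _ hpW.2 hpn), h1 e he]
    · by_cases hpp : s(p'.1, p'.2) = s(p.1, p.2)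
      · right
        rw [hpp, Function.update_self, key p' hpp, ← hpp]
      · rw [Function.update_of_ne hpp]
        exact h2 p' hp'
    · by_cases hpp : s(p'.1, p'.2) = s(p.1, p.2)
      · right
        rw [hpp, Function.update_self, key p' hpp, ← hpp]
      · rw [Function.update_of_ne hpp]
        have : p' ≠ p := by
          rintro rfl
          exact hpp rfl
        simpa [this] using h3 p' hp'
  · rintro z ⟨-, h1, -, h3⟩
    refine ⟨fun a ha b hb hab => ?_, h1⟩
    rcases mem_pairs_or hab ha hb with h | h
    · exact (h3 _ h).resolve_left (by simp)
    · have := (h3 _ h).resolve_left (by simp)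
      rw [Sym2.eq_swap, fixValue_comm]
      exact this

/-! ## The level of a pivot edge -/

/-- `F` is the cumulative distribution function of a law on the levels `1, …, L`. -/
structure IsCdf (L : ℕ) (F : ℕ → ℝ) : Prop where
  zero : F 0 = 0
  mono : ∀ ℓ ∈ Finset.Icc 1 L, F (ℓ - 1) ≤ F ℓ
  top : F L = 1

/-- The probability of the level `ℓ`. -/
def incr (F : ℕ → ℝ) (ℓ : ℕ) : ℝ := F ℓ - F (ℓ - 1)

/-- Some level has probability more than `2 / 3`. -/
def Concentrated (L : ℕ) (F : ℕ → ℝ) : Prop := ∃ m ∈ Finset.Icc 1 L, 2 / 3 < incr F m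

open Classical in
/-- The law of the level chosen for a pivot edge. -/
def law (L : ℕ) (F : ℕ → ℝ) (a : ℕ) : ℝ :=
  if Concentrated L F then (if 2 / 3 < incr F a then 1 else 0) else incr F a

section Cdf

variable {L : ℕ} {F : ℕ → ℝ}

theorem sum_incr (F : ℕ → ℝ) (M : ℕ) : ∑ ℓ ∈ Finset.Icc 1 M, incr F ℓ = F M - F 0 := by
  induction M with
  | zero => simp
  | succ M ih => rw [Finset.sum_Icc_succ_top (by omega), ih]; simp [incr]

theorem IsCdf.le (hF : IsCdf L F) {a b : ℕ} (hab : a ≤ b) (hb : b ≤ L) : F a ≤ F b := by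
  induction b, hab using Nat.le_induction with
  | base => exact le_rfl
  | succ b hab ih =>
    refine (ih (by omega)).trans ?_
    simpa using hF.mono (b + 1) (by simp only [Finset.mem_Icc]; omega)

theorem IsCdf.nonneg (hF : IsCdf L F) {a : ℕ} (ha : a ≤ L) : 0 ≤ F a :=
  hF.zero.symm.le.trans (hF.le (Nat.zero_le a) ha)

theorem IsCdf.le_one (hF : IsCdf L F) {a : ℕ} (ha : a ≤ L) : F a ≤ 1 :=
  (hF.le ha le_rfl).trans hF.top.le

theorem IsCdf.incr_nonneg (hF : IsCdf L F) {a : ℕ} (ha : a ∈ Finset.Icc 1 L) : 0 ≤ incr F a :=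
  sub_nonneg.2 (hF.mono a ha)

theorem IsCdf.sum_incr (hF : IsCdf L F) : ∑ ℓ ∈ Finset.Icc 1 L, incr F ℓ = 1 := by
  rw [UMVD.sum_incr, hF.zero, hF.top, sub_zero]

theorem IsCdf.incr_add_le (hF : IsCdf L F) {a b : ℕ} (ha : a ∈ Finset.Icc 1 L)
    (hb : b ∈ Finset.Icc 1 L) (hab : a ≠ b) : incr F a + incr F b ≤ 1 := by
  rw [← hF.sum_incr, ← Finset.sum_pair hab]
  refine Finset.sum_le_sum_of_subset_of_nonneg ?_ fun i hi _ => hF.incr_nonneg hi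
  intro c hc
  simp only [Finset.mem_insert, Finset.mem_singleton] at hc
  rcases hc with rfl | rfl <;> assumption

theorem IsCdf.unique (hF : IsCdf L F) {a b : ℕ} (ha : a ∈ Finset.Icc 1 L) (h1 : 2 / 3 < incr F a)
    (hb : b ∈ Finset.Icc 1 L) (h2 : 2 / 3 < incr F b) : a = b := by
  by_contra hab
  linarith [hF.incr_add_le ha hb hab]

theorem IsCdf.law_eq (hF : IsCdf L F) {m : ℕ} (hm : m ∈ Finset.Icc 1 L) (h : 2 / 3 < incr F m)
    {a : ℕ} (ha : a ∈ Finset.Icc 1 L) : law L F a = if a = m then 1 else 0 := by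
  rw [law, if_pos ⟨m, hm, h⟩]
  refine if_congr ⟨fun h' => hF.unique ha h' hm h, ?_⟩ rfl rfl
  rintro rfl
  exact h

theorem law_eq_incr (h : ¬ Concentrated L F) (a : ℕ) : law L F a = incr F a := by
  rw [law, if_neg h]

theorem IsCdf.law_nonneg (hF : IsCdf L F) {a : ℕ} (ha : a ∈ Finset.Icc 1 L) : 0 ≤ law L F a := by
  unfold law
  split_ifs
  exacts [zero_le_one, le_rfl, hF.incr_nonneg ha]

theorem IsCdf.sum_law_mul (hF : IsCdf L F) {m : ℕ} (hm : m ∈ Finset.Icc 1 L)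
    (h : 2 / 3 < incr F m) (g : ℕ → ℝ) : ∑ a ∈ Finset.Icc 1 L, law L F a * g a = g m := by
  rw [Finset.sum_congr rfl fun a ha => by rw [hF.law_eq hm h ha], Finset.sum_eq_single_of_mem m hm]
  · simp
  · intro b _ hb
    simp [hb]

theorem IsCdf.sum_law (hF : IsCdf L F) : ∑ a ∈ Finset.Icc 1 L, law L F a = 1 := by
  by_cases h : Concentrated L F
  · obtain ⟨m, hm, h⟩ := h
    simpa using hF.sum_law_mul hm h fun _ => 1
  · simp_rw [law_eq_incr h]
    exact hF.sum_incr

end Cdf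

/-- For α = 1/3 and β = 0 the threshold is 2/3 and the clipped table equals `F`, so the two branches
together realise `law`. -/
theorem triple_pivotLevel {L : ℕ} (hL : 1 ≤ L) {F : ℕ → ℝ} (hF : IsCdf L F)
    {y : ℕ × Sym2 (Fin n) → ℝ} {e : Sym2 (Fin n)} (hy : ∀ ℓ ≤ L, y (ℓ, e) = F ℓ)
    {g : ℕ → ℝ} (hg : ∀ ℓ ∈ Finset.Icc 1 L, 0 ≤ g ℓ) :
    Triple (pivotLevel (1 / 3) 0 L y e) (20 * (L + 1))
      (fun ℓ => ℓ ∈ Finset.Icc 1 L ∧ 0 < law L F ℓ) g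
      (∑ ℓ ∈ Finset.Icc 1 L, law L F ℓ * g ℓ) := by
  have hincr : ∀ ℓ ∈ Finset.Icc 1 L, y (ℓ, e) - y (ℓ - 1, e) = incr F ℓ := by
    intro ℓ hℓ
    rw [Finset.mem_Icc] at hℓ
    rw [hy ℓ hℓ.2, hy (ℓ - 1) (by omega), incr]
  refine Triple.mono (T := (3 + (L - 1) * 5) + (1 + (1 + ((L + 1) * 8 + (L + 1))))) ?_ (by omega)
    (fun _ h => h) le_rfl
  refine (det_dominant L hL y e).bind_triple ?_
  rintro ⟨m, v⟩ ⟨hm, hv, hmax⟩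
  simp only at hm hv hmax
  rw [hincr m hm] at hv
  refine (det_op _).bind_triple ?_
  rintro _ rfl
  refine (det_op _).bind_triple ?_
  rintro _ rfl
  by_cases h : 2 / 3 < incr F m
  · have h' : 1 - 1 / 3 < v := by rw [hv]; linarith
    simp only [h', decide_true, if_true]
    refine (((det_pure (Q := (· = m)) rfl).triple (g := g) (b := g m) ?_).mono (by omega) ?_ ?_)
    · rintro _ rfl
      exact le_rfl
    · rintro _ rfl
      refine ⟨hm, ?_⟩
      rw [hF.law_eq hm h hm]
      simp
    · rw [hF.sum_law_mul hm h]
  · have h' : ¬ 1 - 1 / 3 < v := by rw [hv]; linarith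
    have hnc : ¬ Concentrated L F := by
      rintro ⟨m', hm', h''⟩
      have := hmax m' hm'
      rw [hincr m' hm', hv] at this
      linarith
    simp only [h', decide_false]
    refine (det_ccdf _ _ L y e).bind_triple ?_
    intro G hG
    have hGF : ∀ ℓ ≤ L, G ℓ = F ℓ := by
      intro ℓ hℓ
      rw [hG ℓ hℓ, hy ℓ hℓ]
      simpa using hF.nonneg hℓ
    have hGi : ∀ ℓ ∈ Finset.Icc 1 L, G ℓ - G (ℓ - 1) = law L F ℓ := by
      intro ℓ hℓ
      rw [Finset.mem_Icc] at hℓ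
      rw [hGF ℓ hℓ.2, hGF (ℓ - 1) (by omega), law_eq_incr hnc, incr]
    refine (triple_drawLevel L G g (fun ℓ hℓ => ?_) ?_ ?_ hg).mono le_rfl ?_ ?_
    · rw [← sub_nonneg, hGi ℓ hℓ]
      exact hF.law_nonneg hℓ
    · rw [hGF 0 (by omega), hF.zero]
    · rw [hGF L le_rfl, hF.top]
    · rintro ℓ ⟨h1, h2⟩
      rw [hGi ℓ h1] at h2
      exact ⟨h1, h2⟩
    · exact (Finset.sum_congr rfl fun ℓ hℓ => by rw [hGi ℓ hℓ]).le

/-! ### Expectations over independent levels of the pivot edges. -/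

/-- The expected value of `H` at the table that results from `x` if every pivot edge `s(i, j)` with
`j` in the list independently gets a random level with the law of `F j`. -/
def levelExp (L : ℕ) (d : ℕ → ℝ) (i : Fin n) (F : Fin n → ℕ → ℝ) (H : PairFun n → ℝ) :
    List (Fin n) → PairFun n → ℝ
  | [], x => H x
  | j :: l, x => ∑ a ∈ Finset.Icc 1 L, law L (F j) a *
      levelExp L d i F H l (Function.update x s(i, j) (d a))

section LevelExp

variable {L : ℕ} {d : ℕ → ℝ} {i : Fin n} {F : Fin n → ℕ → ℝ}

theorem levelExp_nonneg {H : PairFun n → ℝ} (hH : ∀ x, 0 ≤ H x) :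
    ∀ l : List (Fin n), (∀ j ∈ l, IsCdf L (F j)) → ∀ x, 0 ≤ levelExp L d i F H l x
  | [], _, x => hH x
  | j :: l, hF, x => Finset.sum_nonneg fun _ ha =>
      mul_nonneg ((hF j (by simp)).law_nonneg ha)
        (levelExp_nonneg hH l (fun k hk => hF k (by simp [hk])) _)

theorem levelExp_add (H H' : PairFun n → ℝ) : ∀ (l : List (Fin n)) (x : PairFun n),
    levelExp L d i F (fun x => H x + H' x) l x = levelExp L d i F H l x + levelExp L d i F H' l x
  | [], _ => rfl
  | j :: l, x => by
    simp only [levelExp, levelExp_add H H' l, mul_add, Finset.sum_add_distrib]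

theorem levelExp_mul (c : ℝ) (H : PairFun n → ℝ) : ∀ (l : List (Fin n)) (x : PairFun n),
    levelExp L d i F (fun x => c * H x) l x = c * levelExp L d i F H l x
  | [], _ => rfl
  | j :: l, x => by
    simp only [levelExp, levelExp_mul c H l, Finset.mul_sum]
    exact Finset.sum_congr rfl fun a _ => by ring

theorem levelExp_sum {ι : Type} (s : Finset ι) (H : ι → PairFun n → ℝ) :
    ∀ (l : List (Fin n)) (x : PairFun n),
    levelExp L d i F (fun x => ∑ p ∈ s, H p x) l x = ∑ p ∈ s, levelExp L d i F (H p) l x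
  | [], _ => rfl
  | j :: l, x => by
    simp only [levelExp, levelExp_sum s H l, Finset.mul_sum]
    exact Finset.sum_comm

theorem levelExp_congr_of_notMem {H : PairFun n → ℝ} :
    ∀ (l : List (Fin n)), (∀ j ∈ l, IsCdf L (F j)) →
      (∀ j ∈ l, ∀ x v, H (Function.update x s(i, j) v) = H x) → ∀ x,
      levelExp L d i F H l x = H x
  | [], _, _, _ => rfl
  | j :: l, hF, hH, x => by
    simp only [levelExp]
    rw [Finset.sum_congr rfl fun a _ => by
      rw [levelExp_congr_of_notMem l (fun k hk => hF k (by simp [hk]))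
        (fun k hk => hH k (by simp [hk])), hH j (by simp)], ← Finset.sum_mul,
      (hF j (by simp)).sum_law, one_mul]

theorem pivot_edge_ne {i j k : Fin n} (h : j ≠ k) : s(i, j) ≠ s(i, k) := fun h' =>
  h (Sym2.congr_right.1 h')

theorem levelExp_single (h : ℝ → ℝ) {j : Fin n} :
    ∀ (l : List (Fin n)), l.Nodup → j ∈ l → (∀ j ∈ l, IsCdf L (F j)) → ∀ x,
      levelExp L d i F (fun x => h (x s(i, j))) l x =
        ∑ a ∈ Finset.Icc 1 L, law L (F j) a * h (d a)
  | [], _, hj, _, _ => by simp at hj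
  | k :: l, hl, hj, hF, x => by
    rw [List.nodup_cons] at hl
    have hF' : ∀ j ∈ l, IsCdf L (F j) := fun k hk => hF k (by simp [hk])
    simp only [levelExp]
    by_cases hjk : j = k
    · subst hjk
      refine Finset.sum_congr rfl fun a _ => ?_
      rw [levelExp_congr_of_notMem l hF', Function.update_self]
      intro k hk x v
      rw [Function.update_of_ne]
      exact pivot_edge_ne fun h => hl.1 (h ▸ hk)
    · rw [Finset.sum_congr rfl fun a _ => by
        rw [levelExp_single h l hl.2 (by simpa [hjk] using hj) hF'], ← Finset.sum_mul,
        (hF k (by simp)).sum_law, one_mul]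

/-- No later draw touches the cell of `s(i, p)`, so its value is a constant once drawn. This
separates the two draws in `levelExp_pair`. -/
theorem levelExp_congr_of_fixed {H H' : PairFun n → ℝ} {p : Fin n} {v : ℝ}
    (hH : ∀ x, x s(i, p) = v → H x = H' x) :
    ∀ (l : List (Fin n)), p ∉ l → ∀ x, x s(i, p) = v →
      levelExp L d i F H l x = levelExp L d i F H' l x
  | [], _, x, hx => hH x hx
  | j :: l, hp, x, hx => by
    simp only [levelExp]
    refine Finset.sum_congr rfl fun a _ => ?_
    rw [levelExp_congr_of_fixed hH l (fun h => hp (by simp [h])) _ ?_]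
    rw [Function.update_of_ne, hx]
    exact pivot_edge_ne fun h => hp (by simp [h])

theorem levelExp_pair (h : ℝ → ℝ → ℝ) {j k : Fin n} (hjk : j ≠ k) :
    ∀ (l : List (Fin n)), l.Nodup → j ∈ l → k ∈ l → (∀ j ∈ l, IsCdf L (F j)) → ∀ x,
      levelExp L d i F (fun x => h (x s(i, j)) (x s(i, k))) l x =
        ∑ a ∈ Finset.Icc 1 L, ∑ b ∈ Finset.Icc 1 L, law L (F j) a * law L (F k) b * h (d a) (d b)
  | [], _, hj, _, _, _ => by simp at hj
  | m :: l, hl, hj, hk, hF, x => by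
    rw [List.nodup_cons] at hl
    have hF' : ∀ j ∈ l, IsCdf L (F j) := fun k hk => hF k (by simp [hk])
    simp only [levelExp]
    by_cases hmj : j = m
    · subst hmj
      refine Finset.sum_congr rfl fun a _ => ?_
      have hkl : k ∈ l := by simpa [hjk.symm] using hk
      rw [levelExp_congr_of_fixed (H' := fun x => h (d a) (x s(i, k))) (p := j) (v := d a)
        (fun x hx => by rw [hx]) l hl.1 _ (Function.update_self ..),
        levelExp_single (fun t => h (d a) t) l hl.2 hkl hF', Finset.mul_sum]
      exact Finset.sum_congr rfl fun b _ => by ring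
    · by_cases hmk : k = m
      · subst hmk
        rw [Finset.sum_comm]
        refine Finset.sum_congr rfl fun b _ => ?_
        have hjl : j ∈ l := by simpa [hjk] using hj
        rw [levelExp_congr_of_fixed (H' := fun x => h (x s(i, j)) (d b)) (p := k) (v := d b)
          (fun x hx => by rw [hx]) l hl.1 _ (Function.update_self ..),
          levelExp_single (fun t => h t (d b)) l hl.2 hjl hF', Finset.mul_sum]
        exact Finset.sum_congr rfl fun b _ => by ring
      · rw [Finset.sum_congr rfl fun a _ => by
          rw [levelExp_pair h hjk l hl.2 (by simpa [hmj] using hj) (by simpa [hmk] using hk) hF'],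
          ← Finset.sum_mul, (hF m (by simp)).sum_law, one_mul]

end LevelExp

/-- `levelExp` unfolds one vertex at a time exactly as the loop does, so it serves as the loop
potential, and independence of the draws never has to be stated separately. -/
theorem triple_pivotLevels {L : ℕ} (hL : 1 ≤ L) (d : ℕ → ℝ) {i : Fin n} {F : Fin n → ℕ → ℝ}
    {y : ℕ × Sym2 (Fin n) → ℝ} {W : List (Fin n)} (hW : W.Nodup) (hF : ∀ j ∈ W, IsCdf L (F j))
    (hy : ∀ j ∈ W, ∀ ℓ ≤ L, y (ℓ, s(i, j)) = F j ℓ) {H : PairFun n → ℝ} (hH : ∀ x, 0 ≤ H x)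
    (x : PairFun n) :
    Triple (forEach W x fun x' j => do
        let ℓ ← pivotLevel (1 / 3) 0 L y s(i, j)
        let v ← read d ℓ
        write x' s(i, j) v) (W.length * (20 * (L + 1) + 3))
      (fun x' => (∀ j ∈ W, ∃ a ∈ Finset.Icc 1 L, 0 < law L (F j) a ∧ x' s(i, j) = d a) ∧
        ∀ e, (∀ j ∈ W, e ≠ s(i, j)) → x' e = x e) H (levelExp L d i F H W x) := by
  refine (triple_forEach (T := fun _ => 20 * (L + 1) + 2) (fun l x' => l.Nodup ∧ (∀ j ∈ l, j ∈ W) ∧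
    (∀ j ∈ W, j ∈ l ∨ ∃ a ∈ Finset.Icc 1 L, 0 < law L (F j) a ∧ x' s(i, j) = d a) ∧
    ∀ e, (∀ j ∈ W, e ≠ s(i, j)) → x' e = x e) (fun l x' => levelExp L d i F H l x') ?_ W x
    ⟨hW, fun _ h => h, fun j hj => Or.inl hj, fun _ _ => rfl⟩).mono (by simp) ?_ le_rfl
  · rintro j l x' ⟨h0, h1, h2, h3⟩
    have hj := h1 j (by simp)
    have hF' : ∀ j ∈ l, IsCdf L (F j) := fun k hk => hF k (h1 k (by simp [hk]))
    refine (triple_pivotLevel hL (hF j hj) (hy j hj)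
      (g := fun a => levelExp L d i F H l (Function.update x' s(i, j) (d a)))
      fun ℓ _ => levelExp_nonneg hH l hF' _).bind (T' := 2) ?_
    rintro a ⟨ha, hpos⟩
    refine (det_read d a).bind_triple (T' := 1) ?_
    rintro _ rfl
    refine ((det_write _ _ _).triple (g := levelExp L d i F H l) ?_).mono le_rfl ?_ le_rfl
    · rintro _ rfl
      exact le_rfl
    · rintro _ rfl
      refine ⟨(List.nodup_cons.1 h0).2, fun k hk => h1 k (by simp [hk]), fun k hk => ?_,
        fun e he => ?_⟩
      · by_cases hkj : k = j
        · subst hkj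
          exact Or.inr ⟨a, ha, hpos, Function.update_self ..⟩
        · rw [Function.update_of_ne (pivot_edge_ne hkj)]
          simpa [hkj] using h2 k hk
      · rw [Function.update_of_ne (he j hj)]
        exact h3 e he
  · rintro x' ⟨-, -, h2, h3⟩
    exact ⟨fun j hj => (h2 j hj).resolve_left (by simp), h3⟩

/-! ## The probability of a wrong decision -/

/-- The distance of level `m` of an edge is changed if its endpoints get the pivot levels `a`, `b`:
the three levels do not form an ultrametric triangle. -/
def Wrong (a b m : ℕ) : Prop := ¬ ((a = b ∧ a ≤ m) ∨ (a ≠ b ∧ min a b = m))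

instance (a b m : ℕ) : Decidable (Wrong a b m) := by
  unfold Wrong
  infer_instance

/-- The probability that independent levels with the laws of `p` and `q` change an edge of
level `m`. -/
def wrongProb (L : ℕ) (p q : ℕ → ℝ) (m : ℕ) : ℝ :=
  ∑ a ∈ Finset.Icc 1 L, ∑ b ∈ Finset.Icc 1 L, law L p a * law L q b * if Wrong a b m then 1 else 0

/-- The probability that independent levels with the laws of `p` and `q` differ. -/
def sepProb (L : ℕ) (p q : ℕ → ℝ) : ℝ :=
  ∑ a ∈ Finset.Icc 1 L, ∑ b ∈ Finset.Icc 1 L, law L p a * law L q b * if a ≠ b then 1 else 0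

section Laws

variable {L : ℕ} {p q r : ℕ → ℝ}

theorem sum_law_mul_law (p q : ℕ → ℝ) (h : ℕ → ℕ → ℝ) :
    ∑ a ∈ Finset.Icc 1 L, ∑ b ∈ Finset.Icc 1 L, law L p a * law L q b * h a b =
      ∑ a ∈ Finset.Icc 1 L, law L p a * ∑ b ∈ Finset.Icc 1 L, law L q b * h a b := by
  simp only [Finset.mul_sum, mul_assoc]

theorem sepProb_comm (p q : ℕ → ℝ) : sepProb L p q = sepProb L q p := by
  unfold sepProb
  rw [Finset.sum_comm]
  refine Finset.sum_congr rfl fun a _ => Finset.sum_congr rfl fun b _ => ?_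
  rw [mul_comm (law L p b)]
  simp only [ne_comm]

theorem wrong_comm {a b m : ℕ} : Wrong a b m ↔ Wrong b a m := by
  unfold Wrong
  omega

theorem wrongProb_comm (p q : ℕ → ℝ) (m : ℕ) : wrongProb L p q m = wrongProb L q p m := by
  unfold wrongProb
  rw [Finset.sum_comm]
  refine Finset.sum_congr rfl fun a _ => Finset.sum_congr rfl fun b _ => ?_
  rw [mul_comm (law L p b)]
  simp only [wrong_comm]

theorem sum_law_mul_law_nonneg (hp : IsCdf L p) (hq : IsCdf L q) {h : ℕ → ℕ → ℝ}
    (hh : ∀ a b, 0 ≤ h a b) :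
    0 ≤ ∑ a ∈ Finset.Icc 1 L, ∑ b ∈ Finset.Icc 1 L, law L p a * law L q b * h a b :=
  Finset.sum_nonneg fun _ ha => Finset.sum_nonneg fun _ hb =>
    mul_nonneg (mul_nonneg (hp.law_nonneg ha) (hq.law_nonneg hb)) (hh _ _)

theorem sepProb_nonneg (hp : IsCdf L p) (hq : IsCdf L q) : 0 ≤ sepProb L p q :=
  sum_law_mul_law_nonneg hp hq fun _ _ => by split_ifs <;> norm_num

theorem sum_law_mul_le_one (hp : IsCdf L p) {h : ℕ → ℝ} (hh : ∀ a, h a ≤ 1) :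
    ∑ a ∈ Finset.Icc 1 L, law L p a * h a ≤ 1 := by
  rw [← hp.sum_law]
  exact Finset.sum_le_sum fun a ha => mul_le_of_le_one_right (hp.law_nonneg ha) (hh a)

theorem wrongProb_le_one (hp : IsCdf L p) (hq : IsCdf L q) (m : ℕ) : wrongProb L p q m ≤ 1 := by
  rw [wrongProb, sum_law_mul_law]
  refine sum_law_mul_le_one hp fun a => sum_law_mul_le_one hq fun b => ?_
  split_ifs <;> norm_num

theorem IsCdf.sum_law_ne (hp : IsCdf L p) {v : ℕ} (hv : v ∈ Finset.Icc 1 L) :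
    ∑ a ∈ Finset.Icc 1 L, law L p a * (if v ≠ a then 1 else 0) = 1 - law L p v := by
  have h1 : ∀ a ∈ Finset.Icc 1 L, law L p a * (if v ≠ a then (1 : ℝ) else 0) =
      law L p a - if v = a then law L p a else 0 := by
    intro a _
    by_cases h : v = a <;> simp [h]
  rw [Finset.sum_congr rfl h1, Finset.sum_sub_distrib, hp.sum_law, Finset.sum_ite_eq, if_pos hv]

theorem IsCdf.sepProb_eq (hp : IsCdf L p) (hq : IsCdf L q) {m : ℕ} (hm : m ∈ Finset.Icc 1 L)
    (h : 2 / 3 < incr p m) : sepProb L p q = 1 - law L q m := by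
  rw [sepProb, sum_law_mul_law, hp.sum_law_mul hm h, hq.sum_law_ne hm]

theorem law_le (h : ¬ Concentrated L p) {a : ℕ} (ha : a ∈ Finset.Icc 1 L) : law L p a ≤ 2 / 3 := by
  rw [law_eq_incr h]
  exact not_lt.1 fun h' => h ⟨a, ha, h'⟩

theorem IsCdf.sepProb_ge (hp : IsCdf L p) (hq : IsCdf L q) (h : Concentrated L p)
    (h' : ¬ Concentrated L q) : 1 / 3 ≤ sepProb L p q := by
  obtain ⟨m, hm, h⟩ := h
  rw [hp.sepProb_eq hq hm h]
  linarith [law_le h' hm]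

theorem IsCdf.lt_of_lt (hp : IsCdf L p) {m : ℕ} (hm : m ∈ Finset.Icc 1 L) (h : 2 / 3 < incr p m)
    {ℓ : ℕ} (hℓ : ℓ < m) : p ℓ < 1 / 3 := by
  rw [Finset.mem_Icc] at hm
  have h1 := hp.le (a := ℓ) (b := m - 1) (by omega) (by omega)
  have h2 := hp.le_one hm.2
  unfold incr at h
  linarith

theorem IsCdf.lt_of_le (hp : IsCdf L p) {m : ℕ} (hm : m ∈ Finset.Icc 1 L) (h : 2 / 3 < incr p m)
    {ℓ : ℕ} (hℓ : m ≤ ℓ) (hL : ℓ ≤ L) : 2 / 3 < p ℓ := by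
  rw [Finset.mem_Icc] at hm
  have h1 := hp.le hℓ hL
  have h2 := hp.nonneg (a := m - 1) (by omega)
  unfold incr at h
  linarith

/-- The triangle inequality for three cumulative distribution functions on all levels. -/
def IsTriangle (L : ℕ) (p q r : ℕ → ℝ) : Prop :=
  ∀ ℓ ≤ L, p ℓ ≤ q ℓ + r ℓ ∧ q ℓ ≤ p ℓ + r ℓ ∧ r ℓ ≤ p ℓ + q ℓ

/-- If one of three levels were strictly the smallest, then at that level its edge would have value
above 2/3 and the other two values below 1/3, against the triangle inequality. So the smallest level
occurs at least twice, which is what an ultrametric triangle means. -/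
theorem not_wrong_of_concentrated (hp : IsCdf L p) (hq : IsCdf L q) (hr : IsCdf L r)
    (htri : IsTriangle L p q r) {a b c : ℕ} (ha : a ∈ Finset.Icc 1 L) (hpa : 2 / 3 < incr p a)
    (hb : b ∈ Finset.Icc 1 L) (hqb : 2 / 3 < incr q b)
    (hc : c ∈ Finset.Icc 1 L) (hrc : 2 / 3 < incr r c) : ¬ Wrong a b c := by
  have hcL := (Finset.mem_Icc.1 hc).2
  have haL := (Finset.mem_Icc.1 ha).2
  have hbL := (Finset.mem_Icc.1 hb).2
  have h1 : ¬ (c < a ∧ c < b) := by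
    rintro ⟨h1, h2⟩
    linarith [hp.lt_of_lt ha hpa h1, hq.lt_of_lt hb hqb h2, hr.lt_of_le hc hrc le_rfl hcL,
      (htri c hcL).2.2]
  have h2 : ¬ (a < c ∧ a < b) := by
    rintro ⟨h1, h2⟩
    linarith [hr.lt_of_lt hc hrc h1, hq.lt_of_lt hb hqb h2, hp.lt_of_le ha hpa le_rfl haL,
      (htri a haL).1]
  have h3 : ¬ (b < c ∧ b < a) := by
    rintro ⟨h1, h2⟩
    linarith [hr.lt_of_lt hc hrc h1, hp.lt_of_lt ha hpa h2, hq.lt_of_le hb hqb le_rfl hbL,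
      (htri b hbL).2.1]
  unfold Wrong
  omega

theorem IsCdf.wrongProb_eq (hp : IsCdf L p) {a : ℕ} (ha : a ∈ Finset.Icc 1 L)
    (hpa : 2 / 3 < incr p a) (q : ℕ → ℝ) (m : ℕ) : wrongProb L p q m =
      ∑ b ∈ Finset.Icc 1 L, law L q b * if Wrong a b m then 1 else 0 := by
  rw [wrongProb, sum_law_mul_law, hp.sum_law_mul ha hpa]

theorem IsCdf.sum_incr_lt (hq : IsCdf L q) {m : ℕ} (hm : m ∈ Finset.Icc 1 L) :
    ∑ b ∈ Finset.Icc 1 L, incr q b * (if b < m then 1 else 0) = q (m - 1) := by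
  rw [Finset.mem_Icc] at hm
  have : (Finset.Icc 1 L).filter (· < m) = Finset.Icc 1 (m - 1) := by
    ext b
    simp only [Finset.mem_filter, Finset.mem_Icc]
    omega
  simp only [mul_ite, mul_one, mul_zero]
  rw [← Finset.sum_filter, this, UMVD.sum_incr, hq.zero, sub_zero]

theorem wrong_same_iff {b m : ℕ} : Wrong m b m ↔ b < m := by
  unfold Wrong
  omega

/-- If the edge opposite to the pivot is concentrated on the level `m`, the pivot edge `p` is
concentrated and the pivot edge `q` is not. -/
theorem wrongProb_le_of_concentrated (hp : IsCdf L p) (hq : IsCdf L q) (hr : IsCdf L r)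
    (htri : IsTriangle L p q r) {a m : ℕ} (ha : a ∈ Finset.Icc 1 L) (hpa : 2 / 3 < incr p a)
    (hqn : ¬ Concentrated L q) (hm : m ∈ Finset.Icc 1 L) :
    wrongProb L p q m ≤ 2 * (1 - incr p a) + 2 * (1 - incr r m) := by
  rw [hp.wrongProb_eq ha hpa]
  simp_rw [law_eq_incr hqn]
  have ha' := Finset.mem_Icc.1 ha
  have hm' := Finset.mem_Icc.1 hm
  have hpm : p (a - 1) ≤ 1 - incr p a := by
    have := hp.le_one ha'.2
    unfold incr
    linarith
  have hrm : r (m - 1) ≤ 1 - incr r m := by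
    have := hr.le_one hm'.2
    unfold incr
    linarith
  have hpn := hp.nonneg (a := a - 1) (by omega)
  have hrn := hr.nonneg (a := m - 1) (by omega)
  -- If the level `v` of `q` is never wrong, the error probability is at most the mass that `q` puts
  -- elsewhere.
  have hne : ∀ v ∈ Finset.Icc 1 L, (∀ b, Wrong a b m → v ≠ b) →
      ∑ b ∈ Finset.Icc 1 L, incr q b * (if Wrong a b m then 1 else 0) ≤ 1 - incr q v := by
    intro v hv himp
    rw [← law_eq_incr (L := L) hqn v, ← hq.sum_law_ne hv]
    refine Finset.sum_le_sum fun b hb => ?_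
    rw [law_eq_incr hqn]
    refine mul_le_mul_of_nonneg_left ?_ (hq.incr_nonneg hb)
    by_cases h : Wrong a b m
    · rw [if_pos h, if_pos (himp b h)]
    · rw [if_neg h]
      split_ifs <;> norm_num
  -- The harmless levels of `q` are `b = a` if `a < m`, all `b ≥ m` if `a = m`, and `b = m` if `a >
  -- m`. In each case the triangle inequality, applied at a level and its predecessor or at the
  -- predecessor alone, bounds the other mass of `q` by the masses missing in `p` and `r`.
  rcases lt_trichotomy a m with h | h | h
  · refine (hne a ha fun b hb => ?_).trans ?_
    · unfold Wrong at hb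
      omega
    · have h1 := (htri a ha'.2).1
      have h2 := (htri (a - 1) (by omega)).2.1
      have h3 := hr.le (a := a) (b := m - 1) (by omega) (by omega)
      have h4 := hr.le (a := a - 1) (b := m - 1) (by omega) (by omega)
      unfold incr at *
      linarith
  · subst h
    simp_rw [wrong_same_iff]
    rw [hq.sum_incr_lt hm]
    linarith [(htri (a - 1) (by omega)).2.1]
  · refine (hne m hm fun b hb => ?_).trans ?_
    · unfold Wrong at hb
      omega
    · have h1 := (htri m hm'.2).2.2
      have h2 := (htri (m - 1) (by omega)).2.1
      have h3 := hp.le (a := m) (b := a - 1) (by omega) (by omega)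
      have h4 := hp.le (a := m - 1) (b := a - 1) (by omega) (by omega)
      unfold incr at *
      linarith

open Classical in
/-- The charging inequality for a pivot with edges `p`, `q` and the opposite edge `r`: the
probability of a wrong decision is paid for by the edges `r` and `p`. -/
theorem wrongProb_le (hp : IsCdf L p) (hq : IsCdf L q) (hr : IsCdf L r) (htri : IsTriangle L p q r)
    {m u v : ℕ} (hm : m ∈ Finset.Icc 1 L) (hrm : 2 / 3 < incr r m) (hu : ∀ ℓ < u, p ℓ = 0)
    (hv : v ∈ Finset.Icc 1 L) {lp lr : ℝ} (hlp : 1 - incr p v ≤ lp) (hlr : 1 - incr r m ≤ lr) :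
    wrongProb L p q m ≤ 9 * (lr * sepProb L p q +
      lp * (sepProb L q r + if 2 / 3 < incr q m ∧ u < m then 1 else 0)) := by
  have hrc : Concentrated L r := ⟨m, hm, hrm⟩
  have hone : ∀ {F : ℕ → ℝ}, IsCdf L F → ∀ {w}, w ∈ Finset.Icc 1 L → incr F w ≤ 1 := by
    intro F hF w hw
    rw [← hF.sum_incr]
    exact Finset.single_le_sum (fun i hi => hF.incr_nonneg hi) hw
  have hlr0 : 0 ≤ lr := by linarith [hone hr hm]
  have hlp0 : 0 ≤ lp := by linarith [hone hp hv]
  have hs1 := sepProb_nonneg hp hq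
  have hs2 := sepProb_nonneg hq hr
  have hind : (0 : ℝ) ≤ if 2 / 3 < incr q m ∧ u < m then 1 else 0 := by split_ifs <;> norm_num
  by_cases hpc : Concentrated L p
  · obtain ⟨a, ha, hpa⟩ := hpc
    by_cases hqc : Concentrated L q
    · obtain ⟨b, hb, hqb⟩ := hqc
      rw [hp.wrongProb_eq ha hpa, hq.sum_law_mul hb hqb,
        if_neg (not_wrong_of_concentrated hp hq hr htri ha hpa hb hqb hm hrm)]
      positivity
    · have h1 := wrongProb_le_of_concentrated hp hq hr htri ha hpa hqc hm
      have h2 := hp.sepProb_ge hq ⟨a, ha, hpa⟩ hqc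
      have h3 := hr.sepProb_ge hq hrc hqc
      rw [sepProb_comm] at h3
      -- If `v ≠ a`, the mass of `p` at `v` is at most 1 minus that at `a`, so `lp` is at least the
      -- mass at `a`, which exceeds 2/3.
      have h4 : 1 - incr p a ≤ lp := by
        by_cases hva : v = a
        · subst hva
          exact hlp
        · linarith [hp.incr_add_le hv ha hva]
      nlinarith [mul_le_mul_of_nonneg_left h2 hlr0, mul_le_mul_of_nonneg_left h3 hlp0,
        mul_nonneg hlp0 hind]
  -- An unconcentrated `p` makes `lp` at least 1/3. From here the trivial bound 1 on the error
  -- probability suffices, except when `q` sits on a level `m ≤ u`.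
  · have hlp3 : 1 / 3 ≤ lp := by
      have := law_le hpc hv
      rw [law_eq_incr hpc] at this
      linarith
    have hle := wrongProb_le_one hp hq m
    have hl := mul_nonneg hlr0 hs1
    by_cases hqc : Concentrated L q
    · obtain ⟨b, hb, hqb⟩ := hqc
      by_cases hbm : b = m
      · subst hbm
        by_cases hub : u < b
        · rw [if_pos ⟨hqb, hub⟩]
          nlinarith
        -- Here `q` sits on the level of `r` and only a lower level of `p` is wrong. Such a level is
        -- at most `u - 1`, where truncation has removed all mass of `p`.
        · rw [wrongProb_comm, hq.wrongProb_eq hb hqb]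
          simp_rw [wrong_same_iff, law_eq_incr hpc]
          rw [hp.sum_incr_lt hb, hu (b - 1) (by rw [Finset.mem_Icc] at hb; omega)]
          positivity
      · have : sepProb L q r = 1 := by
          rw [hq.sepProb_eq hr hb hqb, hr.law_eq hm hrm hb, if_neg hbm, sub_zero]
        rw [this]
        nlinarith
    -- This case needs the full constant: an error probability up to 1 is paid by 9 times `lp ≥ 1/3`
    -- times a separation probability of at least 1/3.
    · have h3 := hr.sepProb_ge hq hrc hqc
      rw [sepProb_comm] at h3
      nlinarith

end Laws

/-! ## Potentials -/

/-- A function of the number of vertices in a set and of their levels that decreases by one on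
average if a random vertex and all vertices of no larger level are removed. -/
structure IsPotential {V : Type} (f : Finset V → (V → ℕ) → ℝ) : Prop where
  nonneg : ∀ E m, 0 ≤ f E m
  mono : ∀ E E' m, E ⊆ E' → f E m ≤ f E' m
  step : ∀ E m, ∑ k ∈ E, f (E.filter fun k' => m k < m k') m ≤ E.card * (f E m - 1)

/-- The potential that leads to the logarithmic bound. -/
def harmonicPotential {V : Type} (E : Finset V) (_ : V → ℕ) : ℝ := harmonic E.card

/-- The potential that leads to the bound by the number of levels. -/
def levelPotential {V : Type} (E : Finset V) (m : V → ℕ) : ℝ := (E.image m).card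

/-- The level of `k` itself no longer occurs among the remaining vertices, so every single choice of
`k` loses a value. -/
theorem isPotential_levelPotential {V : Type} : IsPotential (levelPotential (V := V)) where
  nonneg _ _ := by unfold levelPotential; positivity
  mono E E' m h := by
    unfold levelPotential
    exact_mod_cast Finset.card_le_card (Finset.image_subset_image h)
  step E m := by
    have : ∀ k ∈ E, levelPotential (E.filter fun k' => m k < m k') m ≤ levelPotential E m - 1 := by
      intro k hk
      unfold levelPotential
      rw [le_sub_iff_add_le]
      have : ((E.filter fun k' => m k < m k').image m).card < (E.image m).card := by
        refine Finset.card_lt_card ⟨Finset.image_subset_image (Finset.filter_subset _ _), fun h => ?_⟩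
        have := h (Finset.mem_image_of_mem m hk)
        simp at this
        omega
      exact_mod_cast this
    simpa using Finset.sum_le_card_nsmul E _ _ this

theorem harmonic_mono : Monotone harmonic := monotone_nat_of_le_succ fun k => by
  rw [harmonic_succ]
  have : (0 : ℚ) ≤ ((k + 1 : ℕ) : ℚ)⁻¹ := by positivity
  linarith

/-- The level of the chosen `k` leaves at most as many vertices as its rank from the top, so the
extreme case is that of distinct levels. Induction inserts a vertex `a` of minimal level: it
survives no other choice, and choosing it leaves at most `s`. -/
theorem isPotential_harmonicPotential {V : Type} : IsPotential (harmonicPotential (V := V)) := by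
  classical
  refine ⟨fun E m => ?_, fun E E' m h => ?_, fun E m => ?_⟩
  · unfold harmonicPotential
    have := harmonic_mono (Nat.zero_le E.card)
    rw [harmonic_zero] at this
    exact_mod_cast this
  · unfold harmonicPotential
    exact_mod_cast harmonic_mono (Finset.card_le_card h)
  · unfold harmonicPotential
    induction E using Finset.induction_on_min_value m with
    | empty => simp
    | insert a s ha hmin ih =>
      rw [Finset.sum_insert ha]
      have h1 : ∀ k ∈ s, (insert a s).filter (fun k' => m k < m k') =
          s.filter fun k' => m k < m k' := by
        intro k hk
        rw [Finset.filter_insert, if_neg (not_lt.2 (hmin k hk))]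
      rw [Finset.sum_congr rfl fun k hk => by rw [h1 k hk]]
      have h2 : (harmonic ((insert a s).filter fun k' => m a < m k').card : ℝ) ≤
          harmonic s.card := by
        have : ((insert a s).filter fun k' => m a < m k') ⊆ s := by
          rw [Finset.filter_insert, if_neg (lt_irrefl _)]
          exact Finset.filter_subset _ _
        exact_mod_cast harmonic_mono (Finset.card_le_card this)
      rw [Finset.card_insert_of_notMem ha, harmonic_succ]
      have hpos : ((s.card : ℝ) + 1) ≠ 0 := by positivity
      -- With s elements, this is (s+1)(H_{s+1} - 1) = H_s + s(H_s - 1), the equality behind the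
      -- harmonic recursion.
      have h3 : (((s.card + 1 : ℕ) : ℝ)) * ((((harmonic s.card + ((s.card + 1 : ℕ) : ℚ)⁻¹ : ℚ)) : ℝ) - 1)
          = harmonic s.card + s.card * ((harmonic s.card : ℝ) - 1) := by
        push_cast
        field_simp
        ring
      rw [h3]
      linarith

/-! ## Distances, levels and the linear program -/

theorem mem_edges {i j : Fin n} (h : i ≠ j) : s(i, j) ∈ edges n := by
  simp [edges, h]

theorem exists_of_mem_edges {e : Sym2 (Fin n)} (h : e ∈ edges n) : ∃ i j, i ≠ j ∧ e = s(i, j) := by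
  induction e with
  | h i j => exact ⟨i, j, by simpa [edges] using h, rfl⟩

/-- Costs and the objective run over unordered pairs, budgets over ordered ones; this is the source
of the factors 2 in the final constants. -/
theorem sum_offDiag_eq (h : Sym2 (Fin n) → ℝ) :
    ∑ p ∈ (Finset.univ : Finset (Fin n)).offDiag, h s(p.1, p.2) = 2 * ∑ e ∈ edges n, h e := by
  have h1 : edges n = (Finset.univ : Finset (Fin n)).sym2.filter fun e => ¬ e.IsDiag := by
    ext e
    simp [edges]
  rw [h1, Finset.sum_sym2_filter_not_isDiag, two_mul,
    ← Finset.sum_filter_add_sum_filter_not _ (fun p : Fin n × Fin n => p.1 < p.2)]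
  congr 1
  refine Finset.sum_nbij' Prod.swap Prod.swap ?_ ?_ ?_ ?_ ?_
  · rintro ⟨a, b⟩ hp
    simp only [Finset.mem_filter, Finset.mem_offDiag, Finset.mem_univ, true_and, not_lt,
      Prod.swap_prod_mk] at hp ⊢
    exact ⟨Ne.symm hp.1, lt_of_le_of_ne hp.2 (Ne.symm hp.1)⟩
  · rintro ⟨a, b⟩ hp
    simp only [Finset.mem_filter, Finset.mem_offDiag, Finset.mem_univ, true_and, not_lt,
      Prod.swap_prod_mk] at hp ⊢
    exact ⟨Ne.symm hp.1, hp.2.le⟩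
  · rintro ⟨a, b⟩ _
    rfl
  · rintro ⟨a, b⟩ _
    rfl
  · rintro ⟨a, b⟩ _
    simp only [Prod.swap_prod_mk]
    rw [Sym2.eq_swap]

namespace Instance

variable (I : Instance n)

theorem length_distances : I.distances.length = I.numLevels := Finset.length_sort _

theorem mem_distances {e : Sym2 (Fin n)} (he : e ∈ edges n) : I.x e ∈ I.distances := by
  rw [distances, Finset.mem_sort]
  exact Finset.mem_image_of_mem _ he

theorem level_mem {e : Sym2 (Fin n)} (he : e ∈ edges n) :
    I.level e ∈ Finset.Icc 1 I.numLevels := by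
  have := List.idxOf_lt_length_of_mem (I.mem_distances he)
  rw [I.length_distances] at this
  rw [Finset.mem_Icc, level]
  omega

theorem d_eq {ℓ : ℕ} (h : ℓ ∈ Finset.Icc 1 I.numLevels) :
    ∃ hℓ : ℓ - 1 < I.distances.length, I.d ℓ = I.distances[ℓ - 1] := by
  rw [Finset.mem_Icc] at h
  have hℓ : ℓ - 1 < I.distances.length := by
    rw [I.length_distances]
    omega
  exact ⟨hℓ, List.getD_eq_getElem _ _ hℓ⟩

theorem d_level {e : Sym2 (Fin n)} (he : e ∈ edges n) : I.d (I.level e) = I.x e := by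
  obtain ⟨h1, h2⟩ := I.d_eq (I.level_mem he)
  rw [h2]
  exact List.getElem_idxOf h1

theorem d_lt {a b : ℕ} (ha : a ∈ Finset.Icc 1 I.numLevels) (hb : b ∈ Finset.Icc 1 I.numLevels)
    (hab : a < b) : I.d b < I.d a := by
  obtain ⟨h1, h2⟩ := I.d_eq ha
  obtain ⟨h3, h4⟩ := I.d_eq hb
  rw [h2, h4]
  rw [Finset.mem_Icc] at ha
  exact (Finset.sortedGT_sort _).getElem_gt_getElem_of_lt (by omega)

theorem d_le_iff {a b : ℕ} (ha : a ∈ Finset.Icc 1 I.numLevels)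
    (hb : b ∈ Finset.Icc 1 I.numLevels) : I.d a ≤ I.d b ↔ b ≤ a := by
  constructor
  · intro h
    by_contra hab
    exact absurd (I.d_lt ha hb (not_le.1 hab)) (not_lt.2 h)
  · intro h
    rcases h.eq_or_lt with rfl | h
    · exact le_rfl
    · exact (I.d_lt hb ha h).le

theorem d_inj {a b : ℕ} (ha : a ∈ Finset.Icc 1 I.numLevels)
    (hb : b ∈ Finset.Icc 1 I.numLevels) : I.d a = I.d b ↔ a = b := by
  rw [le_antisymm_iff, I.d_le_iff ha hb, I.d_le_iff hb ha]
  omega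

theorem min_d {a b : ℕ} (ha : a ∈ Finset.Icc 1 I.numLevels)
    (hb : b ∈ Finset.Icc 1 I.numLevels) : min (I.d a) (I.d b) = I.d (max a b) := by
  rcases le_total a b with h | h
  · rw [max_eq_right h, min_eq_right ((I.d_le_iff hb ha).2 h)]
  · rw [max_eq_left h, min_eq_left ((I.d_le_iff ha hb).2 h)]

theorem max_d {a b : ℕ} (ha : a ∈ Finset.Icc 1 I.numLevels)
    (hb : b ∈ Finset.Icc 1 I.numLevels) : max (I.d a) (I.d b) = I.d (min a b) := by
  rcases le_total a b with h | h
  · rw [min_eq_left h, max_eq_left ((I.d_le_iff hb ha).2 h)]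
  · rw [min_eq_right h, max_eq_right ((I.d_le_iff ha hb).2 h)]

theorem d_pos {a : ℕ} (ha : a ∈ Finset.Icc 1 I.numLevels) : 0 < I.d a := by
  obtain ⟨h1, h2⟩ := I.d_eq ha
  have h3 : I.d a ∈ I.distances := h2 ▸ List.getElem_mem h1
  rw [distances, Finset.mem_sort, Finset.mem_image] at h3
  obtain ⟨e, he, h⟩ := h3
  obtain ⟨i, j, hij, rfl⟩ := exists_of_mem_edges he
  rw [← h]
  exact I.x_pos i j hij

theorem w_nonneg' {e : Sym2 (Fin n)} (he : e ∈ edges n) : 0 ≤ I.w e := by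
  obtain ⟨i, j, hij, rfl⟩ := exists_of_mem_edges he
  exact I.w_nonneg i j hij

theorem numLevels_le : I.numLevels ≤ n * n := by
  refine Finset.card_image_le.trans ?_
  have h := sum_offDiag_eq (n := n) fun _ => 1
  simp only [Finset.sum_const, Finset.offDiag_card, Finset.card_univ, Fintype.card_fin] at h
  have h' : n * n - n = 2 * (edges n).card := by
    have : ((n * n - n : ℕ) : ℝ) = ((2 * (edges n).card : ℕ) : ℝ) := by simpa using h
    exact_mod_cast this
  omega

theorem one_le_numLevels {i j : Fin n} (h : i ≠ j) : 1 ≤ I.numLevels := by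
  have := I.level_mem (mem_edges h)
  rw [Finset.mem_Icc] at this
  omega

/-! ### The value of the linear program is at most the optimal value -/

/-- Being closer than a fixed threshold is a transitive relation in an ultrametric, so the threshold
indicators satisfy the LP triangle inequalities. No constraint asks for y_L = 1, so distances of `z`
below all input distances do no harm. -/
theorem lpFeasible_of_isUltrametric {z : PairFun n} (hz : IsUltrametric z) :
    I.LPFeasible fun ℓ e => if ℓ ∈ Finset.Icc 1 I.numLevels ∧ I.d ℓ ≤ z e then 1 else 0 where
  level_zero e := by simp
  diag_zero ℓ i := by
    rw [if_neg]
    rintro ⟨hℓ, h⟩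
    rw [hz.self_zero] at h
    exact absurd (I.d_pos hℓ) (not_lt.2 h)
  triangle ℓ h1 h2 i j k := by
    have hℓ : ℓ ∈ Finset.Icc 1 I.numLevels := Finset.mem_Icc.2 ⟨h1, h2⟩
    simp only [hℓ, true_and]
    have := hz.ultra i k j
    by_cases hij : I.d ℓ ≤ z s(i, j)
    · rcases le_max_iff.1 (hij.trans this) with h | h
      · rw [if_pos h, if_pos hij]
        split_ifs <;> norm_num
      · rw [if_pos hij, if_pos h]
        split_ifs <;> norm_num
    · rw [if_neg hij]
      split_ifs <;> norm_num
  mono ℓ h1 h2 i j := by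
    have hℓ : ℓ ∈ Finset.Icc 1 I.numLevels := Finset.mem_Icc.2 ⟨h1, h2⟩
    by_cases h : ℓ - 1 ∈ Finset.Icc 1 I.numLevels ∧ I.d (ℓ - 1) ≤ z s(i, j)
    · rw [if_pos h, if_pos ⟨hℓ, le_trans ((I.d_le_iff hℓ h.1).2 (by omega)) h.2⟩]
    · rw [if_neg h]
      split_ifs <;> norm_num
  nonneg ℓ _ _ i j := by split_ifs <;> norm_num
  le_one ℓ _ _ i j := by split_ifs <;> norm_num

/-- Only an inequality: a value of `z` strictly between d_ℓ and d_{ℓ-1} disagrees with the input but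
adds nothing to the objective. -/
theorem lpObjective_le_cost {z : PairFun n} :
    I.lpObjective (fun ℓ e => if ℓ ∈ Finset.Icc 1 I.numLevels ∧ I.d ℓ ≤ z e then 1 else 0) ≤
      I.cost z := by
  refine Finset.sum_le_sum fun e he => ?_
  have hw := I.w_nonneg' he
  have hl := I.level_mem he
  have hd := I.d_level he
  have hne : I.d (I.level e) ≤ z e → I.level e - 1 ∈ Finset.Icc 1 I.numLevels ∧
      I.d (I.level e - 1) ≤ z e → z e ≠ I.x e := by
    rintro - ⟨h1, h2⟩
    have : I.d (I.level e) < I.d (I.level e - 1) := by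
      refine I.d_lt h1 hl ?_
      rw [Finset.mem_Icc] at h1
      omega
    rw [← hd]
    exact (this.trans_le h2).ne'
  have hne' : ¬ I.d (I.level e) ≤ z e → z e ≠ I.x e := by
    intro h h'
    rw [hd, h'] at h
    exact h le_rfl
  have hback : I.level e - 1 ∈ Finset.Icc 1 I.numLevels ∧
      I.d (I.level e - 1) ≤ z e → I.d (I.level e) ≤ z e := by
    rintro ⟨h1, h2⟩
    exact ((I.d_le_iff hl h1).2 (by omega)).trans h2
  simp only [hl, true_and]
  by_cases h1 : I.d (I.level e) ≤ z e
  · rw [if_pos h1]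
    by_cases h2 : I.level e - 1 ∈ Finset.Icc 1 I.numLevels ∧ I.d (I.level e - 1) ≤ z e
    · rw [if_pos h2, if_pos (hne h1 h2)]
      linarith
    · rw [if_neg h2]
      split_ifs <;> linarith
  · rw [if_neg h1, if_pos (hne' h1), if_neg fun h2 => h1 (hback h2)]
    linarith

theorem lpObjective_le_opt {y : ℕ → PairFun n} (hy : I.LPOptimal y) : I.lpObjective y ≤ I.opt := by
  refine le_csInf ?_ ?_
  -- The infimum needs a nonempty set; the uniform metric is an ultrametric.
  · classical
    refine ⟨_, fun e => if e.IsDiag then 0 else 1, ⟨fun i => by simp, fun i j h => by simp [h],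
      fun i j k => ?_⟩, rfl⟩
    simp only [Sym2.mk_isDiag_iff]
    by_cases h1 : i = j
    · subst h1
      simp
    · rw [if_neg h1]
      refine le_trans ?_ (le_max_left _ _)
      split_ifs <;> norm_num
  · rintro c ⟨z, hz, rfl⟩
    exact (hy.optimal _ (I.lpFeasible_of_isUltrametric hz)).trans I.lpObjective_le_cost

/-! ### Optimal solutions exist -/

theorem isClosed_lpFeasible : IsClosed {y : ℕ → PairFun n | I.LPFeasible y} := by
  have : {y : ℕ → PairFun n | I.LPFeasible y} = {y | ∀ e, y 0 e = 0} ∩ {y | ∀ ℓ i, y ℓ s(i, i) = 0} ∩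
      {y | ∀ ℓ, 1 ≤ ℓ → ℓ ≤ I.numLevels → ∀ i j k, y ℓ s(i, j) ≤ y ℓ s(i, k) + y ℓ s(k, j)} ∩
      {y | ∀ ℓ, 1 ≤ ℓ → ℓ ≤ I.numLevels → ∀ i j, y (ℓ - 1) s(i, j) ≤ y ℓ s(i, j)} ∩
      {y | ∀ ℓ, 1 ≤ ℓ → ℓ ≤ I.numLevels → ∀ i j, 0 ≤ y ℓ s(i, j)} ∩
      {y | ∀ ℓ, 1 ≤ ℓ → ℓ ≤ I.numLevels → ∀ i j, y ℓ s(i, j) ≤ 1} := by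
    ext y
    constructor
    · rintro ⟨h1, h2, h3, h4, h5, h6⟩
      exact ⟨⟨⟨⟨⟨h1, h2⟩, h3⟩, h4⟩, h5⟩, h6⟩
    · rintro ⟨⟨⟨⟨⟨h1, h2⟩, h3⟩, h4⟩, h5⟩, h6⟩
      exact ⟨h1, h2, h3, h4, h5, h6⟩
  rw [this]
  simp only [Set.ofPred_forall]
  refine ((((IsClosed.inter ?_ ?_).inter ?_).inter ?_).inter ?_).inter ?_
  · exact isClosed_iInter fun e => isClosed_eq (by fun_prop) (by fun_prop)
  · exact isClosed_iInter fun ℓ => isClosed_iInter fun i => isClosed_eq (by fun_prop) (by fun_prop)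
  · exact isClosed_iInter fun ℓ => isClosed_iInter fun _ => isClosed_iInter fun _ =>
      isClosed_iInter fun i => isClosed_iInter fun j => isClosed_iInter fun k =>
        isClosed_le (by fun_prop) (by fun_prop)
  all_goals
    exact isClosed_iInter fun ℓ => isClosed_iInter fun _ => isClosed_iInter fun _ =>
      isClosed_iInter fun i => isClosed_iInter fun j => isClosed_le (by fun_prop) (by fun_prop)

/-- A continuous function has a minimum on the compact box of [0,1]-valued tables intersected with
the closed feasible set. A minimiser can then be raised to 1 on the top level. -/
theorem exists_lpOptimal : ∃ y : ℕ → PairFun n, I.LPOptimal y := by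
  classical
  set S : Set (ℕ → PairFun n) := (Set.univ.pi fun _ => Set.univ.pi fun _ => Set.Icc 0 1) ∩
    {y | I.LPFeasible y} with hS
  have hcomp : IsCompact S :=
    (isCompact_univ_pi fun _ => isCompact_univ_pi fun _ => isCompact_Icc).inter_right
      I.isClosed_lpFeasible
  have hne : S.Nonempty := ⟨fun _ _ => 0, fun _ _ _ _ => ⟨le_rfl, zero_le_one⟩,
    ⟨fun _ => rfl, fun _ _ => rfl, by simp, by simp, by simp, by simp⟩⟩
  have hcont : Continuous (I.lpObjective : (ℕ → PairFun n) → ℝ) := by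
    unfold lpObjective
    fun_prop
  obtain ⟨y, hyS, hmin⟩ := hcomp.exists_isMinOn hne hcont.continuousOn
  have hy : I.LPFeasible y := hyS.2
  have hopt : ∀ y', I.LPFeasible y' → I.lpObjective y ≤ I.lpObjective y' := by
    intro y' hy'
    -- Levels above L are subject to no bounds; setting them to zero moves a feasible solution into
    -- the box without changing the objective.
    set y'' : ℕ → PairFun n := fun ℓ e => if ℓ ≤ I.numLevels then y' ℓ e else 0 with hy''
    have h1 : y'' ∈ S := by
      refine ⟨?_, ?_⟩
      · rw [Set.mem_univ_pi]
        intro ℓ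
        rw [Set.mem_univ_pi]
        intro e
        rw [hy'']
        dsimp only
        split_ifs with h
        · rcases Nat.eq_zero_or_pos ℓ with rfl | hℓ
          · rw [hy'.level_zero]
            simp
          · induction e with
            | h i j => exact ⟨hy'.nonneg ℓ hℓ h i j, hy'.le_one ℓ hℓ h i j⟩
        · simp
      · refine ⟨fun e => ?_, fun ℓ i => ?_, fun ℓ h1 h2 => ?_, fun ℓ h1 h2 => ?_, fun ℓ h1 h2 => ?_,
          fun ℓ h1 h2 => ?_⟩
        · simp [hy'', hy'.level_zero]
        · simp [hy'', hy'.diag_zero]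
        · simpa [hy'', h2] using hy'.triangle ℓ h1 h2
        · have h3 : ℓ ≤ I.numLevels + 1 := by omega
          simpa [hy'', h2, h3] using hy'.mono ℓ h1 h2
        · simpa [hy'', h2] using hy'.nonneg ℓ h1 h2
        · simpa [hy'', h2] using hy'.le_one ℓ h1 h2
    have h2 : I.lpObjective y'' = I.lpObjective y' := by
      refine Finset.sum_congr rfl fun e he => ?_
      have := Finset.mem_Icc.1 (I.level_mem he)
      rw [hy'']
      dsimp only
      rw [if_pos this.2, if_pos (by omega)]
    rw [← h2]
    exact hmin h1
  -- Since no input level exceeds L, the value y_L enters the objective only with a minus sign, so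
  -- raising it does not increase the objective.
  set z : ℕ → PairFun n := fun ℓ e => if ℓ = I.numLevels ∧ ¬ e.IsDiag then 1 else y ℓ e with hz
  have hz0 : ∀ ℓ i, z ℓ s(i, i) = 0 := fun ℓ i => by simp [hz, hy.diag_zero]
  have hz1 : ∀ ℓ i j, ℓ ≠ I.numLevels → z ℓ s(i, j) = y ℓ s(i, j) := fun ℓ i j h => by simp [hz, h]
  have hz2 : ∀ i j, i ≠ j → z I.numLevels s(i, j) = 1 := fun i j h => by simp [hz, h]
  have hbd : ∀ ℓ, 1 ≤ ℓ → ℓ ≤ I.numLevels → ∀ i j, y ℓ s(i, j) ≤ z ℓ s(i, j) ∧ z ℓ s(i, j) ≤ 1 := by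
    intro ℓ h1 h2 i j
    have := hy.le_one ℓ h1 h2 i j
    rw [hz]
    dsimp only
    split_ifs
    · exact ⟨this, le_rfl⟩
    · exact ⟨le_rfl, this⟩
  have hzf : I.LPFeasible z := by
    refine ⟨fun e => ?_, hz0, fun ℓ h1 h2 i j k => ?_, fun ℓ h1 h2 i j => ?_,
      fun ℓ h1 h2 i j => (hy.nonneg ℓ h1 h2 i j).trans (hbd ℓ h1 h2 i j).1,
      fun ℓ h1 h2 i j => (hbd ℓ h1 h2 i j).2⟩
    · induction e with
      | h i j =>
        by_cases h : i = j
        · subst h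
          exact hz0 0 i
        -- A pair of distinct vertices forces L ≥ 1, so the raised level is not level 0.
        · have := I.one_le_numLevels h
          rw [hz1 _ _ _ (by omega), hy.level_zero]
    · by_cases hℓ : ℓ = I.numLevels
      · subst hℓ
        have hnn : ∀ i j, 0 ≤ z I.numLevels s(i, j) := fun i j =>
          (hy.nonneg _ h1 h2 i j).trans (hbd _ h1 h2 i j).1
        by_cases hij : i = j
        · subst hij
          rw [hz0]
          exact add_nonneg (hnn _ _) (hnn _ _)
        · rw [hz2 i j hij]
          by_cases hik : i = k
          · subst hik
            rw [hz2 i j hij]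
            linarith [hnn i i]
          · rw [hz2 i k hik]
            linarith [hnn k j]
      · rw [hz1 _ _ _ hℓ, hz1 _ _ _ hℓ, hz1 _ _ _ hℓ]
        exact hy.triangle ℓ h1 h2 i j k
    · rw [hz1 (ℓ - 1) i j (by omega)]
      exact (hy.mono ℓ h1 h2 i j).trans (hbd ℓ h1 h2 i j).1
  refine ⟨z, hzf, fun y' hy' => le_trans (Finset.sum_le_sum fun e he => ?_) (hopt y' hy'), hz2⟩
  have hl := Finset.mem_Icc.1 (I.level_mem he)
  obtain ⟨i, j, hij, rfl⟩ := exists_of_mem_edges he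
  refine mul_le_mul_of_nonneg_left ?_ (I.w_nonneg' he)
  rw [hz1 (I.level s(i, j) - 1) i j (by omega)]
  linarith [(hbd _ hl.1 hl.2 i j).1]

end Instance

/-! ## One round of the algorithm -/

/-! ### Sums over ordered triangles and their symmetries. -/

/-- The sum over all triples of distinct elements. -/
def tripleSum {ι : Type} [DecidableEq ι] (V : Finset ι) (h : ι → ι → ι → ℝ) : ℝ :=
  ∑ i ∈ V, ∑ j ∈ V, ∑ k ∈ V, if i ≠ j ∧ i ≠ k ∧ j ≠ k then h i j k else 0

section TripleSum

variable {ι : Type} [DecidableEq ι] {V : Finset ι}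

theorem sum_offDiag_eq_sum_sum (V : Finset ι) (h : ι → ι → ℝ) :
    ∑ p ∈ V.offDiag, h p.1 p.2 = ∑ j ∈ V, ∑ k ∈ V, if j ≠ k then h j k else 0 := by
  have : V.offDiag = (V ×ˢ V).filter fun p => p.1 ≠ p.2 := by
    ext p
    simp [and_assoc]
  rw [this, Finset.sum_filter, Finset.sum_product]

theorem tripleSum_eq (V : Finset ι) (h : ι → ι → ι → ℝ) :
    tripleSum V h = ∑ i ∈ V, ∑ p ∈ (V.erase i).offDiag, h i p.1 p.2 := by
  refine Finset.sum_congr rfl fun i hi => ?_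
  rw [sum_offDiag_eq_sum_sum, ← Finset.add_sum_erase V _ hi]
  simp only [ne_eq, not_true_eq_false, false_and, if_false, Finset.sum_const_zero, zero_add]
  refine Finset.sum_congr rfl fun j hj => ?_
  rw [← Finset.add_sum_erase V _ hi]
  simp only [not_true_eq_false, false_and, and_false, if_false, zero_add]
  refine Finset.sum_congr rfl fun k hk => ?_
  have h1 := (Finset.mem_erase.1 hj).1.symm
  have h2 := (Finset.mem_erase.1 hk).1.symm
  simp only [h1, h2, not_false_eq_true, true_and]

theorem tripleSum_eq' (V : Finset ι) (h : ι → ι → ι → ℝ) :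
    tripleSum V h = ∑ p ∈ V.offDiag, ∑ i ∈ V, if i ≠ p.1 ∧ i ≠ p.2 then h i p.1 p.2 else 0 := by
  rw [sum_offDiag_eq_sum_sum V fun j k => ∑ i ∈ V, if i ≠ j ∧ i ≠ k then h i j k else 0, tripleSum,
    Finset.sum_comm]
  refine Finset.sum_congr rfl fun j _ => ?_
  rw [Finset.sum_comm]
  refine Finset.sum_congr rfl fun k _ => ?_
  by_cases hjk : j = k
  · subst hjk
    simp
  · simp [hjk]

theorem tripleSum_swap (h : ι → ι → ι → ℝ) :
    tripleSum V (fun i j k => h j i k) = tripleSum V h := by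
  unfold tripleSum
  rw [Finset.sum_comm]
  refine Finset.sum_congr rfl fun i _ => Finset.sum_congr rfl fun j _ =>
    Finset.sum_congr rfl fun k _ => if_congr ?_ rfl rfl
  constructor
  · rintro ⟨h1, h2, h3⟩
    exact ⟨h1.symm, h3, h2⟩
  · rintro ⟨h1, h2, h3⟩
    exact ⟨h1.symm, h3, h2⟩

theorem tripleSum_swap' (h : ι → ι → ι → ℝ) :
    tripleSum V (fun i j k => h i k j) = tripleSum V h := by
  unfold tripleSum
  refine Finset.sum_congr rfl fun i _ => ?_
  rw [Finset.sum_comm]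
  refine Finset.sum_congr rfl fun j _ => Finset.sum_congr rfl fun k _ => if_congr ?_ rfl rfl
  constructor
  · rintro ⟨h1, h2, h3⟩
    exact ⟨h2, h1, h3.symm⟩
  · rintro ⟨h1, h2, h3⟩
    exact ⟨h2, h1, h3.symm⟩

/-- Payments of different edges of a triangle, each with the opposite vertex as pivot, agree after
summation over all ordered triangles. -/
theorem tripleSum_rotate (h : ι → ι → ι → ℝ) :
    tripleSum V (fun i j k => h k i j) = tripleSum V h := by
  rw [← tripleSum_swap h, ← tripleSum_swap' fun i j k => h j i k]

theorem tripleSum_add (h h' : ι → ι → ι → ℝ) :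
    tripleSum V (fun i j k => h i j k + h' i j k) = tripleSum V h + tripleSum V h' := by
  simp only [tripleSum, ← Finset.sum_add_distrib]
  refine Finset.sum_congr rfl fun i _ => Finset.sum_congr rfl fun j _ =>
    Finset.sum_congr rfl fun k _ => ?_
  split_ifs <;> simp

theorem tripleSum_mul (c : ℝ) (h : ι → ι → ι → ℝ) :
    tripleSum V (fun i j k => c * h i j k) = c * tripleSum V h := by
  simp only [tripleSum, Finset.mul_sum]
  refine Finset.sum_congr rfl fun i _ => Finset.sum_congr rfl fun j _ =>
    Finset.sum_congr rfl fun k _ => ?_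
  split_ifs <;> simp

theorem tripleSum_mono {h h' : ι → ι → ι → ℝ} (hle : ∀ i ∈ V, ∀ j ∈ V, ∀ k ∈ V,
    i ≠ j → i ≠ k → j ≠ k → h i j k ≤ h' i j k) : tripleSum V h ≤ tripleSum V h' := by
  refine Finset.sum_le_sum fun i hi => Finset.sum_le_sum fun j hj => Finset.sum_le_sum fun k hk => ?_
  split_ifs with hd
  · exact hle i hi j hj k hk hd.1 hd.2.1 hd.2.2
  · exact le_rfl

end TripleSum

/-! ### Good cost, eligible pivots, budgets and the charging argument. -/

/-- The cumulative distribution function of the level of an edge. -/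
def cdf (y : ℕ → PairFun n) (u : ℕ) (e : Sym2 (Fin n)) : ℕ → ℝ := fun ℓ => trunc y u ℓ e

namespace Instance

variable (I : Instance n) (y : ℕ → PairFun n)

/-- The contribution of an edge of unit weight to the objective of the linear program. -/
def lp (e : Sym2 (Fin n)) : ℝ := 1 - y (I.level e) e + y (I.level e - 1) e

open Classical in
/-- The level on which the edge is concentrated, or zero. -/
def detLevel (e : Sym2 (Fin n)) : ℕ :=
  if h : Concentrated I.numLevels (fun ℓ => y ℓ e) then h.choose else 0

/-- The pivots in `V` that send `j` and `k` to the same level larger than `u` with certainty. -/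
def eligible (u : ℕ) (V : Finset (Fin n)) (j k : Fin n) : Finset (Fin n) :=
  V.filter fun i => i ≠ j ∧ i ≠ k ∧ I.detLevel y s(i, j) = I.detLevel y s(i, k) ∧
    u < I.detLevel y s(i, j)

/-- The eligible pivots that may remain after a round with pivot `i`. -/
def remaining (u : ℕ) (V : Finset (Fin n)) (i j k : Fin n) : Finset (Fin n) :=
  if i ∈ I.eligible y u V j k then
    (I.eligible y u V j k).filter fun i' => I.detLevel y s(i, j) < I.detLevel y s(i', j)
  else I.eligible y u V j k

/-- The budget of a call of the algorithm. -/
def budget (f : Finset (Fin n) → (Fin n → ℕ) → ℝ) (V : Finset (Fin n)) (u : ℕ) : ℝ :=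
  27 * ∑ p ∈ V.offDiag, I.w s(p.1, p.2) * I.lp y s(p.1, p.2) *
    (1 + f (I.eligible y u V p.1 p.2) fun i => I.detLevel y s(i, p.1))

open Classical in
/-- Twice the weighted disagreement on the edges with a small contribution to the objective. -/
def goodCost (z : PairFun n) : ℝ :=
  ∑ p ∈ (Finset.univ : Finset (Fin n)).offDiag,
    if I.lp y s(p.1, p.2) < 1 / 3 ∧ z s(p.1, p.2) ≠ I.x s(p.1, p.2) then I.w s(p.1, p.2) else 0

open Classical in
/-- An upper bound on the cost and the remaining budget after a round with pivot `i`, in terms of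
the table `x'` of distances from the pivot. -/
def roundBound (f : Finset (Fin n) → (Fin n → ℕ) → ℝ) (V : Finset (Fin n)) (x : PairFun n) (u : ℕ)
    (i : Fin n) (x' : PairFun n) : ℝ :=
  I.goodCost y x + ∑ p ∈ (V.erase i).offDiag,
    ((if I.lp y s(p.1, p.2) < 1 / 3 ∧ u ≤ I.level s(p.1, p.2) then I.w s(p.1, p.2) else 0) *
      (if fixValue (x' s(i, p.1)) (x' s(i, p.2)) (I.x s(p.1, p.2)) ≠ I.x s(p.1, p.2) then 1 else 0) +
    27 * (I.w s(p.1, p.2) * I.lp y s(p.1, p.2) *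
      (1 + f (I.remaining y u V i p.1 p.2) fun i' => I.detLevel y s(i', p.1))) *
      if x' s(i, p.1) = x' s(i, p.2) then 1 else 0)

variable {I y}

theorem LPOptimal.isCdf (hy : I.LPOptimal y) {u : ℕ} (hu1 : 1 ≤ u) (hu : u ≤ I.numLevels)
    {e : Sym2 (Fin n)} (he : e ∈ edges n) : IsCdf I.numLevels (cdf y u e) := by
  obtain ⟨i, j, hij, rfl⟩ := exists_of_mem_edges he
  refine ⟨if_pos (by omega), fun ℓ hℓ => ?_, ?_⟩
  · rw [Finset.mem_Icc] at hℓ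
    unfold cdf trunc
    have h1 := hy.feasible.nonneg ℓ hℓ.1 hℓ.2 i j
    have h2 := hy.feasible.mono ℓ hℓ.1 hℓ.2 i j
    by_cases h : ℓ < u
    · rw [if_pos h, if_pos (by omega)]
    · rw [if_neg h]
      split_ifs <;> assumption
  · unfold cdf trunc
    rw [if_neg (by omega)]
    exact hy.top_one i j hij

theorem LPOptimal.isTriangle (hy : I.LPOptimal y) (u : ℕ) (i j k : Fin n) :
    IsTriangle I.numLevels (cdf y u s(i, j)) (cdf y u s(i, k)) (cdf y u s(j, k)) := by
  intro ℓ hℓ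
  unfold cdf trunc
  by_cases h : ℓ < u
  · simp [h]
  · simp only [h, if_false]
    rcases Nat.eq_zero_or_pos ℓ with rfl | hℓ0
    · simp [hy.feasible.level_zero]
    · have h1 := hy.feasible.triangle ℓ hℓ0 hℓ i j k
      have h2 := hy.feasible.triangle ℓ hℓ0 hℓ i k j
      have h3 := hy.feasible.triangle ℓ hℓ0 hℓ j k i
      rw [Sym2.eq_swap (a := k) (b := j)] at h1
      rw [Sym2.eq_swap (a := j) (b := i)] at h3
      exact ⟨h1, h2, h3⟩

/-- Truncation collects the mass below `u` on level `u` and leaves the levels above alone. Hence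
eligibility, which asks for levels above `u`, can be defined by the untruncated solution and
compared between calls. -/
theorem incr_cdf_of_lt {u ℓ : ℕ} (h : u < ℓ) (e : Sym2 (Fin n)) :
    incr (cdf y u e) ℓ = incr (fun ℓ => y ℓ e) ℓ := by
  unfold incr cdf trunc
  rw [if_neg (by omega), if_neg (by omega)]

theorem incr_cdf_of_gt {u ℓ : ℕ} (h : ℓ < u) (e : Sym2 (Fin n)) : incr (cdf y u e) ℓ = 0 := by
  unfold incr cdf trunc
  rw [if_pos (by omega), if_pos (by omega), sub_zero]

theorem LPOptimal.le (hy : I.LPOptimal y) {e : Sym2 (Fin n)} {a b : ℕ} (hab : a ≤ b)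
    (hb : b ≤ I.numLevels) : y a e ≤ y b e := by
  induction b, hab using Nat.le_induction with
  | base => exact le_rfl
  | succ b hab ih =>
    refine (ih (by omega)).trans ?_
    induction e with
    | h i j => simpa using hy.feasible.mono (b + 1) (by omega) hb i j

theorem LPOptimal.nonneg (hy : I.LPOptimal y) {e : Sym2 (Fin n)} {a : ℕ} (ha : a ≤ I.numLevels) :
    0 ≤ y a e :=
  (hy.feasible.level_zero e).symm.le.trans (hy.le (Nat.zero_le a) ha)

/-- Truncation moves mass from below `u` up to `u`, so the mass of the input level is still
contained in that of `max (I.level e) u`. -/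
theorem LPOptimal.lp_ge (hy : I.LPOptimal y) {u : ℕ} (hu : u ≤ I.numLevels) {e : Sym2 (Fin n)}
    (he : e ∈ edges n) : 1 - incr (cdf y u e) (max (I.level e) u) ≤ I.lp y e := by
  have hl := Finset.mem_Icc.1 (I.level_mem he)
  unfold incr cdf trunc lp
  rcases lt_trichotomy u (I.level e) with h | h | h
  · rw [max_eq_left h.le, if_neg (by omega), if_neg (by omega)]
    linarith
  · have := hy.nonneg (e := e) (a := I.level e - 1) (by omega)
    rw [max_eq_left h.le, if_neg (by omega), if_pos (by omega)]
    linarith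
  · have h1 := hy.le (e := e) h.le hu
    have h2 := hy.nonneg (e := e) (a := I.level e - 1) (by omega)
    rw [max_eq_right h.le, if_neg (by omega), if_pos (by omega)]
    linarith

theorem LPOptimal.concentrated_of_lp_lt (hy : I.LPOptimal y) {u : ℕ} (hu : u ≤ I.numLevels)
    {e : Sym2 (Fin n)} (he : e ∈ edges n) (h : I.lp y e < 1 / 3) (hul : u ≤ I.level e) :
    2 / 3 < incr (cdf y u e) (I.level e) := by
  have := hy.lp_ge hu he
  rw [max_eq_left hul] at this
  linarith

theorem LPOptimal.lp_nonneg (hy : I.LPOptimal y) {e : Sym2 (Fin n)} (he : e ∈ edges n) :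
    0 ≤ I.lp y e := by
  have hl := Finset.mem_Icc.1 (I.level_mem he)
  obtain ⟨i, j, hij, rfl⟩ := exists_of_mem_edges he
  have h1 := hy.feasible.le_one _ hl.1 hl.2 i j
  have h2 := hy.nonneg (e := s(i, j)) (a := I.level s(i, j) - 1) (by omega)
  unfold lp
  linarith

theorem LPOptimal.detLevel_eq (hy : I.LPOptimal y) {e : Sym2 (Fin n)} (he : e ∈ edges n) {m : ℕ}
    (hm : m ∈ Finset.Icc 1 I.numLevels) (h : 2 / 3 < incr (fun ℓ => y ℓ e) m) :
    I.detLevel y e = m := by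
  have hc : Concentrated I.numLevels fun ℓ => y ℓ e := ⟨m, hm, h⟩
  have hcdf : IsCdf I.numLevels fun ℓ => y ℓ e := by
    obtain ⟨i, j, hij, rfl⟩ := exists_of_mem_edges he
    exact ⟨hy.feasible.level_zero _, fun ℓ hℓ => hy.le (by omega) (Finset.mem_Icc.1 hℓ).2,
      hy.top_one i j hij⟩
  rw [detLevel, dif_pos hc]
  exact hcdf.unique hc.choose_spec.1 hc.choose_spec.2 hm h

theorem detLevel_spec {e : Sym2 (Fin n)} (h : 0 < I.detLevel y e) :
    I.detLevel y e ∈ Finset.Icc 1 I.numLevels ∧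
      2 / 3 < incr (fun ℓ => y ℓ e) (I.detLevel y e) := by
  unfold detLevel at h ⊢
  split_ifs at h ⊢ with hc
  · exact hc.choose_spec
  · exact absurd h (lt_irrefl _)

theorem detLevel_le (e : Sym2 (Fin n)) : I.detLevel y e ≤ I.numLevels := by
  rcases Nat.eq_zero_or_pos (I.detLevel y e) with h | h
  · omega
  · exact (Finset.mem_Icc.1 (detLevel_spec h).1).2

theorem LPOptimal.mem_eligible (hy : I.LPOptimal y) {u m : ℕ} {V : Finset (Fin n)} {i j k : Fin n}
    (hi : i ∈ V) (hij : i ≠ j) (hik : i ≠ k) (hm : m ∈ Finset.Icc 1 I.numLevels) (hum : u < m)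
    (hj : 2 / 3 < incr (cdf y u s(i, j)) m) (hk : 2 / 3 < incr (cdf y u s(i, k)) m) :
    i ∈ I.eligible y u V j k := by
  rw [incr_cdf_of_lt hum] at hj hk
  have h1 := hy.detLevel_eq (mem_edges hij) hm hj
  have h2 := hy.detLevel_eq (mem_edges hik) hm hk
  rw [eligible, Finset.mem_filter, h1, h2]
  exact ⟨hi, hij, hik, rfl, hum⟩

/-- The part of the budget of the edge between `j` and `k` that a round with pivot `i` frees,
relative to the weight of the edge. -/
def freed (I : Instance n) (y : ℕ → PairFun n) (u : ℕ) (V : Finset (Fin n)) (i j k : Fin n) : ℝ :=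
  I.lp y s(j, k) * (sepProb I.numLevels (cdf y u s(i, j)) (cdf y u s(i, k)) +
    if i ∈ I.eligible y u V j k then 1 else 0)

theorem LPOptimal.freed_nonneg (hy : I.LPOptimal y) {u : ℕ} (hu1 : 1 ≤ u) (hu : u ≤ I.numLevels)
    (V : Finset (Fin n)) {i j k : Fin n} (hij : i ≠ j) (hik : i ≠ k) (hjk : j ≠ k) :
    0 ≤ freed I y u V i j k := by
  refine mul_nonneg (hy.lp_nonneg (mem_edges hjk)) (add_nonneg
    (sepProb_nonneg (hy.isCdf hu1 hu (mem_edges hij)) (hy.isCdf hu1 hu (mem_edges hik))) ?_)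
  split_ifs <;> norm_num

theorem eligible_comm (u : ℕ) (V : Finset (Fin n)) (j k : Fin n) :
    I.eligible y u V j k = I.eligible y u V k j := by
  unfold eligible
  refine Finset.filter_congr fun i _ => ?_
  constructor
  · rintro ⟨h1, h2, h3, h4⟩
    exact ⟨h2, h1, h3.symm, h3 ▸ h4⟩
  · rintro ⟨h1, h2, h3, h4⟩
    exact ⟨h2, h1, h3.symm, h3 ▸ h4⟩

/-- Seen from `k`, the payment of ij in `wrongProb_le` is what pivot `k` frees on ij: either the
levels of ik and jk differ, or both edges are concentrated on the level of jk above `u`, and then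
`k` is eligible for ij. -/
theorem LPOptimal.wrongProb_le_freed (hy : I.LPOptimal y) {u : ℕ} (hu1 : 1 ≤ u)
    (hu : u ≤ I.numLevels) {V : Finset (Fin n)} {i j k : Fin n} (hk : k ∈ V) (hij : i ≠ j)
    (hik : i ≠ k) (hjk : j ≠ k) (hg : I.lp y s(j, k) < 1 / 3) (hl : u ≤ I.level s(j, k)) :
    wrongProb I.numLevels (cdf y u s(i, j)) (cdf y u s(i, k)) (I.level s(j, k)) ≤
      9 * (freed I y u V i j k + freed I y u V k i j) := by
  have hij' := hy.isCdf hu1 hu (mem_edges hij)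
  have hik' := hy.isCdf hu1 hu (mem_edges hik)
  have hjk' := hy.isCdf hu1 hu (mem_edges hjk)
  have hv : max (I.level s(i, j)) u ∈ Finset.Icc 1 I.numLevels := by
    have := Finset.mem_Icc.1 (I.level_mem (mem_edges hij))
    rw [Finset.mem_Icc]
    omega
  have hr := hy.lp_ge hu (mem_edges hjk)
  rw [max_eq_left hl] at hr
  have hc := hy.concentrated_of_lp_lt hu (mem_edges hjk) hg hl
  refine (wrongProb_le hij' hik' hjk' (hy.isTriangle u i j k) (I.level_mem (mem_edges hjk)) hc
    (u := u) (fun ℓ hℓ => if_pos hℓ) hv (hy.lp_ge hu (mem_edges hij)) hr).trans ?_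
  refine mul_le_mul_of_nonneg_left (add_le_add ?_ ?_) (by norm_num)
  · refine mul_le_mul_of_nonneg_left (le_add_of_nonneg_right ?_) (hy.lp_nonneg (mem_edges hjk))
    split_ifs <;> norm_num
  · unfold freed
    refine mul_le_mul_of_nonneg_left (add_le_add ?_ ?_) (hy.lp_nonneg (mem_edges hij))
    · rw [Sym2.eq_swap (a := i) (b := k), Sym2.eq_swap (a := j) (b := k)]
    · by_cases h : 2 / 3 < incr (cdf y u s(i, k)) (I.level s(j, k)) ∧ u < I.level s(j, k)
      · rw [if_pos h, if_pos]
        refine hy.mem_eligible hk hik.symm hjk.symm (I.level_mem (mem_edges hjk)) h.2 ?_ ?_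
        · rw [Sym2.eq_swap]
          exact h.1
        · rw [Sym2.eq_swap (a := k)]
          exact hc
      · rw [if_neg h]
        split_ifs <;> norm_num

/-- The expected cost of a wrong decision is charged to the three edges of the triangle. -/
theorem LPOptimal.weighted_wrongProb_le (hy : I.LPOptimal y) {u : ℕ} (hu1 : 1 ≤ u)
    (hu : u ≤ I.numLevels) {V : Finset (Fin n)} {i j k : Fin n} (hj : j ∈ V) (hk : k ∈ V)
    (hij : i ≠ j) (hik : i ≠ k) (hjk : j ≠ k) :
    (if I.lp y s(j, k) < 1 / 3 ∧ u ≤ I.level s(j, k) then I.w s(j, k) else 0) *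
        wrongProb I.numLevels (cdf y u s(i, j)) (cdf y u s(i, k)) (I.level s(j, k)) ≤
      9 * (I.w s(j, k) * freed I y u V i j k + I.w s(i, j) * freed I y u V k i j +
        I.w s(i, k) * freed I y u V j i k) := by
  have h1 := hy.freed_nonneg hu1 hu V hij hik hjk
  have h2 := hy.freed_nonneg hu1 hu V hik.symm hjk.symm hij
  have h3 := hy.freed_nonneg hu1 hu V hij.symm hjk hik
  have w1 := I.w_nonneg j k hjk
  have w2 := I.w_nonneg i j hij
  have w3 := I.w_nonneg i k hik
  split_ifs with h
  · have hb1 := hy.wrongProb_le_freed hu1 hu hk hij hik hjk h.1 h.2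
    -- Exchanging `j` and `k` lets ik pay instead of ij.
    have hb2 := hy.wrongProb_le_freed hu1 hu (V := V) (i := i) (j := k) (k := j) hj hik hij hjk.symm
      (by rw [Sym2.eq_swap]; exact h.1) (by rw [Sym2.eq_swap]; exact h.2)
    have hsym : freed I y u V i k j = freed I y u V i j k := by
      unfold freed
      rw [eligible_comm, sepProb_comm, Sym2.eq_swap (a := k)]
    rw [wrongProb_comm, Sym2.eq_swap (a := k), hsym] at hb2
    set P := wrongProb I.numLevels (cdf y u s(i, j)) (cdf y u s(i, k)) (I.level s(j, k))
    have htri := I.w_triangle j i k hij.symm hik hjk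
    rw [Sym2.eq_swap (a := j) (b := i)] at htri
    set A := freed I y u V i j k
    set B := freed I y u V k i j
    set C := freed I y u V j i k
    -- With the minimum, w(jk) ≤ w(ij) + w(ik) can be split so that ij pays at most `B` and ik at
    -- most `C`.
    have hmin : P ≤ 9 * (A + min B C) := by
      rcases min_choice B C with h | h <;> rw [h] <;> assumption
    have hm0 : 0 ≤ min B C := le_min h2 h3
    calc I.w s(j, k) * P ≤ I.w s(j, k) * (9 * (A + min B C)) := mul_le_mul_of_nonneg_left hmin w1
      _ = 9 * (I.w s(j, k) * A + I.w s(j, k) * min B C) := by ring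
      _ ≤ 9 * (I.w s(j, k) * A + (I.w s(i, j) + I.w s(i, k)) * min B C) := by
        have := mul_le_mul_of_nonneg_right htri hm0
        linarith
      _ ≤ _ := by
        have h4 := mul_le_mul_of_nonneg_left (min_le_left B C) w2
        have h5 := mul_le_mul_of_nonneg_left (min_le_right B C) w3
        linarith
  · rw [zero_mul]
    positivity

/-- The budget of an edge pays for what a round frees and for the remaining budget. -/
theorem LPOptimal.edge_budget (hy : I.LPOptimal y) {f : Finset (Fin n) → (Fin n → ℕ) → ℝ}
    (hf : IsPotential f) {u : ℕ} (hu1 : 1 ≤ u) (hu : u ≤ I.numLevels) (V : Finset (Fin n))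
    {j k : Fin n} :
    ∑ i ∈ V, (if i ≠ j ∧ i ≠ k then
      sepProb I.numLevels (cdf y u s(i, j)) (cdf y u s(i, k)) +
        (if i ∈ I.eligible y u V j k then 1 else 0) +
        (1 + f (I.remaining y u V i j k) fun i' => I.detLevel y s(i', j)) *
          (1 - sepProb I.numLevels (cdf y u s(i, j)) (cdf y u s(i, k))) else 0) ≤
      V.card * (1 + f (I.eligible y u V j k) fun i' => I.detLevel y s(i', j)) := by
  set E := I.eligible y u V j k with hE
  set m : Fin n → ℕ := fun i' => I.detLevel y s(i', j) with hm
  have hf0 := hf.nonneg E m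
  have hEV : E ⊆ V := Finset.filter_subset _ _
  -- With separation probability s and remaining potential r, s + (1 + r)(1 - s) ≤ 1 + r. An
  -- eligible pivot adds 1, which the average drop in `hf.step` compensates.
  calc _ ≤ ∑ i ∈ V, (if i ∈ E then 2 + f (E.filter fun i' => m i < m i') m else 1 + f E m) := by
        refine Finset.sum_le_sum fun i _ => ?_
        by_cases hd : i ≠ j ∧ i ≠ k
        · rw [if_pos hd]
          have hs := sepProb_nonneg (hy.isCdf hu1 hu (mem_edges hd.1))
            (hy.isCdf hu1 hu (mem_edges hd.2))
          have hr := hf.nonneg (I.remaining y u V i j k) m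
          have := mul_nonneg hr hs
          by_cases hi : i ∈ E
          · have hrem : I.remaining y u V i j k = E.filter fun i' => m i < m i' := if_pos hi
            rw [hrem] at this ⊢
            rw [if_pos hi, if_pos hi]
            linarith
          · have hrem : I.remaining y u V i j k = E := if_neg hi
            rw [hrem] at this ⊢
            rw [if_neg hi, if_neg hi]
            linarith
        · rw [if_neg hd]
          have := hf.nonneg (E.filter fun i' => m i < m i') m
          split_ifs <;> linarith
    _ = ∑ i ∈ E, (2 + f (E.filter fun i' => m i < m i') m) + ∑ i ∈ V \ E, (1 + f E m) := by
        rw [Finset.sum_ite, Finset.filter_mem_eq_inter, Finset.inter_eq_right.2 hEV,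
          Finset.filter_notMem_eq_sdiff]
    _ ≤ E.card * (1 + f E m) + (V \ E).card * (1 + f E m) := by
        rw [Finset.sum_add_distrib]
        have := hf.step E m
        simp only [Finset.sum_const, nsmul_eq_mul]
        linarith
    _ = V.card * (1 + f E m) := by
        rw [← add_mul, ← Nat.cast_add, add_comm E.card, Finset.card_sdiff_add_card_eq_card hEV]

end Instance

namespace Instance

variable {I : Instance n} {y : ℕ → PairFun n}

theorem fixValue_d_ne_iff {a b : ℕ} (ha : a ∈ Finset.Icc 1 I.numLevels)
    (hb : b ∈ Finset.Icc 1 I.numLevels) {e : Sym2 (Fin n)} (he : e ∈ edges n) :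
    fixValue (I.d a) (I.d b) (I.x e) ≠ I.x e ↔ Wrong a b (I.level e) := by
  have hm := I.level_mem he
  have ha' := Finset.mem_Icc.1 ha
  have hb' := Finset.mem_Icc.1 hb
  have hm' := Finset.mem_Icc.1 hm
  rw [← I.d_level he, Ne, fixValue, I.min_d hm ha, I.max_d ha hb]
  simp only [I.d_inj ha hb]
  unfold Wrong
  by_cases hab : a = b
  · rw [if_pos hab, I.d_inj (Finset.mem_Icc.2 (by omega)) hm]
    omega
  · rw [if_neg hab, I.d_inj (Finset.mem_Icc.2 (by omega)) hm]
    omega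

/-- The expected value of the bound on a round with pivot `i`. -/
theorem LPOptimal.levelExp_roundBound (hy : I.LPOptimal y)
    (f : Finset (Fin n) → (Fin n → ℕ) → ℝ) {u : ℕ} (hu1 : 1 ≤ u)
    (hu : u ≤ I.numLevels) (V : Finset (Fin n)) (x t : PairFun n) (i : Fin n) {W : List (Fin n)}
    (hW : W.Nodup) (hWV : ∀ j, j ∈ W ↔ j ∈ V ∧ j ≠ i) :
    levelExp I.numLevels I.d i (fun j => cdf y u s(i, j)) (I.roundBound y f V x u i) W t =
      I.goodCost y x + ∑ p ∈ (V.erase i).offDiag,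
        ((if I.lp y s(p.1, p.2) < 1 / 3 ∧ u ≤ I.level s(p.1, p.2) then I.w s(p.1, p.2) else 0) *
          wrongProb I.numLevels (cdf y u s(i, p.1)) (cdf y u s(i, p.2)) (I.level s(p.1, p.2)) +
        27 * (I.w s(p.1, p.2) * I.lp y s(p.1, p.2) *
          (1 + f (I.remaining y u V i p.1 p.2) fun i' => I.detLevel y s(i', p.1))) *
          (1 - sepProb I.numLevels (cdf y u s(i, p.1)) (cdf y u s(i, p.2)))) := by
  have hcdf : ∀ j ∈ W, IsCdf I.numLevels (cdf y u s(i, j)) := fun j hj =>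
    hy.isCdf hu1 hu (mem_edges ((hWV j).1 hj).2.symm)
  unfold roundBound
  rw [levelExp_add (fun _ => I.goodCost y x), levelExp_sum,
    levelExp_congr_of_notMem (H := fun _ => I.goodCost y x) W hcdf (fun _ _ _ _ => rfl)]
  congr 1
  refine Finset.sum_congr rfl fun p hp => ?_
  simp only [Finset.mem_offDiag, Finset.mem_erase] at hp
  obtain ⟨⟨h1, h1V⟩, ⟨h2, h2V⟩, h12⟩ := hp
  have hp1 : p.1 ∈ W := (hWV _).2 ⟨h1V, h1⟩
  have hp2 : p.2 ∈ W := (hWV _).2 ⟨h2V, h2⟩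
  have hc1 := hcdf _ hp1
  have hc2 := hcdf _ hp2
  rw [levelExp_add, levelExp_mul, levelExp_mul,
    levelExp_pair (fun a b => if fixValue a b (I.x s(p.1, p.2)) ≠ I.x s(p.1, p.2) then 1 else 0)
      h12 W hW hp1 hp2 hcdf,
    levelExp_pair (fun a b => if a = b then 1 else 0) h12 W hW hp1 hp2 hcdf]
  congr 2
  · refine Finset.sum_congr rfl fun a ha => Finset.sum_congr rfl fun b hb => ?_
    congr 1
    exact if_congr (fixValue_d_ne_iff ha hb (mem_edges h12)) rfl rfl
  · rw [eq_sub_iff_add_eq, sepProb, ← Finset.sum_add_distrib]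
    calc _ = ∑ a ∈ Finset.Icc 1 I.numLevels, law I.numLevels (cdf y u s(i, p.1)) a *
          ∑ b ∈ Finset.Icc 1 I.numLevels, law I.numLevels (cdf y u s(i, p.2)) b := by
          refine Finset.sum_congr rfl fun a ha => ?_
          rw [← Finset.sum_add_distrib, Finset.mul_sum]
          refine Finset.sum_congr rfl fun b hb => ?_
          simp only [I.d_inj ha hb]
          by_cases h : a = b <;> simp [h]
      _ = 1 := by rw [hc2.sum_law, ← Finset.sum_mul, hc1.sum_law, one_mul]

/-- On average over the pivots, the cost after a round and the remaining budget are at most the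
cost and the budget before. -/
theorem LPOptimal.sum_levelExp_roundBound (hy : I.LPOptimal y)
    {f : Finset (Fin n) → (Fin n → ℕ) → ℝ} (hf : IsPotential f) {u : ℕ} (hu1 : 1 ≤ u)
    (hu : u ≤ I.numLevels) {V : Finset (Fin n)} (hV : V.Nonempty) (x : PairFun n) :
    (∑ i ∈ V, (I.goodCost y x + ∑ p ∈ (V.erase i).offDiag,
        ((if I.lp y s(p.1, p.2) < 1 / 3 ∧ u ≤ I.level s(p.1, p.2) then I.w s(p.1, p.2) else 0) *
          wrongProb I.numLevels (cdf y u s(i, p.1)) (cdf y u s(i, p.2)) (I.level s(p.1, p.2)) +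
        27 * (I.w s(p.1, p.2) * I.lp y s(p.1, p.2) *
          (1 + f (I.remaining y u V i p.1 p.2) fun i' => I.detLevel y s(i', p.1))) *
          (1 - sepProb I.numLevels (cdf y u s(i, p.1)) (cdf y u s(i, p.2)))))) / V.card ≤
      I.goodCost y x + I.budget y f V u := by
  have hcard : (0 : ℝ) < V.card := by exact_mod_cast hV.card_pos
  rw [div_le_iff₀ hcard, Finset.sum_add_distrib, Finset.sum_const, nsmul_eq_mul, add_mul,
    mul_comm (I.goodCost y x)]
  refine add_le_add le_rfl ?_
  rw [← tripleSum_eq V fun i j k =>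
    (if I.lp y s(j, k) < 1 / 3 ∧ u ≤ I.level s(j, k) then I.w s(j, k) else 0) *
      wrongProb I.numLevels (cdf y u s(i, j)) (cdf y u s(i, k)) (I.level s(j, k)) +
    27 * (I.w s(j, k) * I.lp y s(j, k) *
      (1 + f (I.remaining y u V i j k) fun i' => I.detLevel y s(i', j))) *
      (1 - sepProb I.numLevels (cdf y u s(i, j)) (cdf y u s(i, k)))]
  set B : Fin n → Fin n → Fin n → ℝ := fun i j k => I.w s(j, k) * freed I y u V i j k with hB
  calc _ ≤ tripleSum V fun i j k => 9 * (B i j k + B k i j + B j i k) +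
        27 * (I.w s(j, k) * I.lp y s(j, k) *
          (1 + f (I.remaining y u V i j k) fun i' => I.detLevel y s(i', j))) *
          (1 - sepProb I.numLevels (cdf y u s(i, j)) (cdf y u s(i, k))) :=
        tripleSum_mono fun i _ j hj k hk hij hik hjk => add_le_add
          (hy.weighted_wrongProb_le hu1 hu hj hk hij hik hjk) le_rfl
    _ = tripleSum V fun i j k => 27 * (I.w s(j, k) * I.lp y s(j, k) *
          (sepProb I.numLevels (cdf y u s(i, j)) (cdf y u s(i, k)) +
          (if i ∈ I.eligible y u V j k then 1 else 0) +
          (1 + f (I.remaining y u V i j k) fun i' => I.detLevel y s(i', j)) *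
          (1 - sepProb I.numLevels (cdf y u s(i, j)) (cdf y u s(i, k))))) := by
        -- After rotation the three payments of each triangle coincide, so 9 becomes 27, the factor
        -- in `budget`.
        rw [tripleSum_add, tripleSum_mul, tripleSum_add, tripleSum_add, tripleSum_rotate B,
          tripleSum_swap B, show 9 * (tripleSum V B + tripleSum V B + tripleSum V B) =
          27 * tripleSum V B by ring, ← tripleSum_mul, ← tripleSum_add]
        congr 1
        funext i j k
        rw [hB]
        unfold freed
        ring
    _ ≤ I.budget y f V u * V.card := by
        rw [tripleSum_mul, tripleSum_eq', budget, mul_assoc, Finset.sum_mul]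
        refine mul_le_mul_of_nonneg_left (Finset.sum_le_sum fun p hp => ?_) (by norm_num)
        have hp12 := mem_edges (Finset.mem_offDiag.1 hp).2.2
        have := mul_le_mul_of_nonneg_left (hy.edge_budget hf hu1 hu V (j := p.1) (k := p.2))
          (mul_nonneg (I.w_nonneg' hp12) (hy.lp_nonneg hp12))
        rw [Finset.mul_sum] at this
        calc _ = _ := Finset.sum_congr rfl fun i _ => by rw [mul_ite, mul_zero]
          _ ≤ _ := this
          _ = _ := by ring

/-- No level below `u` is ever drawn, so the bound of a recursive call is never below that of its
parent. -/
theorem law_cdf_eq_zero {u a : ℕ} (h : a < u) (e : Sym2 (Fin n)) :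
    law I.numLevels (cdf y u e) a = 0 := by
  rw [law, incr_cdf_of_gt h]
  norm_num

theorem LPOptimal.roundBound_nonneg (hy : I.LPOptimal y) {f : Finset (Fin n) → (Fin n → ℕ) → ℝ}
    (hf : IsPotential f) (V : Finset (Fin n)) (x : PairFun n) (u : ℕ) (i : Fin n)
    (x' : PairFun n) : 0 ≤ I.roundBound y f V x u i x' := by
  refine add_nonneg (Finset.sum_nonneg fun p hp => ?_) (Finset.sum_nonneg fun p hp => ?_)
  · have := I.w_nonneg' (mem_edges (Finset.mem_offDiag.1 hp).2.2)
    split_ifs <;> first | assumption | exact le_rfl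
  · have h12 := mem_edges (Finset.mem_offDiag.1 hp).2.2
    have h1 := I.w_nonneg' h12
    have h2 := hy.lp_nonneg h12
    have h3 := hf.nonneg (I.remaining y u V i p.1 p.2) fun i' => I.detLevel y s(i', p.1)
    refine add_nonneg (mul_nonneg ?_ ?_) (mul_nonneg (by positivity) ?_)
    all_goals split_ifs <;> first | assumption | norm_num

/-! ### The tables before and after a round. -/

section Round

variable {V W : Finset (Fin n)} {u : ℕ} {i : Fin n} {x x' z : PairFun n}

/-- The good cost after a round. -/
theorem LPOptimal.goodCost_le (hy : I.LPOptimal y) (hu1 : 1 ≤ u) (hu : u ≤ I.numLevels)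
    (hW : W = V.erase i) (hi : i ∈ V)
    (hx : ∀ a ∈ V, ∀ b ∈ V, a ≠ b → x s(a, b) = min (I.x s(a, b)) (I.d u))
    (hx' : ∀ j ∈ W, ∃ a ∈ Finset.Icc 1 I.numLevels,
      0 < law I.numLevels (cdf y u s(i, j)) a ∧ x' s(i, j) = I.d a)
    (hx'x : ∀ e, (∀ j ∈ W, e ≠ s(i, j)) → x' e = x e)
    (hz : ∀ a ∈ W, ∀ b ∈ W, a ≠ b → z s(a, b) =
      fixValue (x' s(i, a)) (x' s(i, b)) (x' s(a, b)))
    (hzx' : ∀ e, (∀ a ∈ W, ∀ b ∈ W, a ≠ b → e ≠ s(a, b)) → z e = x' e) :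
    I.goodCost y z ≤ I.goodCost y x + ∑ p ∈ W.offDiag,
      (if I.lp y s(p.1, p.2) < 1 / 3 ∧ u ≤ I.level s(p.1, p.2) then I.w s(p.1, p.2) else 0) *
      (if fixValue (x' s(i, p.1)) (x' s(i, p.2)) (I.x s(p.1, p.2)) ≠ I.x s(p.1, p.2)
        then 1 else 0) := by
  have hiW : i ∉ W := by simp [hW]
  have hWV : ∀ j ∈ W, j ∈ V := fun j hj => by
    rw [hW] at hj
    exact Finset.mem_of_mem_erase hj
  have huI : u ∈ Finset.Icc 1 I.numLevels := Finset.mem_Icc.2 ⟨hu1, hu⟩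
  -- Input distances above d_u were capped at d_u by earlier rounds; such edges are already counted
  -- in the cost of `x`.
  have hlost : ∀ a ∈ V, ∀ b ∈ V, a ≠ b → I.level s(a, b) < u → x s(a, b) ≠ I.x s(a, b) := by
    intro a ha b hb hab hl
    rw [hx a ha b hb hab, ← I.d_level (mem_edges hab), I.min_d (I.level_mem (mem_edges hab)) huI,
      max_eq_right hl.le, Ne, I.d_inj huI (I.level_mem (mem_edges hab))]
    omega
  have hkeep : ∀ a ∈ V, ∀ b ∈ V, a ≠ b → u ≤ I.level s(a, b) → x s(a, b) = I.x s(a, b) := by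
    intro a ha b hb hab hl
    rw [hx a ha b hb hab, ← I.d_level (mem_edges hab), I.min_d (I.level_mem (mem_edges hab)) huI,
      max_eq_left hl]
  -- A good pivot edge of level at least `u` is concentrated there and gets its input distance with
  -- certainty, so pivot edges cause no new cost.
  have hpivot : ∀ j ∈ W, I.lp y s(i, j) < 1 / 3 → z s(i, j) ≠ I.x s(i, j) →
      x s(i, j) ≠ I.x s(i, j) := by
    intro j hj hg hne
    have hij : i ≠ j := fun h => hiW (h ▸ hj)
    refine hlost i hi j (hWV j hj) hij (not_le.1 fun hl => hne ?_)
    have hz' : z s(i, j) = x' s(i, j) := by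
      refine hzx' _ fun a ha b hb _ h => ?_
      rw [Sym2.eq_iff] at h
      rcases h with ⟨rfl, -⟩ | ⟨rfl, -⟩
      exacts [hiW ha, hiW hb]
    obtain ⟨a, ha, hpos, h⟩ := hx' j hj
    have hc := hy.concentrated_of_lp_lt hu (mem_edges hij) hg hl
    rw [(hy.isCdf hu1 hu (mem_edges hij)).law_eq (I.level_mem (mem_edges hij)) hc ha] at hpos
    have : a = I.level s(i, j) := by
      by_contra hne
      simp [hne] at hpos
    rw [hz', h, this, I.d_level (mem_edges hij)]
  have hsub : W.offDiag ⊆ (Finset.univ : Finset (Fin n)).offDiag := by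
    intro p hp
    rw [Finset.mem_offDiag] at hp ⊢
    exact ⟨Finset.mem_univ _, Finset.mem_univ _, hp.2.2⟩
  unfold goodCost
  rw [← Finset.sum_sdiff hsub, ← Finset.sum_sdiff hsub, add_assoc, ← Finset.sum_add_distrib]
  refine add_le_add (Finset.sum_le_sum ?_) (Finset.sum_le_sum ?_)
  · rintro ⟨a, b⟩ hp
    rw [Finset.mem_sdiff, Finset.mem_offDiag, Finset.mem_offDiag] at hp
    obtain ⟨⟨-, -, hab⟩, hnW⟩ := hp
    dsimp only at hab hnW ⊢
    have hw := I.w_nonneg a b hab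
    by_cases h : I.lp y s(a, b) < 1 / 3 ∧ z s(a, b) ≠ I.x s(a, b)
    · have hne : x s(a, b) ≠ I.x s(a, b) := by
        by_cases hpa : a = i ∧ b ∈ W
        · obtain ⟨rfl, hb⟩ := hpa
          exact hpivot b hb h.1 h.2
        · by_cases hpb : b = i ∧ a ∈ W
          · obtain ⟨rfl, ha⟩ := hpb
            rw [Sym2.eq_swap] at h ⊢
            exact hpivot a ha h.1 h.2
          · have h1 : z s(a, b) = x' s(a, b) := by
              refine hzx' _ fun c hc e he _ hce => hnW ?_
              rcases Sym2.eq_iff.1 hce with ⟨rfl, rfl⟩ | ⟨rfl, rfl⟩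
              exacts [⟨hc, he, hab⟩, ⟨he, hc, hab⟩]
            have h2 : x' s(a, b) = x s(a, b) := by
              refine hx'x _ fun c hc hce => ?_
              rcases Sym2.eq_iff.1 hce with ⟨rfl, rfl⟩ | ⟨rfl, rfl⟩
              exacts [hpa ⟨rfl, hc⟩, hpb ⟨rfl, hc⟩]
            rw [← h2, ← h1]
            exact h.2
      rw [if_pos h, if_pos ⟨h.1, hne⟩]
    · rw [if_neg h]
      split_ifs <;> first | assumption | exact le_rfl
  · rintro ⟨a, b⟩ hp
    obtain ⟨ha, hb, hab⟩ := Finset.mem_offDiag.1 hp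
    dsimp only at ha hb hab ⊢
    have hw := I.w_nonneg a b hab
    have hnn : 0 ≤ (if I.lp y s(a, b) < 1 / 3 ∧ u ≤ I.level s(a, b) then I.w s(a, b) else 0) *
        (if fixValue (x' s(i, a)) (x' s(i, b)) (I.x s(a, b)) ≠ I.x s(a, b)
          then 1 else 0) := by
      refine mul_nonneg ?_ ?_ <;> split_ifs <;> first | assumption | norm_num
    by_cases h : I.lp y s(a, b) < 1 / 3 ∧ z s(a, b) ≠ I.x s(a, b)
    · rw [if_pos h]
      rcases lt_or_ge (I.level s(a, b)) u with hl | hl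
      · rw [if_pos ⟨h.1, hlost a (hWV a ha) b (hWV b hb) hab hl⟩]
        exact le_add_of_nonneg_right hnn
      · have hxx : x' s(a, b) = I.x s(a, b) := by
          rw [hx'x, hkeep a (hWV a ha) b (hWV b hb) hab hl]
          intro c _ hce
          rcases Sym2.eq_iff.1 hce with ⟨rfl, -⟩ | ⟨-, rfl⟩
          exacts [hiW ha, hiW hb]
        have hfix := h.2
        rw [hz a ha b hb hab, hxx] at hfix
        rw [if_pos (And.intro h.1 hl), if_pos hfix, mul_one]
        refine le_add_of_nonneg_left ?_
        split_ifs <;> first | assumption | exact le_rfl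
    · rw [if_neg h]
      refine add_nonneg ?_ hnn
      split_ifs <;> first | assumption | exact le_rfl

/-- The budget of the recursive calls. -/
theorem LPOptimal.sum_budget_le (hy : I.LPOptimal y) {f : Finset (Fin n) → (Fin n → ℕ) → ℝ}
    (hf : IsPotential f) (hu1 : 1 ≤ u) (hu : u ≤ I.numLevels) (hW : W = V.erase i)
    (hx' : ∀ j ∈ W, ∃ a ∈ Finset.Icc 1 I.numLevels,
      0 < law I.numLevels (cdf y u s(i, j)) a ∧ x' s(i, j) = I.d a) :
    ∑ ℓ ∈ Finset.Icc u I.numLevels, I.budget y f (W.filter fun j => x' s(i, j) = I.d ℓ) ℓ ≤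
      ∑ p ∈ W.offDiag, 27 * (I.w s(p.1, p.2) * I.lp y s(p.1, p.2) *
        (1 + f (I.remaining y u V i p.1 p.2) fun i' => I.detLevel y s(i', p.1))) *
        if x' s(i, p.1) = x' s(i, p.2) then 1 else 0 := by
  have hiW : i ∉ W := by simp [hW]
  have hWV : ∀ j ∈ W, j ∈ V := fun j hj => by
    rw [hW] at hj
    exact Finset.mem_of_mem_erase hj
  set c : ℕ → Fin n × Fin n → ℝ := fun ℓ p => 27 * (I.w s(p.1, p.2) * I.lp y s(p.1, p.2) *
    (1 + f (I.eligible y ℓ (W.filter fun j => x' s(i, j) = I.d ℓ) p.1 p.2)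
      fun i' => I.detLevel y s(i', p.1))) with hc
  have hbud : ∀ ℓ, I.budget y f (W.filter fun j => x' s(i, j) = I.d ℓ) ℓ =
      ∑ p ∈ W.offDiag, if x' s(i, p.1) = I.d ℓ ∧ x' s(i, p.2) = I.d ℓ then c ℓ p else 0 := by
    intro ℓ
    rw [budget, Finset.mul_sum, ← Finset.sum_filter]
    refine Finset.sum_congr ?_ fun p _ => rfl
    ext p
    simp only [Finset.mem_offDiag, Finset.mem_filter]
    tauto
  simp_rw [hbud]
  -- A pair counts only in the class that contains both endpoints, so for each pair at most one
  -- level survives.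
  rw [Finset.sum_comm]
  refine Finset.sum_le_sum ?_
  rintro ⟨j, k⟩ hp
  obtain ⟨hj, hk, hjk⟩ := Finset.mem_offDiag.1 hp
  dsimp only at hj hk hjk ⊢
  have hw := I.w_nonneg j k hjk
  have hlp := hy.lp_nonneg (mem_edges hjk)
  have hij : i ≠ j := fun h => hiW (h ▸ hj)
  by_cases hsame : x' s(i, j) = x' s(i, k)
  · rw [if_pos hsame, mul_one]
    obtain ⟨a, ha, hpos, hja⟩ := hx' j hj
    have hua : u ≤ a := by
      by_contra h
      rw [law_cdf_eq_zero (not_le.1 h)] at hpos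
      exact lt_irrefl _ hpos
    rw [Finset.sum_eq_single_of_mem a (Finset.mem_Icc.2 ⟨hua, (Finset.mem_Icc.1 ha).2⟩),
      if_pos ⟨hja, hsame ▸ hja⟩]
    · refine mul_le_mul_of_nonneg_left (mul_le_mul_of_nonneg_left (add_le_add le_rfl ?_)
        (mul_nonneg hw hlp)) (by norm_num)
      refine hf.mono _ _ _ fun i' hi' => ?_
      rw [eligible, Finset.mem_filter, Finset.mem_filter] at hi'
      obtain ⟨⟨h1, -⟩, h2, h3, h4, h5⟩ := hi'
      dsimp only at h2 h3 h4 h5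
      have hE : i' ∈ I.eligible y u V j k := by
        rw [eligible, Finset.mem_filter]
        exact ⟨hWV _ h1, h2, h3, h4, by omega⟩
      unfold remaining
      split_ifs with hiE
      -- If `i` is eligible, its deterministic level is the class level `a`, and eligibility in the
      -- child call asks for a level above `a`.
      · refine Finset.mem_filter.2 ⟨hE, ?_⟩
        have hdet : u < I.detLevel y s(i, j) := ((Finset.mem_filter.1 hiE).2).2.2.2
        obtain ⟨hd1, hd2⟩ := detLevel_spec (I := I) (y := y) (e := s(i, j)) (by omega)
        rw [← incr_cdf_of_lt hdet] at hd2
        rw [(hy.isCdf hu1 hu (mem_edges hij)).law_eq hd1 hd2 ha] at hpos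
        have : a = I.detLevel y s(i, j) := by
          by_contra hne
          simp [hne] at hpos
        omega
      · exact hE
    · intro b hb hba
      rw [if_neg]
      rintro ⟨h, -⟩
      rw [hja, I.d_inj ha] at h
      · exact hba h.symm
      · rw [Finset.mem_Icc] at hb ⊢
        omega
  · rw [if_neg hsame, mul_zero]
    refine (Finset.sum_eq_zero fun ℓ _ => if_neg ?_).le
    rintro ⟨h1, h2⟩
    exact hsame (h1.trans h2.symm)

end Round

end Instance

/-! ## The recursion -/

/-- The table `z` differs from `x` only on the pairs in `V`, where it is an ultrametric whose values
are input distances of level at least `u`. -/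
structure FitsOn (I : Instance n) (V : List (Fin n)) (u : ℕ) (x z : PairFun n) : Prop where
  eq_of_notMem : ∀ e, (∀ a ∈ V, ∀ b ∈ V, a ≠ b → e ≠ s(a, b)) → z e = x e
  value : ∀ a ∈ V, ∀ b ∈ V, a ≠ b → ∃ ℓ, u ≤ ℓ ∧ ℓ ≤ I.numLevels ∧ z s(a, b) = I.d ℓ
  ultra : ∀ a ∈ V, ∀ b ∈ V, ∀ k ∈ V, a ≠ b → b ≠ k → a ≠ k →
    z s(a, k) ≤ max (z s(a, b)) (z s(b, k))

/-- The specification of the calls of the algorithm with recursion depth at most `depth`. -/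
def PivotSpec (I : Instance n) (y : ℕ → PairFun n) (f : Finset (Fin n) → (Fin n → ℕ) → ℝ) (B : ℕ)
    (depth : ℕ) : Prop :=
  ∀ (V : List (Fin n)) (x : PairFun n) (u : ℕ), V.Nodup → V.length ≤ depth → 1 ≤ u →
    u ≤ I.numLevels →
    (∀ a ∈ V, ∀ b ∈ V, a ≠ b → x s(a, b) = min (I.x s(a, b)) (I.d u)) →
    Triple (pivot (1 / 3) 0 I.numLevels I.d (fun q => y q.1 q.2) depth V x u) (1 + B * V.length)
      (FitsOn I V u x) (I.goodCost y) (I.goodCost y x + I.budget y f V.toFinset u)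

/-- The state of the loop through the recursive calls: the classes `{a | c a = ℓ}` with `ℓ` not in
the list are finished, and nothing else has been changed. -/
structure ClassesDone (I : Instance n) (W : List (Fin n)) (c : Fin n → ℕ) (z₀ : PairFun n)
    (l : List ℕ) (z : PairFun n) : Prop where
  eq_of_notMem : ∀ e, (∀ a ∈ W, ∀ b ∈ W, a ≠ b → c a = c b → c a ∉ l → e ≠ s(a, b)) → z e = z₀ e
  value : ∀ a ∈ W, ∀ b ∈ W, a ≠ b → c a = c b → c a ∉ l →
    ∃ ℓ, c a ≤ ℓ ∧ ℓ ≤ I.numLevels ∧ z s(a, b) = I.d ℓ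
  ultra : ∀ a ∈ W, ∀ b ∈ W, ∀ k ∈ W, a ≠ b → b ≠ k → a ≠ k → c a = c b → c b = c k → c a ∉ l →
    z s(a, k) ≤ max (z s(a, b)) (z s(b, k))

namespace Instance

variable {I : Instance n} {y : ℕ → PairFun n}

theorem goodCost_nonneg (I : Instance n) (z : PairFun n) : 0 ≤ I.goodCost y z := by
  refine Finset.sum_nonneg fun p hp => ?_
  have := I.w_nonneg' (mem_edges (Finset.mem_offDiag.1 hp).2.2)
  split_ifs <;> first | assumption | exact le_rfl

theorem LPOptimal.budget_nonneg (hy : I.LPOptimal y) {f : Finset (Fin n) → (Fin n → ℕ) → ℝ}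
    (hf : IsPotential f) (V : Finset (Fin n)) (u : ℕ) : 0 ≤ I.budget y f V u := by
  refine mul_nonneg (by norm_num) (Finset.sum_nonneg fun p hp => ?_)
  have h12 := mem_edges (Finset.mem_offDiag.1 hp).2.2
  have h1 := I.w_nonneg' h12
  have h2 := hy.lp_nonneg h12
  have h3 := hf.nonneg (I.eligible y u V p.1 p.2) fun i' => I.detLevel y s(i', p.1)
  positivity

end Instance

theorem toFinset_range' (u L : ℕ) : (List.range' u (L + 1 - u)).toFinset = Finset.Icc u L := by
  ext ℓ
  simp only [List.mem_toFinset, List.mem_range'_1, Finset.mem_Icc]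
  omega

theorem sum_map_range' {M : Type} [AddCommMonoid M] (u L : ℕ) (g : ℕ → M) :
    ((List.range' u (L + 1 - u)).map g).sum = ∑ ℓ ∈ Finset.Icc u L, g ℓ := by
  rw [← toFinset_range', List.sum_toFinset _ (List.nodup_range' ..)]

/-- Classes are disjoint, so a finished call leaves the cells of the other classes unchanged. The
loop potential is the current good cost plus the budgets of the classes still to come. -/
theorem triple_children {I : Instance n} {y : ℕ → PairFun n} (hy : I.LPOptimal y)
    {f : Finset (Fin n) → (Fin n → ℕ) → ℝ} (hf : IsPotential f) {B depth : ℕ}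
    (hrec : PivotSpec I y f B depth) {W : List (Fin n)} (hW : W.Nodup) (hlen : W.length ≤ depth)
    {i : Fin n} (hi : i ∉ W) {u : ℕ} (hu1 : 1 ≤ u) {c : Fin n → ℕ}
    (hc : ∀ j ∈ W, u ≤ c j ∧ c j ≤ I.numLevels) {z₀ : PairFun n}
    (hz₀i : ∀ j ∈ W, z₀ s(i, j) = I.d (c j))
    (hz₀ : ∀ a ∈ W, ∀ b ∈ W, a ≠ b → c a = c b → z₀ s(a, b) = min (I.x s(a, b)) (I.d (c a))) :
    Triple (forEach (List.range' u (I.numLevels + 1 - u)) z₀ fun x' ℓ => do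
        let Vℓ ← part I.d i x' W ℓ
        pivot (1 / 3) 0 I.numLevels I.d (fun q => y q.1 q.2) depth Vℓ x' ℓ)
      ((I.numLevels + 1 - u) * (W.length * 5 + 2) + B * W.length) (ClassesDone I W c z₀ [])
      (I.goodCost y) (I.goodCost y z₀ +
        ∑ ℓ ∈ Finset.Icc u I.numLevels, I.budget y f (W.toFinset.filter fun j => c j = ℓ) ℓ) := by
  have huI : ∀ {ℓ}, u ≤ ℓ → ℓ ≤ I.numLevels → ℓ ∈ Finset.Icc 1 I.numLevels := fun h1 h2 =>
    Finset.mem_Icc.2 ⟨by omega, h2⟩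
  refine ((triple_forEach
    (T := fun ℓ => W.length * 5 + (1 + B * (W.toFinset.filter fun j => c j = ℓ).card))
    (fun l z => l.Nodup ∧ (∀ ℓ ∈ l, u ≤ ℓ ∧ ℓ ≤ I.numLevels) ∧ ClassesDone I W c z₀ l z)
    (fun l z => I.goodCost y z + (l.map fun ℓ =>
      I.budget y f (W.toFinset.filter fun j => c j = ℓ) ℓ).sum) ?_ _ z₀ ?_).mono_right ?_).mono ?_ ?_ ?_
  · rintro ℓ l z ⟨hnd, hl, hz⟩
    obtain ⟨hℓu, hℓL⟩ := hl ℓ (by simp)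
    have hzi : ∀ j ∈ W, z s(i, j) = I.d (c j) := by
      intro j hj
      rw [hz.eq_of_notMem, hz₀i j hj]
      intro a ha b hb _ _ _ h
      rcases Sym2.eq_iff.1 h with ⟨rfl, -⟩ | ⟨rfl, -⟩
      exacts [hi ha, hi hb]
    refine (det_part I.d i z W ℓ hW).bind_triple ?_
    rintro A ⟨hA, hmem⟩
    have hmem' : ∀ j, j ∈ A ↔ j ∈ W ∧ c j = ℓ := by
      intro j
      rw [hmem]
      refine and_congr_right fun hj => ?_
      rw [hzi j hj, I.d_inj (huI (hc j hj).1 (hc j hj).2) (huI hℓu hℓL)]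
    have hAf : A.toFinset = W.toFinset.filter fun j => c j = ℓ := by
      ext j
      simp [hmem']
    have hAlen : A.length = (W.toFinset.filter fun j => c j = ℓ).card := by
      rw [← hAf, List.toFinset_card_of_nodup hA]
    have hAW : A.length ≤ W.length := by
      rw [hAlen, ← List.toFinset_card_of_nodup hW]
      exact Finset.card_filter_le _ _
    -- Class `ℓ` is still in the list, so its cells hold the values from the start of the loop.
    have hzA : ∀ a ∈ A, ∀ b ∈ A, a ≠ b → z s(a, b) = min (I.x s(a, b)) (I.d ℓ) := by
      intro a ha b hb hab
      rw [hmem'] at ha hb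
      rw [hz.eq_of_notMem, hz₀ a ha.1 b hb.1 hab (ha.2.trans hb.2.symm), ha.2]
      intro a' _ b' _ _ _ hnl h
      have : c a' = ℓ := by
        rcases Sym2.eq_iff.1 h with ⟨rfl, -⟩ | ⟨-, rfl⟩
        exacts [ha.2, hb.2]
      exact hnl (by simp [this])
    have hspec := hrec A z ℓ hA (hAW.trans hlen) (by omega) hℓL hzA
    rw [hAlen, hAf] at hspec
    have hrest : 0 ≤ (l.map fun ℓ => I.budget y f (W.toFinset.filter fun j => c j = ℓ) ℓ).sum := by
      refine List.sum_nonneg fun t ht => ?_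
      obtain ⟨ℓ', -, rfl⟩ := List.mem_map.1 ht
      exact hy.budget_nonneg hf _ _
    refine (hspec.add_const (add_nonneg (I.goodCost_nonneg z) (hy.budget_nonneg hf _ _))
      hrest).mono le_rfl ?_ ?_
    · intro z' hr1
      refine ⟨(List.nodup_cons.1 hnd).2, fun ℓ' hℓ' => hl ℓ' (by simp [hℓ']), ?_⟩
      have hold : ∀ e, (∀ a ∈ W, ∀ b ∈ W, a ≠ b → c a = c b → c a = ℓ → e ≠ s(a, b)) →
          z' e = z e := by
        intro e he
        refine hr1.eq_of_notMem e fun a ha b hb hab => ?_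
        rw [hmem'] at ha hb
        exact he a ha.1 b hb.1 hab (ha.2.trans hb.2.symm) ha.2
      have hold' : ∀ a ∈ W, ∀ b, c a ≠ ℓ → z' s(a, b) = z s(a, b) := by
        intro a ha b hne
        refine hold _ fun a' _ b' _ _ hcc hcl h => hne ?_
        rcases Sym2.eq_iff.1 h with ⟨rfl, -⟩ | ⟨rfl, -⟩
        exacts [hcl, hcc ▸ hcl]
      refine ⟨fun e he => ?_, fun a ha b hb hab hcc hcl => ?_,
        fun a ha b hb k hk hab hbk hak hcab hcbk hcl => ?_⟩
      · rw [hold e fun a ha b hb hab hcc hcl => he a ha b hb hab hcc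
          (hcl ▸ (List.nodup_cons.1 hnd).1)]
        refine hz.eq_of_notMem e fun a ha b hb hab hcc hcl => he a ha b hb hab hcc fun h => ?_
        exact hcl (List.mem_cons_of_mem _ h)
      · by_cases h : c a = ℓ
        · rw [h]
          exact hr1.value a ((hmem' a).2 ⟨ha, h⟩) b ((hmem' b).2 ⟨hb, hcc ▸ h⟩) hab
        · rw [hold' a ha b h]
          exact hz.value a ha b hb hab hcc (by simp [h, hcl])
      · by_cases h : c a = ℓ
        · exact hr1.ultra a ((hmem' a).2 ⟨ha, h⟩) b ((hmem' b).2 ⟨hb, hcab ▸ h⟩) k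
            ((hmem' k).2 ⟨hk, hcbk ▸ hcab ▸ h⟩) hab hbk hak
        · rw [hold' a ha k h, hold' a ha b h, hold' b hb k (hcab ▸ h)]
          exact hz.ultra a ha b hb k hk hab hbk hak hcab hcbk (by simp [h, hcl])
    · rw [List.map_cons, List.sum_cons, add_assoc]
  · refine ⟨List.nodup_range' .., fun ℓ hℓ => ?_, fun e _ => rfl, fun a ha b hb _ _ h => ?_,
      fun a ha b hb k hk _ _ _ _ _ h => ?_⟩
    · rw [List.mem_range'_1] at hℓ
      omega
    all_goals
      refine absurd ?_ h
      have := hc a ha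
      rw [List.mem_range'_1]
      omega
  · intro z
    simp
  · rw [sum_map_range']
    have hcard : ∑ ℓ ∈ Finset.Icc u I.numLevels, (W.toFinset.filter fun j => c j = ℓ).card =
        W.length := by
      rw [← List.toFinset_card_of_nodup hW]
      refine (Finset.card_eq_sum_card_fiberwise fun j hj => ?_).symm
      have := hc j (by simpa using hj)
      simpa using this
    rw [Finset.sum_congr rfl fun ℓ _ => show W.length * 5 +
      (1 + B * (W.toFinset.filter fun j => c j = ℓ).card) + 1 =
      (W.length * 5 + 2) + B * (W.toFinset.filter fun j => c j = ℓ).card by ring,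
      Finset.sum_add_distrib, ← Finset.mul_sum, hcard]
    simp
  · exact fun z hz => hz.2.2
  · rw [sum_map_range']

/-- Within a class all distances are at most the distance d_{c a} to the pivot, because a recursive
call assigns only levels at least its bound. Between classes the distance is the larger of the two
pivot distances. Every triangle is then isosceles with a short base, or lies in one class and is
settled by the recursive call. -/
theorem ClassesDone.fitsOn {I : Instance n} {V W : List (Fin n)} {i : Fin n} {u : ℕ} (hu1 : 1 ≤ u)
    {c : Fin n → ℕ} {x x' z₀ z : PairFun n} (hi : i ∈ V) (hWV : ∀ j, j ∈ W ↔ j ∈ V ∧ j ≠ i)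
    (hc : ∀ j ∈ W, u ≤ c j ∧ c j ≤ I.numLevels)
    (hx' : ∀ j ∈ W, x' s(i, j) = I.d (c j))
    (hx'x : ∀ e, (∀ j ∈ W, e ≠ s(i, j)) → x' e = x e)
    (hz₀ : ∀ a ∈ W, ∀ b ∈ W, a ≠ b → z₀ s(a, b) =
      fixValue (x' s(i, a)) (x' s(i, b)) (x' s(a, b)))
    (hz₀x' : ∀ e, (∀ a ∈ W, ∀ b ∈ W, a ≠ b → e ≠ s(a, b)) → z₀ e = x' e)
    (hz : ClassesDone I W c z₀ [] z) : FitsOn I V u x z := by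
  have hiW : i ∉ W := fun h => ((hWV i).1 h).2 rfl
  have hcI : ∀ j ∈ W, c j ∈ Finset.Icc 1 I.numLevels := fun j hj =>
    Finset.mem_Icc.2 ⟨hu1.trans (hc j hj).1, (hc j hj).2⟩
  have hW : ∀ j ∈ V, j ≠ i → j ∈ W := fun j hj hji => (hWV j).2 ⟨hj, hji⟩
  have hzi : ∀ j ∈ W, z s(i, j) = I.d (c j) := by
    intro j hj
    have hne : ∀ a ∈ W, ∀ b ∈ W, s(i, j) ≠ s(a, b) := by
      intro a ha b hb h
      rcases Sym2.eq_iff.1 h with ⟨rfl, -⟩ | ⟨rfl, -⟩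
      exacts [hiW ha, hiW hb]
    rw [hz.eq_of_notMem _ fun a ha b hb _ _ _ => hne a ha b hb,
      hz₀x' _ fun a ha b hb _ => hne a ha b hb, hx' j hj]
  have hzi' : ∀ j ∈ W, z s(j, i) = I.d (c j) := fun j hj => by rw [Sym2.eq_swap, hzi j hj]
  have hdiff : ∀ a ∈ W, ∀ b ∈ W, c a ≠ c b → z s(a, b) = max (I.d (c a)) (I.d (c b)) := by
    intro a ha b hb hab
    have hab' : a ≠ b := fun h => hab (h ▸ rfl)
    rw [hz.eq_of_notMem, hz₀ a ha b hb hab', hx' a ha, hx' b hb, fixValue, if_neg]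
    · rwa [I.d_inj (hcI a ha) (hcI b hb)]
    · intro a' _ b' _ _ hcc _ h
      rcases Sym2.eq_iff.1 h with ⟨rfl, rfl⟩ | ⟨rfl, rfl⟩
      exacts [hab hcc, hab hcc.symm]
  have hsame : ∀ a ∈ W, ∀ b ∈ W, a ≠ b → c a = c b → z s(a, b) ≤ I.d (c a) := by
    intro a ha b hb hab hcc
    obtain ⟨ℓ, h1, h2, h3⟩ := hz.value a ha b hb hab hcc (by simp)
    rw [h3, I.d_le_iff _ (hcI a ha)]
    · exact h1
    · have := hcI a ha
      rw [Finset.mem_Icc] at this ⊢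
      omega
  have hle : ∀ a ∈ W, ∀ b ∈ W, a ≠ b → z s(a, b) ≤ max (I.d (c a)) (I.d (c b)) := by
    intro a ha b hb hab
    by_cases h : c a = c b
    · exact (hsame a ha b hb hab h).trans (le_max_left _ _)
    · exact (hdiff a ha b hb h).le
  refine ⟨fun e he => ?_, fun a ha b hb hab => ?_, fun a ha b hb k hk hab hbk hak => ?_⟩
  · have hWne : ∀ a ∈ W, ∀ b ∈ W, a ≠ b → e ≠ s(a, b) := fun a ha b hb =>
      he a ((hWV a).1 ha).1 b ((hWV b).1 hb).1
    rw [hz.eq_of_notMem e fun a ha b hb hab _ _ => hWne a ha b hb hab, hz₀x' e hWne, hx'x e]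
    intro j hj
    exact he i hi j ((hWV j).1 hj).1 ((hWV j).1 hj).2.symm
  · by_cases hai : a = i
    · subst hai
      have hbW := hW b hb hab.symm
      exact ⟨c b, (hc b hbW).1, (hc b hbW).2, hzi b hbW⟩
    · have haW := hW a ha hai
      by_cases hbi : b = i
      · subst hbi
        exact ⟨c a, (hc a haW).1, (hc a haW).2, hzi' a haW⟩
      · have hbW := hW b hb hbi
        by_cases hcc : c a = c b
        · obtain ⟨ℓ, h1, h2, h3⟩ := hz.value a haW b hbW hab hcc (by simp)
          exact ⟨ℓ, (hc a haW).1.trans h1, h2, h3⟩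
        · have h1 := hc a haW
          have h2 := hc b hbW
          refine ⟨min (c a) (c b), by omega, by omega, ?_⟩
          rw [hdiff a haW b hbW hcc, I.max_d (hcI a haW) (hcI b hbW)]
  · by_cases hai : a = i
    · subst hai
      have hbW := hW b hb hab.symm
      have hkW := hW k hk hak.symm
      rw [hzi k hkW, hzi b hbW]
      by_cases hcc : c b = c k
      · rw [hcc]
        exact le_max_left _ _
      · rw [hdiff b hbW k hkW hcc]
        exact le_max_of_le_right (le_max_right _ _)
    · have haW := hW a ha hai
      by_cases hki : k = i
      · subst hki
        have hbW := hW b hb hbk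
        rw [hzi' a haW, hzi' b hbW]
        by_cases hcc : c a = c b
        · rw [hcc]
          exact le_max_right _ _
        · rw [hdiff a haW b hbW hcc]
          exact le_max_of_le_left (le_max_left _ _)
      · have hkW := hW k hk hki
        by_cases hbi : b = i
        · subst hbi
          rw [hzi' a haW, hzi k hkW]
          exact hle a haW k hkW hak
        · have hbW := hW b hb hbi
          by_cases h1 : c a = c b
          · by_cases h2 : c b = c k
            · exact hz.ultra a haW b hbW k hkW hab hbk hak h1 h2 (by simp)
            · rw [hdiff a haW k hkW (h1 ▸ h2), hdiff b hbW k hkW h2, h1]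
              exact le_max_right _ _
          · rw [hdiff a haW b hbW h1]
            by_cases h2 : c b = c k
            · rw [h2]
              exact (hle a haW k hkW hak).trans (le_max_left _ _)
            · rw [hdiff b hbW k hkW h2]
              exact (hle a haW k hkW hak).trans (max_le
                (le_max_of_le_left (le_max_left _ _)) (le_max_of_le_right (le_max_right _ _)))

/-- Each vertex has an allowance of 50(n+1)^4 steps. The pivot spends its own on all work of the
call, and the other `w` vertices hand theirs down to the recursive calls. -/
theorem call_time_le {n L v w u : ℕ} (hv : v ≤ n) (hw : w + 1 = v) (hL : L ≤ n * n) (hu1 : 1 ≤ u)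
    (hu : u ≤ L) :
    1 + (1 + (v * 3 + (((L + 1) * (n * n) + v * v * ((u - 1) * 2 + 1)) +
      (w * (20 * (L + 1) + 3) + (w * w * 7 +
        ((L + 1 - u) * (w * 5 + 2) + 50 * (n + 1) ^ 4 * w)))))) ≤
      1 + 50 * (n + 1) ^ 4 * v := by
  set N := n + 1 with hN
  have hN1 : 1 ≤ N := by omega
  have hvN : v ≤ N := by omega
  have hwN : w ≤ N := by omega
  have hLN : L + 1 ≤ N ^ 2 := by
    rw [hN]
    nlinarith
  have hnN : n * n ≤ N ^ 2 := by
    rw [hN]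
    nlinarith
  have huN : (u - 1) * 2 + 1 ≤ 2 * N ^ 2 := by omega
  have hLu : L + 1 - u ≤ N ^ 2 := by omega
  have p1 : N ^ 2 ≤ N ^ 4 := Nat.pow_le_pow_right hN1 (by norm_num)
  have p2 : N ^ 3 ≤ N ^ 4 := Nat.pow_le_pow_right hN1 (by norm_num)
  have p3 : N ≤ N ^ 4 := Nat.le_self_pow (by norm_num) N
  have h1 : (L + 1) * (n * n) ≤ N ^ 4 := (Nat.mul_le_mul hLN hnN).trans (by ring_nf; rfl)
  have h2 : v * v * ((u - 1) * 2 + 1) ≤ 2 * N ^ 4 :=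
    (Nat.mul_le_mul (Nat.mul_le_mul hvN hvN) huN).trans (by ring_nf; rfl)
  have h3 : w * (20 * (L + 1) + 3) ≤ 20 * N ^ 3 + 3 * N :=
    (Nat.mul_le_mul hwN (Nat.add_le_add (Nat.mul_le_mul_left 20 hLN) le_rfl)).trans (by ring_nf; rfl)
  have h4 : w * w * 7 ≤ 7 * N ^ 2 :=
    (Nat.mul_le_mul_right 7 (Nat.mul_le_mul hwN hwN)).trans (by ring_nf; rfl)
  have h5 : (L + 1 - u) * (w * 5 + 2) ≤ 5 * N ^ 3 + 2 * N ^ 2 :=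
    (Nat.mul_le_mul hLu (Nat.add_le_add (Nat.mul_le_mul_right 5 hwN) le_rfl)).trans (by ring_nf; rfl)
  have h6 : 50 * N ^ 4 * v = 50 * N ^ 4 * w + 50 * N ^ 4 := by
    rw [← hw]
    ring
  rw [h6]
  generalize 50 * N ^ 4 * w = X
  generalize N ^ 4 = P4 at *
  omega

/-- Induction on the depth: removing the pivot makes every class smaller than `V`, so the
specification at the smaller depth applies to it. -/
theorem pivotSpec {I : Instance n} {y : ℕ → PairFun n} (hy : I.LPOptimal y)
    {f : Finset (Fin n) → (Fin n → ℕ) → ℝ} (hf : IsPotential f) :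
    ∀ depth, PivotSpec I y f (50 * (n + 1) ^ 4) depth
  | 0 => by
    intro V x u _ hlen _ _ _
    obtain rfl : V = [] := List.eq_nil_of_length_eq_zero (by omega)
    refine (Det.triple (Q := (· = x)) (T := 0) (det_pure rfl) ?_).mono (by omega) ?_ le_rfl
    · rintro _ rfl
      exact le_add_of_nonneg_right (hy.budget_nonneg hf _ _)
    · rintro _ rfl
      exact ⟨fun _ _ => rfl, by simp, by simp⟩
  | depth + 1 => by
    intro V x u hV hlen hu1 hu hx
    have huI : u ∈ Finset.Icc 1 I.numLevels := Finset.mem_Icc.2 ⟨hu1, hu⟩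
    rw [pivot]
    by_cases h : V.length ≤ 2 ∨ u = I.numLevels
    · refine ((det_charge 1).bind_triple (T' := 0) (Q' := (· = x)) (g' := I.goodCost y)
        (b := I.goodCost y x) fun _ _ => ?_).mono (by omega) ?_
        (le_add_of_nonneg_right (hy.budget_nonneg hf _ _))
      · rw [dif_pos h]
        refine Det.triple (det_pure rfl) ?_
        rintro _ rfl
        exact le_rfl
      · intro z hz
        rw [hz]
        have hval : ∀ a ∈ V, ∀ b ∈ V, a ≠ b →
            x s(a, b) = I.d (max (I.level s(a, b)) u) := by
          intro a ha b hb hab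
          rw [hx a ha b hb hab, ← I.min_d (I.level_mem (mem_edges hab)) huI,
            I.d_level (mem_edges hab)]
        refine ⟨fun _ _ => rfl, fun a ha b hb hab => ⟨_, ?_, ?_, hval a ha b hb hab⟩,
          fun a ha b hb k hk hab hbk hak => ?_⟩
        · exact le_max_right _ _
        · have := Finset.mem_Icc.1 (I.level_mem (mem_edges hab))
          omega
        · rcases h with h | h
          · exfalso
            have h3 : ({a, b, k} : Finset (Fin n)).card = 3 := Finset.card_eq_three.2
              ⟨a, b, k, hab, hak, hbk, rfl⟩
            have h4 : ({a, b, k} : Finset (Fin n)) ⊆ V.toFinset := by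
              intro j hj
              simp only [Finset.mem_insert, Finset.mem_singleton] at hj
              rw [List.mem_toFinset]
              rcases hj with rfl | rfl | rfl <;> assumption
            have h5 := Finset.card_le_card h4
            rw [List.toFinset_card_of_nodup hV] at h5
            omega
          · have hm : ∀ a ∈ V, ∀ b ∈ V, a ≠ b → x s(a, b) = I.d I.numLevels := by
              intro a ha b hb hab
              have := Finset.mem_Icc.1 (I.level_mem (mem_edges hab))
              rw [hval a ha b hb hab, h, max_eq_right this.2]
            rw [hm a ha k hk hak, hm a ha b hb hab]
            exact le_max_left _ _
    · have hVne : V ≠ [] := by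
        rintro rfl
        simp at h
      have hvn : V.length ≤ n := by
        rw [← List.toFinset_card_of_nodup hV]
        simpa using Finset.card_le_univ V.toFinset
      -- The list `W` is known only after the pivot is drawn, so the expectation is first taken
      -- along some list of the same vertices; `levelExp_roundBound` shows that the order is
      -- irrelevant.
      refine Triple.mono (b := (∑ i ∈ V.toFinset,
        levelExp I.numLevels I.d i (fun j => cdf y u s(i, j)) (I.roundBound y f V.toFinset x u i)
          (V.toFinset.erase i).toList x) / V.toFinset.card) ?_
        (call_time_le (w := V.length - 1) hvn (by
          have := List.length_pos_iff.2 hVne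
          omega) I.numLevels_le hu1 hu) (fun _ h => h) ?_
      swap
      · refine le_trans (le_of_eq ?_) (hy.sum_levelExp_roundBound hf hu1 hu
          ((List.toFinset_nonempty_iff V).2 hVne) x)
        congr 1
        refine Finset.sum_congr rfl fun i _ => ?_
        refine hy.levelExp_roundBound f hu1 hu _ x x i (Finset.nodup_toList _) fun j => ?_
        simp [and_comm]
      refine (det_charge 1).bind_triple fun _ _ => ?_
      rw [dif_neg h]
      refine (triple_pick V hVne _ fun i _ => ?_).bind fun i hi => ?_
      · refine levelExp_nonneg (hy.roundBound_nonneg hf _ _ _ _) _ (fun j hj => ?_) _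
        rw [Finset.mem_toList, Finset.mem_erase] at hj
        exact hy.isCdf hu1 hu (mem_edges hj.1.symm)
      refine (det_remove i V hV).bind_triple ?_
      rintro W ⟨hW, hWV⟩
      have hWf : W.toFinset = V.toFinset.erase i := by
        ext j
        simp [hWV, and_comm]
      have hWlen : W.length = V.length - 1 := by
        rw [← List.toFinset_card_of_nodup hW, hWf, Finset.card_erase_of_mem (by simpa using hi),
          List.toFinset_card_of_nodup hV]
      have hiW : i ∉ W := fun h => ((hWV i).1 h).2 rfl
      refine (det_truncate I.numLevels y hy.feasible.level_zero V u).bind_triple fun y' hy' => ?_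
      have hcdf : ∀ j ∈ W, IsCdf I.numLevels (cdf y u s(i, j)) := fun j hj =>
        hy.isCdf hu1 hu (mem_edges ((hWV j).1 hj).2.symm)
      rw [← hWlen]
      have hexp : levelExp I.numLevels I.d i (fun j => cdf y u s(i, j))
          (I.roundBound y f V.toFinset x u i) (V.toFinset.erase i).toList x =
          levelExp I.numLevels I.d i (fun j => cdf y u s(i, j))
          (I.roundBound y f V.toFinset x u i) W x := by
        rw [hy.levelExp_roundBound f hu1 hu _ x x i hW (fun j => by rw [hWV, List.mem_toFinset]),
          hy.levelExp_roundBound f hu1 hu _ x x i (Finset.nodup_toList _) fun j => by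
            simp [and_comm]]
      rw [hexp]
      refine (triple_pivotLevels (hu1.trans hu) I.d hW hcdf (fun j hj ℓ _ =>
        hy' i hi j ((hWV j).1 hj).1 ((hWV j).1 hj).2.symm ℓ)
        (hy.roundBound_nonneg hf V.toFinset x u i) x).bind ?_
      rintro x' ⟨hx', hx'x⟩
      have hx'f : ∀ j ∈ W.toFinset, ∃ a ∈ Finset.Icc 1 I.numLevels,
          0 < law I.numLevels (cdf y u s(i, j)) a ∧ x' s(i, j) = I.d a := by
        simpa using hx'
      choose! c hcI hcpos hcd using hx'
      have hc : ∀ j ∈ W, u ≤ c j ∧ c j ≤ I.numLevels := by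
        refine fun j hj => ⟨?_, (Finset.mem_Icc.1 (hcI j hj)).2⟩
        by_contra hlt
        have := hcpos j hj
        rw [Instance.law_cdf_eq_zero (not_le.1 hlt)] at this
        exact lt_irrefl _ this
      refine (det_fixEdges i x' W hW hiW).bind_triple ?_
      rintro z₀ ⟨hz₀, hz₀x'⟩
      have hxW : ∀ a ∈ W, ∀ b ∈ W, a ≠ b → x' s(a, b) = min (I.x s(a, b)) (I.d u) := by
        intro a ha b hb hab
        rw [hx'x, hx a ((hWV a).1 ha).1 b ((hWV b).1 hb).1 hab]
        intro j _ h
        rcases Sym2.eq_iff.1 h with ⟨rfl, -⟩ | ⟨-, rfl⟩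
        exacts [hiW ha, hiW hb]
      refine (triple_children (I := I) (y := y) hy hf (pivotSpec hy hf depth) hW (by omega) hiW hu1
        hc (z₀ := z₀) ?_ ?_).mono le_rfl ?_ ?_
      · intro j hj
        rw [hz₀x', hcd j hj]
        intro a ha b hb _ h
        rcases Sym2.eq_iff.1 h with ⟨rfl, -⟩ | ⟨rfl, -⟩
        exacts [hiW ha, hiW hb]
      · intro a ha b hb hab hcc
        -- Capping at d_u and then at the class distance is the same as capping at the class
        -- distance, since the class level is at least `u`.
        rw [hz₀ a ha b hb hab, hcd a ha, hcd b hb, hcc, fixValue, if_pos rfl, hxW a ha b hb hab,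
          min_assoc, min_eq_right ((I.d_le_iff (hcI b hb) huI).2 (hc b hb).1)]
      · exact fun z hz => hz.fitsOn hu1 hi hWV hc hcd hx'x hz₀ hz₀x'
      · have h1 := hy.goodCost_le (V := V.toFinset) (W := W.toFinset) (z := z₀) hu1 hu hWf
          (by simpa using hi) (by simpa using hx) hx'f (by simpa using hx'x) (by simpa using hz₀)
          (fun e he => hz₀x' e (by simpa using he))
        have h2 := hy.sum_budget_le hf hu1 hu hWf hx'f
        have h3 : ∑ ℓ ∈ Finset.Icc u I.numLevels,
            I.budget y f (W.toFinset.filter fun j => c j = ℓ) ℓ =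
            ∑ ℓ ∈ Finset.Icc u I.numLevels,
            I.budget y f (W.toFinset.filter fun j => x' s(i, j) = I.d ℓ) ℓ := by
          refine Finset.sum_congr rfl fun ℓ hℓ => ?_
          congr 1
          refine Finset.filter_congr fun j hj => ?_
          rw [List.mem_toFinset] at hj
          rw [hcd j hj, I.d_inj (hcI j hj)]
          rw [Finset.mem_Icc] at hℓ ⊢
          omega
        rw [h3]
        refine (add_le_add h1 h2).trans (le_of_eq ?_)
        rw [Instance.roundBound, add_assoc, ← Finset.sum_add_distrib, hWf]

/-! ## The approximation guarantee -/

theorem one_le_log (hn : 3 ≤ n) : 1 ≤ Real.log n := by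
  have h3 : (3 : ℝ) ≤ n := by exact_mod_cast hn
  rw [Real.le_log_iff_exp_le (by linarith)]
  linarith [Real.exp_one_lt_d9]

theorem harmonicPotential_le (hn : 3 ≤ n) (E : Finset (Fin n)) (m : Fin n → ℕ) :
    harmonicPotential E m ≤ 2 * Real.log n := by
  have h1 : (harmonic E.card : ℝ) ≤ harmonic n := by
    exact_mod_cast harmonic_mono (by simpa using Finset.card_le_univ E)
  have h2 := harmonic_le_one_add_log n
  have h3 := one_le_log hn
  unfold harmonicPotential
  linarith

theorem levelPotential_le {L : ℕ} (E : Finset (Fin n)) {m : Fin n → ℕ} (hm : ∀ k ∈ E, 1 ≤ m k)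
    (hL : ∀ k, m k ≤ L) : levelPotential E m ≤ L := by
  have : E.image m ⊆ Finset.Icc 1 L := by
    intro ℓ hℓ
    obtain ⟨k, hk, rfl⟩ := Finset.mem_image.1 hℓ
    exact Finset.mem_Icc.2 ⟨hm k hk, hL k⟩
  have h := Finset.card_le_card this
  rw [Nat.card_Icc, Nat.add_sub_cancel] at h
  unfold levelPotential
  exact_mod_cast h

namespace Instance

variable {I : Instance n} {y : ℕ → PairFun n}

theorem cost_nonneg (I : Instance n) (z : PairFun n) : 0 ≤ I.cost z := by
  refine Finset.sum_nonneg fun e he => ?_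
  have := I.w_nonneg' he
  split_ifs <;> first | assumption | exact le_rfl

theorem sum_w_mul_lp (I : Instance n) (y : ℕ → PairFun n) :
    ∑ p ∈ (Finset.univ : Finset (Fin n)).offDiag, I.w s(p.1, p.2) * I.lp y s(p.1, p.2) =
      2 * I.lpObjective y :=
  sum_offDiag_eq fun e => I.w e * I.lp y e

theorem LPOptimal.lpObjective_nonneg (hy : I.LPOptimal y) : 0 ≤ I.lpObjective y :=
  Finset.sum_nonneg fun _ he => mul_nonneg (I.w_nonneg' he) (hy.lp_nonneg he)

/-- A bad edge has `lp ≥ 1/3`, so its weight is at most three times its part of the objective. -/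
theorem LPOptimal.cost_le (hy : I.LPOptimal y) (z : PairFun n) :
    I.cost z ≤ I.goodCost y z + 6 * I.lpObjective y := by
  have h1 : 2 * I.cost z ≤ I.goodCost y z + 3 * (2 * I.lpObjective y) := by
    rw [← I.sum_w_mul_lp, cost, ← sum_offDiag_eq fun e => if z e ≠ I.x e then I.w e else 0,
      Finset.mul_sum, goodCost, ← Finset.sum_add_distrib]
    refine Finset.sum_le_sum fun p hp => ?_
    have he := mem_edges (Finset.mem_offDiag.1 hp).2.2
    have hw := I.w_nonneg' he
    have hlp := hy.lp_nonneg he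
    by_cases hz : z s(p.1, p.2) ≠ I.x s(p.1, p.2)
    · rw [if_pos hz]
      by_cases hg : I.lp y s(p.1, p.2) < 1 / 3
      · rw [if_pos ⟨hg, hz⟩]
        have := mul_nonneg hw hlp
        linarith
      · rw [if_neg fun h => hg h.1]
        nlinarith
    · rw [if_neg hz, if_neg fun h => hz h.2]
      have := mul_nonneg hw hlp
      linarith
  linarith [I.cost_nonneg z]

/-- The factor is 54 = 27 · 2, because the budget runs over ordered pairs. -/
theorem LPOptimal.budget_le (hy : I.LPOptimal y) {f : Finset (Fin n) → (Fin n → ℕ) → ℝ} {M : ℝ}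
    (hM : ∀ j k, f (I.eligible y 1 Finset.univ j k) (fun i => I.detLevel y s(i, j)) ≤ M) :
    I.budget y f Finset.univ 1 ≤ 54 * (1 + M) * I.lpObjective y := by
  have : 54 * (1 + M) * I.lpObjective y = 27 * (2 * I.lpObjective y * (1 + M)) := by ring
  rw [this, ← I.sum_w_mul_lp, budget, Finset.sum_mul]
  refine mul_le_mul_of_nonneg_left (Finset.sum_le_sum fun p hp => ?_) (by norm_num)
  have he := mem_edges (Finset.mem_offDiag.1 hp).2.2
  exact mul_le_mul_of_nonneg_left (add_le_add le_rfl (hM _ _))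
    (mul_nonneg (I.w_nonneg' he) (hy.lp_nonneg he))

/-- The algorithm with the budget for a given potential. -/
theorem LPOptimal.triple_pivot (hy : I.LPOptimal y) (hn : 3 ≤ n)
    {f : Finset (Fin n) → (Fin n → ℕ) → ℝ} (hf : IsPotential f) {M : ℝ}
    (hM : ∀ j k, f (I.eligible y 1 Finset.univ j k) (fun i => I.detLevel y s(i, j)) ≤ M) :
    Triple (pivot (1 / 3) 0 I.numLevels I.d (fun q => y q.1 q.2) n (List.finRange n) I.x 1)
      (1 + 50 * (n + 1) ^ 4 * n) IsUltrametric I.cost ((60 + 54 * M) * I.lpObjective y) := by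
  have hL : 1 ≤ I.numLevels :=
    I.one_le_numLevels (i := ⟨0, by omega⟩) (j := ⟨1, by omega⟩) (by simp)
  have h1I : 1 ∈ Finset.Icc 1 I.numLevels := Finset.mem_Icc.2 ⟨le_rfl, hL⟩
  have h := pivotSpec hy hf n (List.finRange n) I.x 1 (List.nodup_finRange n) (by simp) le_rfl hL
    fun a _ b _ hab => by
      have hl := I.level_mem (mem_edges hab)
      rw [← I.d_level (mem_edges hab), I.min_d hl h1I, max_eq_left (Finset.mem_Icc.1 hl).1]
  have huniv : (List.finRange n).toFinset = Finset.univ := by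
    ext i
    simp
  have hgood : I.goodCost y I.x = 0 := by simp [goodCost]
  rw [huniv, hgood, zero_add] at h
  refine ((h.add_const (C := 6 * I.lpObjective y) (hy.budget_nonneg hf _ _)
    (mul_nonneg (by norm_num) hy.lpObjective_nonneg)).mono_right hy.cost_le).mono
    (by simp) ?_ ?_
  · intro z hz
    have hdiag : ∀ i, z s(i, i) = 0 := by
      intro i
      rw [hz.eq_of_notMem, I.x_self]
      intro a _ b _ hab h
      rcases Sym2.eq_iff.1 h with ⟨rfl, rfl⟩ | ⟨rfl, rfl⟩ <;> exact hab rfl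
    have hpos : ∀ i j, i ≠ j → 0 < z s(i, j) := by
      intro i j hij
      obtain ⟨ℓ, h1, h2, h3⟩ := hz.value i (List.mem_finRange i) j (List.mem_finRange j) hij
      rw [h3]
      exact I.d_pos (Finset.mem_Icc.2 ⟨h1, h2⟩)
    refine ⟨hdiag, hpos, fun i j k => ?_⟩
    by_cases hij : i = j
    · subst hij
      exact le_max_right _ _
    by_cases hjk : j = k
    · subst hjk
      exact le_max_left _ _
    by_cases hik : i = k
    · subst hik
      rw [hdiag]
      exact le_max_of_le_left (hpos i j hij).le
    exact hz.ultra i (List.mem_finRange i) j (List.mem_finRange j) k (List.mem_finRange k) hij hjk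
      hik
  · linarith [hy.budget_le hM]

/-- With at most two vertices the algorithm returns the input distances, which are an ultrametric. -/
theorem triple_pivot_of_le_two (I : Instance n) (y : ℕ → PairFun n) (hn : n ≤ 2) :
    Triple (pivot (1 / 3) 0 I.numLevels I.d (fun q => y q.1 q.2) n (List.finRange n) I.x 1)
      1 IsUltrametric I.cost 0 := by
  have hult : IsUltrametric I.x := by
    refine ⟨I.x_self, I.x_pos, fun i j k => ?_⟩
    by_cases hij : i = j
    · subst hij
      exact le_max_right _ _
    by_cases hjk : j = k
    · subst hjk
      exact le_max_left _ _
    have hik : i = k := by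
      have h1 := Fin.val_ne_of_ne hij
      have h2 := Fin.val_ne_of_ne hjk
      ext
      omega
    subst hik
    rw [I.x_self]
    exact le_max_of_le_left (I.x_pos i j hij).le
  have hcost : I.cost I.x = 0 := by simp [cost]
  have hdet : Det (pivot (1 / 3) 0 I.numLevels I.d (fun q => y q.1 q.2) n (List.finRange n) I.x 1)
      1 (· = I.x) := by
    have hlen : (List.finRange n).length ≤ 2 := by simpa using hn
    generalize List.finRange n = V at hlen
    cases n with
    | zero => exact (det_pure (Q := (· = I.x)) rfl).mono (by omega) fun _ h => h
    | succ k =>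
      rw [pivot]
      refine (det_charge 1).bind (T' := 0) fun _ _ => ?_
      rw [dif_pos (Or.inl hlen)]
      exact det_pure rfl
  refine (hdet.triple ?_).mono le_rfl ?_ le_rfl
  · rintro _ rfl
    exact hcost.le
  · rintro _ rfl
    exact hult

end Instance

end UMVD

end

/-! ### The main theorem. -/

theorem theorem6 :
    ∃ (C : ℝ) (p : Polynomial ℕ), ∀ (n : ℕ) (I : UMVD.Instance n),
      (∃ y : ℕ → UMVD.PairFun n, I.LPOptimal y) ∧
      ∀ y : ℕ → UMVD.PairFun n, I.LPOptimal y →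
        (∀ r ∈ (UMVD.algorithm (1 / 3) 0 I y).support,
          UMVD.IsUltrametric r.1 ∧ r.2 ≤ p.eval n) ∧
        UMVD.expectedCost I (UMVD.algorithm (1 / 3) 0 I y) ≤
          ENNReal.ofReal (C * min (I.numLevels : ℝ) (Real.log n) * I.opt) := by
  -- The bound is (60 + 54M) times the LP value, where 60 = 54 + 6 includes the bad edges. M = 2 log
  -- n with log n ≥ 1 gives 168 log n; M = L gives 114 L.
  refine ⟨168, 1 + Polynomial.C 50 * (Polynomial.X + 1) ^ 4 * Polynomial.X, fun n I =>
    ⟨I.exists_lpOptimal, fun y hy => ?_⟩⟩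
  have heval : (1 + Polynomial.C 50 * (Polynomial.X + 1) ^ 4 * Polynomial.X : Polynomial ℕ).eval n =
      1 + 50 * (n + 1) ^ 4 * n := by simp
  rw [heval]
  rcases le_or_gt n 2 with hn | hn
  -- Here log n may be 0, but the output is the input and has cost 0.
  · have h := I.triple_pivot_of_le_two y hn 0
    refine ⟨fun r hr => ⟨(h.1 r hr).1, (h.1 r hr).2.trans (by omega)⟩, h.2.trans ?_⟩
    rw [ENNReal.ofReal_zero]
    exact zero_le
  · have hlp := hy.lpObjective_nonneg
    have hopt := I.lpObjective_le_opt hy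
    have h1 := hy.triple_pivot hn UMVD.isPotential_harmonicPotential
      fun _ _ => UMVD.harmonicPotential_le hn _ _
    have h2 := hy.triple_pivot hn UMVD.isPotential_levelPotential fun j k =>
      UMVD.levelPotential_le (L := I.numLevels) (I.eligible y 1 Finset.univ j k) (fun i hi => by
        have := (Finset.mem_filter.1 hi).2.2.2.2
        omega) fun i => UMVD.Instance.detLevel_le _
    refine ⟨fun r hr => by simpa using (h1 0).1 r hr, ?_⟩
    have hlog := UMVD.one_le_log hn
    have hL : (1 : ℝ) ≤ I.numLevels := by
      exact_mod_cast I.one_le_numLevels (i := ⟨0, by omega⟩) (j := ⟨1, by omega⟩) (by simp)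
    have key : ∀ K : ℝ, 0 ≤ K → K * I.lpObjective y ≤ K * I.opt := fun K hK =>
      mul_le_mul_of_nonneg_left hopt hK
    rcases min_choice (I.numLevels : ℝ) (Real.log n) with h | h
    · refine (h2 0).2.trans (ENNReal.ofReal_le_ofReal ?_)
      rw [h]
      refine le_trans ?_ (key _ (by positivity))
      exact mul_le_mul_of_nonneg_right (by linarith) hlp
    · refine (h1 0).2.trans (ENNReal.ofReal_le_ofReal ?_)
      rw [h]
      refine le_trans ?_ (key _ (by positivity))
      exact mul_le_mul_of_nonneg_right (by linarith) hlp
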